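/- Let $n,k\ge 1$ be integers and let $P=\sum_{|\alpha|\le k}a_\alpha\partial^\alpha$ be a constant coefficient partial differential operator on $\mathbb R^n$ with complex coefficients which is elliptic of order $k$, formally self-adjoint and bounded from below. Let $\Omega\subset\mathbb R^n$ be a nonempty bounded open set, let $H^k_0(\Omega)$ be the closure of $C_c^\infty(\Omega)$ in the norm of $H^k(\Omega)$, and let $H^k_P(\Omega)=\{w\in L^2(\Omega): Pw\in L^2(\Omega)\}$, where $Pw$ is taken in the sense of distributions. Let $V\in L^\infty(\Omega)$ be complex-valued and such that in some neighbourhood of $\partial\Omega$ it only takes values (almost everywhere) in some closed complex half-plane not containing zero. Let $e\in\{0,1,\dots,k-1\}$, and for each multi-index $\alpha$ with $1\le|\alpha|\le e$ let $W_\alpha\in W^{|\alpha|,\infty}(\Omega)$ be complex-valued and vanish (almost everywhere) outside some compact subset of $\Omega$. Put \[ W=\sum_{1\le|\alpha|\le e}W_\alpha\partial^\alpha \] ($W=0$ if $e=0$). Let $\mu,\nu\in\{0,1\}$, and for $\lambda>0$ let $B=B(\lambda)$ be the operator \[ B=\begin{bmatrix}P+\mu W&\lambda^{-\nu}W+V\\0&P\end{bmatrix}\colon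 H^k_0(\Omega)\times H^k_P(\Omega)\longrightarrow L^2(\Omega)\times L^2(\Omega). \] Then there is $\lambda_0>0$ such that for all real $\lambda\ge\lambda_0$ the operator $B$ is well defined on all of $H^k_0(\Omega)\times H^k_P(\Omega)$, the operator $B+\lambda$ is bijective, and its inverse is \[ (B+\lambda)^{-1}=\begin{bmatrix}R_{11}&R_{12}\\R_{21}&R_{22}\end{bmatrix}\colon L^2(\Omega)\times L^2(\Omega)\longrightarrow L^2(\Omega)\times L^2(\Omega) \] with bounded operators $R_{ij}=R_{ij}(\lambda)$ on $L^2(\Omega)$. Here $R_{11}$, $R_{12}$ and $R_{22}$ are compact, and $\chi R_{21}$ is compact for every $\chi\in C_c^\infty(\Omega)$. The operators $\partial^\alpha R_{11}$ and $\partial^\alpha R_{12}$ are bounded on $L^2(\Omega)$ for $|\alpha|\le k$ and compact for $1\le|\alpha|<k$, and $\partial^\alpha\chi R_{21}$ and $\partial^\alpha\chi R_{22}$ are compact on $L^2(\Omega)$ for $1\le|\alpha|<k$ and every $\chi\in C_c^\infty(\Omega)$. Furthermore, for all $\lambda\ge\lambda_0$, every multi-index $\alpha$ with $|\alpha|\le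 k$, every $\varepsilon>0$ and every $\chi\in C_c^\infty(\Omega)$, the operator norms on $L^2(\Omega)$ satisfy \[ \|\partial^\alpha R_{11}\|\le C\lambda^{|\alpha|/k-1},\qquad \|\partial^\alpha R_{12}\|\le C_\varepsilon\lambda^{\varepsilon+(1-\nu)e/k+|\alpha|/k-2},\qquad \|R_{22}\|\le C_\varepsilon\lambda^{\varepsilon+e/k-1}, \] \[ \|R_{21}\|\le C,\qquad \|\chi R_{21}\|\le C_\chi\lambda^{-1/k}, \] where the constants do not depend on $\lambda$; besides the data $n,k,P,\Omega,V,e,W,\mu,\nu$, the constant $C_\varepsilon$ depends only on $\varepsilon$ and $C_\chi$ only on $\chi$. -/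

import Mathlib

open MeasureTheory TopologicalSpace
open scoped Distributions LineDeriv ENNReal

noncomputable section

/-- The Euclidean space `ℝⁿ`. -/
abbrev Rn (n : ℕ) : Type := EuclideanSpace ℝ (Fin n)

/-- The complex Hilbert space `L²(Ω)`. -/
abbrev L2 {n : ℕ} (Ω : Opens (Rn n)) : Type := Lp ℂ 2 (volume.restrict (Ω : Set (Rn n)))

/-- The length `|α|` of a multi-index. -/
def mlen {n : ℕ} (α : Fin n → ℕ) : ℕ := ∑ i, α i

/-- The finite set of multi-indices `α` with `a ≤ |α| ≤ b`. -/
def multiIndices (n a b : ℕ) : Finset (Fin n → ℕ) :=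
  (Finset.Icc a b).biUnion fun m => Finset.piAntidiag Finset.univ m

theorem mem_multiIndices {n a b : ℕ} {α : Fin n → ℕ} :
    α ∈ multiIndices n a b ↔ a ≤ mlen α ∧ mlen α ≤ b := by
  simp [multiIndices, mlen]

/-- The derivative `∂^α φ = ∂₁^{α₁} ⋯ ∂ₙ^{αₙ} φ` of a test function. -/
def mderiv {n : ℕ} {Ω : Opens (Rn n)} (α : Fin n → ℕ) (φ : 𝓓(Ω, ℂ)) : 𝓓(Ω, ℂ) :=
  (List.finRange n).foldr
    (fun i ψ => (fun η : 𝓓(Ω, ℂ) => ∂_{EuclideanSpace.single i (1 : ℝ)} η)^[α i] ψ) φ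

/-- `g` is the weak derivative `∂^α f` in `Ω`. -/
def HasWeakDeriv {n : ℕ} (Ω : Opens (Rn n)) (α : Fin n → ℕ) (f g : Rn n → ℂ) : Prop :=
  LocallyIntegrableOn f (Ω : Set (Rn n)) ∧ LocallyIntegrableOn g (Ω : Set (Rn n)) ∧
    ∀ φ : 𝓓(Ω, ℂ),
      ∫ x in (Ω : Set (Rn n)), g x * φ x =
        (-1) ^ mlen α * ∫ x in (Ω : Set (Rn n)), f x * mderiv α φ x

/-- The constant coefficient operator `∑_{|α| ≤ k} a_α ∂^α` acting on test functions. -/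
def constCoeffOp {n : ℕ} {Ω : Opens (Rn n)} (k : ℕ) (a : (Fin n → ℕ) → ℂ)
    (φ : 𝓓(Ω, ℂ)) : 𝓓(Ω, ℂ) :=
  ∑ α ∈ multiIndices n 0 k, a α • mderiv α φ

/-- `P = ∑_{|α| ≤ k} a_α ∂^α` is elliptic of order `k`. -/
def IsEllipticOp {n : ℕ} (k : ℕ) (a : (Fin n → ℕ) → ℂ) : Prop :=
  ∀ ξ : Rn n, ξ ≠ 0 → ∑ α ∈ multiIndices n k k, a α * ∏ i, ((ξ i : ℝ) : ℂ) ^ α i ≠ 0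

/-- `P` coincides with its formal adjoint `∑_{|α| ≤ k} (-1)^{|α|} conj(a_α) ∂^α`. -/
def IsFormallySelfAdjointOp {n : ℕ} (k : ℕ) (a : (Fin n → ℕ) → ℂ) : Prop :=
  ∀ α ∈ multiIndices n 0 k, (-1) ^ mlen α * (starRingEnd ℂ) (a α) = a α

/-- `P` is bounded from below: `⟨P φ, φ⟩ ≥ -C ‖φ‖²` for all `φ ∈ C_c^∞(ℝⁿ)`. -/
def IsBoundedBelowOp {n : ℕ} (k : ℕ) (a : (Fin n → ℕ) → ℂ) : Prop :=
  ∃ C : ℝ, ∀ φ : 𝓓((⊤ : Opens (Rn n)), ℂ),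
    -C * ∫ x, ‖φ x‖ ^ 2 ≤ (∫ x, constCoeffOp k a φ x * (starRingEnd ℂ) (φ x)).re

/-- `P u = g` in the sense of distributions in `Ω`. -/
def DistribEq {n : ℕ} (Ω : Opens (Rn n)) (k : ℕ) (a : (Fin n → ℕ) → ℂ) (u g : L2 Ω) : Prop :=
  ∀ φ : 𝓓(Ω, ℂ),
    ∫ x in (Ω : Set (Rn n)), g x * φ x =
      ∫ x in (Ω : Set (Rn n)), u x * constCoeffOp k (fun α => (-1) ^ mlen α * a α) φ x

/-- `u ∈ H^k_0(Ω)`: the closure of `C_c^∞(Ω)` in the norm of `H^k(Ω)`. -/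
def MemH0 {n : ℕ} (Ω : Opens (Rn n)) (k : ℕ) (u : L2 Ω) : Prop :=
  ∃ D : (Fin n → ℕ) → L2 Ω,
    (∀ α ∈ multiIndices n 0 k, HasWeakDeriv Ω α u (D α)) ∧
    ∀ δ : ℝ, 0 < δ → ∃ φ : 𝓓(Ω, ℂ), ∀ α ∈ multiIndices n 0 k,
      eLpNorm (fun x => D α x - mderiv α φ x) 2 (volume.restrict (Ω : Set (Rn n))) <
        ENNReal.ofReal δ

/-- `w ∈ H^k_P(Ω)`: the distribution `P w` belongs to `L²(Ω)`. -/
def MemHP {n : ℕ} (Ω : Opens (Rn n)) (k : ℕ) (a : (Fin n → ℕ) → ℂ) (w : L2 Ω) : Prop :=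
  ∃ g : L2 Ω, DistribEq Ω k a w g

/-- `f ∈ W^{m,p}_c(Ω)`: the function `f` is in `W^{m,p}(Ω)` and vanishes (almost everywhere)
outside some compact subset of `Ω`. -/
def MemSobolevC {n : ℕ} (Ω : Opens (Rn n)) (m : ℕ) (p : ℝ≥0∞) (f : Rn n → ℂ) : Prop :=
  MemLp f p (volume.restrict (Ω : Set (Rn n))) ∧
  (∀ β ∈ multiIndices n 0 m, ∃ g : Rn n → ℂ,
    MemLp g p (volume.restrict (Ω : Set (Rn n))) ∧ HasWeakDeriv Ω β f g) ∧
  ∃ K : Set (Rn n), IsCompact K ∧ K ⊆ Ω ∧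
    ∀ᵐ x ∂volume.restrict (Ω : Set (Rn n)), x ∉ K → f x = 0

/-- In some neighbourhood of `∂Ω`, the function `V` only takes values (almost everywhere) in some
closed half-plane `{z | Re (c z) ≥ δ}`, `c ≠ 0`, `δ > 0`, of `ℂ`. These are exactly the closed
half-planes which do not contain zero. -/
def CoerciveNearBoundary {n : ℕ} (Ω : Opens (Rn n)) (V : Rn n → ℂ) : Prop :=
  ∃ U : Set (Rn n), IsOpen U ∧ frontier (Ω : Set (Rn n)) ⊆ U ∧
    ∃ (c : ℂ) (δ : ℝ), c ≠ 0 ∧ 0 < δ ∧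
      ∀ᵐ x ∂volume.restrict (Ω : Set (Rn n)), x ∈ U → δ ≤ (c * V x).re

/-- `z = W w`, where `W = ∑_{1 ≤ |α| ≤ e} W_α ∂^α`, the derivatives being weak ones.
For `e = 0` this says `z = 0`. -/
def LowerOrderEq {n : ℕ} (Ω : Opens (Rn n)) (e : ℕ) (W : (Fin n → ℕ) → Rn n → ℂ)
    (w z : L2 Ω) : Prop :=
  ∃ D : (Fin n → ℕ) → Rn n → ℂ,
    (∀ α ∈ multiIndices n 1 e, HasWeakDeriv Ω α w (D α)) ∧
    ∀ᵐ x ∂volume.restrict (Ω : Set (Rn n)), z x = ∑ α ∈ multiIndices n 1 e, W α x * D α x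

/-- The graph of the Born approximation
`B = [[P + μ W, λ^{-ν} W + V], [0, P]] : H^k_0(Ω) × H^k_P(Ω) → L²(Ω) × L²(Ω)`:
the pair `p = (u, w)` is in the domain `H^k_0(Ω) × H^k_P(Ω)` and `B (u, w) = q`. -/
def BornGraph {n : ℕ} (Ω : Opens (Rn n)) (k e : ℕ) (a : (Fin n → ℕ) → ℂ)
    (W : (Fin n → ℕ) → Rn n → ℂ) (V : Rn n → ℂ) (μ ν : ℕ) (lam : ℝ)
    (p q : L2 Ω × L2 Ω) : Prop :=
  MemH0 Ω k p.1 ∧ MemHP Ω k a p.2 ∧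
  ∃ Pu Wu Ww : L2 Ω,
    DistribEq Ω k a p.1 Pu ∧ LowerOrderEq Ω e W p.1 Wu ∧ LowerOrderEq Ω e W p.2 Ww ∧
    (∀ᵐ x ∂volume.restrict (Ω : Set (Rn n)),
      q.1 x = (Pu x + (μ : ℂ) * Wu x) + (((lam : ℂ) ^ ν)⁻¹ * Ww x + V x * p.2 x)) ∧
    DistribEq Ω k a p.2 q.2

/-- The operator `T` is `∂^α R`. -/
def IsDerivOp {n : ℕ} (Ω : Opens (Rn n)) (α : Fin n → ℕ) (R T : L2 Ω →L[ℂ] L2 Ω) : Prop :=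
  ∀ f : L2 Ω, HasWeakDeriv Ω α (R f) (T f)

/-- The operator `T` is `χ R`, multiplication by `χ ∈ C_c^∞(Ω)` composed with `R`. -/
def IsCutoffOp {n : ℕ} (Ω : Opens (Rn n)) (χ : 𝓓(Ω, ℂ)) (R T : L2 Ω →L[ℂ] L2 Ω) : Prop :=
  ∀ f : L2 Ω, ∀ᵐ x ∂volume.restrict (Ω : Set (Rn n)), T f x = χ x * R f x

end

/-!
Write `λ = s ^ k`. Extending by zero and inverting `P + λ` on the whole space by the Fourier
transform gives an operator `G` on `L²(Ω)` with `(P + λ) G = 1` and `‖∂^α G‖ = O(λ^(|α|/k - 1))`.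
If `Π` is the orthogonal projection of `L²(Ω)` onto the kernel of `P + λ`, then `G (1 - Π)` has
range `H^k_0(Ω)`, and the solutions of `(P + λ) w = g` are `w = G g + Π z`. In the coordinates
`u = G (1 - Π) z`, `w = G g + Π z` the first row of `B + λ` becomes
`(1 - Π + V Π + E) z + X g`, where `E` collects the contributions of `W` and is `O(λ^((e - k)/k))`.

If `x` lies in the kernel, then `(P + λ) (χ x) = [P, χ] x` involves only derivatives of `x` of
order less than `k`, for every cut-off `χ`. Estimating these one order at a time shows that
`‖χ Π‖ = O(λ⁻¹)`: elements of the kernel concentrate near `∂Ω`, where `V` is coercive. Hence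
`1 - Π + V Π` is invertible uniformly in `λ`, and so is its small perturbation by `E`.
-/

noncomputable section

variable {n : ℕ} {Ω : Opens (Rn n)}

/-- The partial derivative `∂ᵢ` as a linear map on test functions. -/
def partialDeriv (i : Fin n) : 𝓓(Ω, ℂ) →ₗ[ℂ] 𝓓(Ω, ℂ) :=
  (TestFunction.lineDerivCLM ℂ (EuclideanSpace.single i (1 : ℝ)) : 𝓓(Ω, ℂ) →L[ℂ] 𝓓(Ω, ℂ))

theorem partialDeriv_apply (i : Fin n) (φ : 𝓓(Ω, ℂ)) (x : Rn n) :
    partialDeriv i φ x = fderiv ℝ φ x (EuclideanSpace.single i 1) := by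
  change TestFunction.lineDerivCLM ℂ (EuclideanSpace.single i (1 : ℝ)) φ x = _
  rw [TestFunction.lineDerivCLM_eq_fderivCLM, TestFunction.fderivCLM_apply_of_le _ (by simp)]

/-- The word in the letters `0, …, n - 1` in which `i` occurs `α i` times; `∂^α` is the
composition of the `∂ᵢ` along it, which makes induction on `|α|` possible. -/
def multiIndexList (α : Fin n → ℕ) : List (Fin n) :=
  (List.finRange n).flatMap fun i => List.replicate (α i) i

theorem length_multiIndexList (α : Fin n → ℕ) : (multiIndexList α).length = mlen α := by
  simp [multiIndexList, List.length_flatMap, mlen, Fin.sum_univ_def]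

theorem prod_pow_eq_prod_map_multiIndexList (α : Fin n → ℕ) (c : Fin n → ℂ) :
    ∏ i, c i ^ α i = ((multiIndexList α).map c).prod := by
  rw [Fin.prod_univ_def, multiIndexList]
  induction List.finRange n with
  | nil => simp
  | cons i l ih => simp [ih, List.flatMap_cons]

theorem mderiv_eq_foldr (α : Fin n → ℕ) (φ : 𝓓(Ω, ℂ)) :
    mderiv α φ = (multiIndexList α).foldr (fun i ψ => partialDeriv i ψ) φ := by
  rw [mderiv, multiIndexList]
  induction List.finRange n with
  | nil => simp
  | cons i l ih =>
    rw [List.foldr_cons, ih, List.flatMap_cons, List.foldr_append]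
    generalize List.foldr _ φ _ = ψ
    induction α i with
    | zero => simp
    | succ m ihm =>
      rw [Function.iterate_succ_apply', ihm, List.replicate_succ, List.foldr_cons]
      rfl

theorem differentiableAt_testFunction (φ : 𝓓(Ω, ℂ)) (x : Rn n) : DifferentiableAt ℝ φ x :=
  (φ.contDiff.differentiable (by simp)).differentiableAt

theorem integrable_testFunction (φ : 𝓓(Ω, ℂ)) (μ : Measure (Rn n)) [IsFiniteMeasureOnCompacts μ] :
    Integrable φ μ :=
  φ.continuous.integrable_of_hasCompactSupport φ.hasCompactSupport

theorem integral_partialDeriv (i : Fin n) (φ : 𝓓(Ω, ℂ)) : ∫ x, partialDeriv i φ x = 0 := by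
  have h := integral_mul_fderiv_eq_neg_fderiv_mul_of_integrable (μ := (volume : Measure (Rn n)))
    (f := fun _ : Rn n => (1 : ℂ)) (g := φ) (v := EuclideanSpace.single i 1) (by simp)
    (by simpa only [one_mul, ← partialDeriv_apply] using integrable_testFunction _ _)
    (by simpa using integrable_testFunction _ _)
    (fun x _ => by fun_prop) (fun x _ => differentiableAt_testFunction φ x)
  simpa [partialDeriv_apply] using h

theorem setIntegral_mul_testFunction (φ : 𝓓(Ω, ℂ)) (f : Rn n → ℂ) :
    ∫ x in (Ω : Set (Rn n)), f x * φ x = ∫ x, f x * φ x := by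
  refine setIntegral_eq_integral_of_forall_compl_eq_zero fun x hx => ?_
  rw [image_eq_zero_of_notMem_tsupport fun h => hx (φ.tsupport_subset h), mul_zero]

/-- The distribution `φ ↦ ∫ f φ` on `Ω`; it is zero when `f` is not locally integrable. -/
def testPairing (f : Rn n → ℂ) : 𝓓(Ω, ℂ) →ₗ[ℂ] ℂ :=
  (TestFunction.integralAgainstBilinCLM (ContinuousLinearMap.mul ℂ ℂ) volume f :
    𝓓(Ω, ℂ) →L[ℂ] ℂ)

theorem testPairing_apply {f : Rn n → ℂ} (hf : LocallyIntegrableOn f (Ω : Set (Rn n)))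
    (φ : 𝓓(Ω, ℂ)) : testPairing f φ = ∫ x in (Ω : Set (Rn n)), f x * φ x := by
  rw [setIntegral_mul_testFunction]
  refine (TestFunction.integralAgainstBilinCLM_eq_integral hf).trans ?_
  simp only [ContinuousLinearMap.mul_apply', mul_comm]

/-- The complex conjugate of a test function. -/
def conjTest (φ : 𝓓(Ω, ℂ)) : 𝓓(Ω, ℂ) :=
  ⟨fun x => (starRingEnd ℂ) (φ x), Complex.conjCLE.contDiff.comp φ.contDiff,
    φ.hasCompactSupport.comp_left (map_zero _),
    (tsupport_comp_subset (map_zero (starRingEnd ℂ)) φ).trans φ.tsupport_subset⟩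

@[simp] theorem conjTest_apply (φ : 𝓓(Ω, ℂ)) (x : Rn n) :
    conjTest φ x = (starRingEnd ℂ) (φ x) := rfl

@[simp] theorem conjTest_conjTest (φ : 𝓓(Ω, ℂ)) : conjTest (conjTest φ) = φ := by ext x; simp

theorem partialDeriv_conjTest (i : Fin n) (φ : 𝓓(Ω, ℂ)) :
    partialDeriv i (conjTest φ) = conjTest (partialDeriv i φ) := by
  ext x
  have h : (conjTest φ : Rn n → ℂ) = Complex.conjCLE ∘ φ := rfl
  rw [conjTest_apply, partialDeriv_apply, partialDeriv_apply, h, Complex.conjCLE.comp_fderiv]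
  rfl

theorem mderiv_conjTest (α : Fin n → ℕ) (φ : 𝓓(Ω, ℂ)) :
    mderiv α (conjTest φ) = conjTest (mderiv α φ) := by
  rw [mderiv_eq_foldr, mderiv_eq_foldr]
  induction multiIndexList α with
  | nil => rfl
  | cons i L ih => simp only [List.foldr_cons, ih, partialDeriv_conjTest]

/-- The symbol `2πiξⱼ` of `∂ⱼ`, for the Fourier transform `∫ f(x) exp(-2πi⟨x, ξ⟩) dx`. -/
def partialSymbol (j : Fin n) (ξ : Rn n) : ℂ := 2 * Real.pi * Complex.I * (ξ j : ℝ)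

/-- The symbol `(2πiξ)^α` of `∂^α`. -/
def monomialSymbol (α : Fin n → ℕ) (ξ : Rn n) : ℂ := ∏ i, partialSymbol i ξ ^ α i

@[simp] theorem partialSymbol_neg (i : Fin n) (ξ : Rn n) :
    partialSymbol i (-ξ) = -partialSymbol i ξ := by
  simp [partialSymbol]

theorem monomialSymbol_eq_prod_map (α : Fin n → ℕ) (ξ : Rn n) :
    monomialSymbol α ξ = ((multiIndexList α).map (partialSymbol · ξ)).prod :=
  prod_pow_eq_prod_map_multiIndexList α _

theorem monomialSymbol_smul (α : Fin n → ℕ) (t : ℝ) (ξ : Rn n) :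
    monomialSymbol α (t • ξ) = (t : ℂ) ^ mlen α * monomialSymbol α ξ := by
  have h (i : Fin n) : partialSymbol i (t • ξ) = t * partialSymbol i ξ := by
    simp only [partialSymbol, PiLp.smul_apply, smul_eq_mul, Complex.ofReal_mul]
    ring
  simp_rw [monomialSymbol, h, mul_pow, Finset.prod_mul_distrib, Finset.prod_pow_eq_pow_sum, mlen]

theorem monomialSymbol_neg (α : Fin n → ℕ) (ξ : Rn n) :
    monomialSymbol α (-ξ) = (-1) ^ mlen α * monomialSymbol α ξ := by
  simpa using monomialSymbol_smul α (-1) ξ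

theorem conj_monomialSymbol (α : Fin n → ℕ) (ξ : Rn n) :
    (starRingEnd ℂ) (monomialSymbol α ξ) = (-1) ^ mlen α * monomialSymbol α ξ := by
  rw [← monomialSymbol_neg]
  simp [monomialSymbol, partialSymbol, map_ofNat]

theorem norm_partialSymbol_le (i : Fin n) (ξ : Rn n) : ‖partialSymbol i ξ‖ ≤ 2 * Real.pi * ‖ξ‖ := by
  have h : |ξ i| ≤ ‖ξ‖ := PiLp.norm_apply_le ξ i
  simp only [partialSymbol, norm_mul, Complex.norm_ofNat, Complex.norm_real, Complex.norm_I,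
    Real.norm_eq_abs, abs_of_pos Real.pi_pos, mul_one]
  gcongr

theorem norm_prod_map_partialSymbol_le (L : List (Fin n)) (ξ : Rn n) :
    ‖(L.map (partialSymbol · ξ)).prod‖ ≤ (2 * Real.pi * ‖ξ‖) ^ L.length := by
  induction L with
  | nil => simp
  | cons i L ih =>
    rw [List.map_cons, List.prod_cons, norm_mul, List.length_cons, pow_succ']
    exact mul_le_mul (norm_partialSymbol_le i ξ) ih (norm_nonneg _) (by positivity)

theorem norm_monomialSymbol_le (α : Fin n → ℕ) (ξ : Rn n) :
    ‖monomialSymbol α ξ‖ ≤ (2 * Real.pi) ^ mlen α * ‖ξ‖ ^ mlen α := by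
  rw [monomialSymbol_eq_prod_map, ← mul_pow, ← length_multiIndexList]
  exact norm_prod_map_partialSymbol_le _ ξ

theorem continuous_monomialSymbol (α : Fin n → ℕ) : Continuous (monomialSymbol α) := by
  unfold monomialSymbol partialSymbol
  fun_prop

/-- The plane wave `exp (-2πi⟨x, ξ⟩)`. -/
def planeWave (ξ x : Rn n) : ℂ := Real.fourierChar (-inner ℝ x ξ)

@[simp] theorem norm_planeWave (ξ x : Rn n) : ‖planeWave ξ x‖ = 1 := Circle.norm_coe _

theorem planeWave_eq_exp (ξ x : Rn n) :
    planeWave ξ x = Complex.exp ((2 * Real.pi * -inner ℝ x ξ : ℝ) * Complex.I) :=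
  Real.fourierChar_apply _

theorem contDiff_planeWave (ξ : Rn n) {m : WithTop ℕ∞} : ContDiff ℝ m (planeWave ξ) := by
  rw [show planeWave ξ = _ from funext (planeWave_eq_exp ξ)]
  exact ((Complex.ofRealCLM.contDiff.comp (contDiff_const.mul
    (contDiff_id.inner ℝ contDiff_const).neg)).mul contDiff_const).cexp

theorem continuous_planeWave (x : Rn n) : Continuous fun ξ => planeWave ξ x := by
  simp only [planeWave_eq_exp]
  fun_prop

theorem fderiv_planeWave (ξ x : Rn n) (i : Fin n) :
    fderiv ℝ (planeWave ξ) x (EuclideanSpace.single i 1) =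
      partialSymbol i (-ξ) * planeWave ξ x := by
  have h : fderiv ℝ (planeWave ξ) x (EuclideanSpace.single i 1) = -2 * Real.pi * Complex.I *
      (inner ℝ (EuclideanSpace.single i 1) ξ : ℝ) * planeWave ξ x :=
    Real.fderiv_fourierChar_neg_bilinear_left_apply (innerSL ℝ) x _ ξ
  simp [h, partialSymbol, EuclideanSpace.inner_single_left]

/-- Multiplication of test functions by a smooth function. -/
def smoothMul (g : Rn n → ℂ) (hg : ContDiff ℝ (⊤ : ℕ∞) g) : 𝓓(Ω, ℂ) →ₗ[ℂ] 𝓓(Ω, ℂ) where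
  toFun φ := ⟨fun x => g x * φ x, hg.mul φ.contDiff, φ.hasCompactSupport.mul_left,
    (tsupport_mul_subset_right (f := g)).trans φ.tsupport_subset⟩
  map_add' φ ψ := by ext x; simp [mul_add]
  map_smul' c φ := by ext x; simp [mul_left_comm]

/-- Multiplication of test functions by a plane wave. -/
def modulate (ξ : Rn n) : 𝓓(Ω, ℂ) →ₗ[ℂ] 𝓓(Ω, ℂ) := smoothMul (planeWave ξ) (contDiff_planeWave ξ)

@[simp] theorem modulate_apply (ξ : Rn n) (φ : 𝓓(Ω, ℂ)) (x : Rn n) :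
    modulate ξ φ x = planeWave ξ x * φ x := rfl

theorem partialDeriv_modulate (ξ : Rn n) (i : Fin n) (φ : 𝓓(Ω, ℂ)) :
    partialDeriv i (modulate ξ φ) =
      modulate ξ (partialDeriv i φ + partialSymbol i (-ξ) • φ) := by
  ext x
  have h : (modulate ξ φ : Rn n → ℂ) = fun y => planeWave ξ y * φ y := rfl
  rw [partialDeriv_apply, h, fderiv_fun_mul
    ((contDiff_planeWave ξ (m := 1)).differentiable (by simp)).differentiableAt
    (differentiableAt_testFunction φ x)]
  simp only [add_apply, smul_apply, smul_eq_mul, fderiv_planeWave, modulate_apply,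
    partialDeriv_apply]
  ring

/-- The Fourier transform of the restriction of `f` to `Ω`. -/
def fourierOn (Ω : Opens (Rn n)) (f : Rn n → ℂ) (ξ : Rn n) : ℂ :=
  ∫ x in (Ω : Set (Rn n)), f x * planeWave ξ x

theorem fourierOn_testFunction (φ : 𝓓(Ω, ℂ)) (ξ : Rn n) :
    fourierOn Ω φ ξ = ∫ x, modulate ξ φ x := by
  simp only [fourierOn, modulate_apply, ← setIntegral_mul_testFunction φ (planeWave ξ), mul_comm]

theorem fourierOn_partialDeriv (i : Fin n) (φ : 𝓓(Ω, ℂ)) (ξ : Rn n) :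
    fourierOn Ω (partialDeriv i φ) ξ = partialSymbol i ξ * fourierOn Ω φ ξ := by
  have h := integral_partialDeriv i (modulate ξ φ)
  rw [partialDeriv_modulate, map_add, map_smul] at h
  simp only [add_apply, smul_apply, smul_eq_mul] at h
  rw [integral_add (integrable_testFunction _ _) ((integrable_testFunction _ _).const_mul _),
    integral_const_mul, ← fourierOn_testFunction, ← fourierOn_testFunction, partialSymbol_neg] at h
  linear_combination h

theorem fourierOn_mderiv (α : Fin n → ℕ) (φ : 𝓓(Ω, ℂ)) (ξ : Rn n) :
    fourierOn Ω (mderiv α φ) ξ = monomialSymbol α ξ * fourierOn Ω φ ξ := by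
  rw [mderiv_eq_foldr, monomialSymbol_eq_prod_map]
  induction multiIndexList α with
  | nil => simp
  | cons i L ih =>
    simp only [List.foldr_cons, fourierOn_partialDeriv, ih, List.map_cons, List.prod_cons,
      mul_assoc]

/-- The functions of growth `O((1 + ‖ξ‖)^d)`, the only property of symbols of order `d` that is
used here. -/
def symbolClass (E : Type*) [SeminormedAddCommGroup E] (d : ℤ) : Submodule ℂ (E → ℂ) where
  carrier := {q | ∃ C : ℝ, 0 ≤ C ∧ ∀ ξ, ‖q ξ‖ ≤ C * (1 + ‖ξ‖) ^ d}
  zero_mem' := ⟨0, le_rfl, by simp⟩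
  add_mem' := by
    rintro q r ⟨C, hC, hq⟩ ⟨D, hD, hr⟩
    exact ⟨C + D, add_nonneg hC hD, fun ξ => (norm_add_le_of_le (hq ξ) (hr ξ)).trans_eq
      (add_mul _ _ _).symm⟩
  smul_mem' := by
    rintro c q ⟨C, hC, hq⟩
    refine ⟨‖c‖ * C, by positivity, fun ξ => ?_⟩
    rw [Pi.smul_apply, norm_smul, mul_assoc]
    exact mul_le_mul_of_nonneg_left (hq ξ) (norm_nonneg c)

section SymbolClass

variable {E : Type*} [SeminormedAddCommGroup E] {d d' : ℤ} {q r : E → ℂ}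

theorem symbolClass_mono (h : d ≤ d') : symbolClass E d ≤ symbolClass E d' := by
  rintro q ⟨C, hC, hq⟩
  refine ⟨C, hC, fun ξ => (hq ξ).trans ?_⟩
  gcongr
  linarith [norm_nonneg ξ]

theorem mul_mem_symbolClass (hq : q ∈ symbolClass E d) (hr : r ∈ symbolClass E d') :
    (fun ξ => q ξ * r ξ) ∈ symbolClass E (d + d') := by
  obtain ⟨C, hC, hq⟩ := hq
  obtain ⟨D, hD, hr⟩ := hr
  refine ⟨C * D, by positivity, fun ξ => ?_⟩
  have hpos : 0 < 1 + ‖ξ‖ := by positivity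
  calc ‖q ξ * r ξ‖ ≤ (C * (1 + ‖ξ‖) ^ d) * (D * (1 + ‖ξ‖) ^ d') :=
        norm_mul_le_of_le (hq ξ) (hr ξ)
    _ = C * D * (1 + ‖ξ‖) ^ (d + d') := by rw [zpow_add₀ hpos.ne']; ring

end SymbolClass

theorem prod_map_partialSymbol_neg_mem_symbolClass (L : List (Fin n)) :
    (fun ξ => (L.map (partialSymbol · (-ξ))).prod) ∈ symbolClass (Rn n) L.length := by
  refine ⟨(2 * Real.pi) ^ L.length, by positivity, fun ξ => ?_⟩
  rw [zpow_natCast, ← mul_pow]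
  refine (norm_prod_map_partialSymbol_le L (-ξ)).trans ?_
  rw [norm_neg]
  gcongr
  linarith

theorem monomialSymbol_mem_symbolClass (α : Fin n → ℕ) :
    monomialSymbol α ∈ symbolClass (Rn n) (mlen α) := by
  refine ⟨(2 * Real.pi) ^ mlen α, by positivity, fun ξ => ?_⟩
  rw [zpow_natCast]
  refine (norm_monomialSymbol_le α ξ).trans ?_
  gcongr
  linarith

/-- The families `ξ ↦ X ξ` of test functions which are finite sums of products `q ξ • χ`, with `q`
of order `d` and `χ` fixed. These are the remainders in commuting a differential operator past a
plane wave. -/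
def testSymbolClass (Ω : Opens (Rn n)) (d : ℤ) : Submodule ℂ (Rn n → 𝓓(Ω, ℂ)) :=
  Submodule.span ℂ {X | ∃ q ∈ symbolClass (Rn n) d, ∃ χ : 𝓓(Ω, ℂ), X = fun ξ => q ξ • χ}

section TestSymbolClass

variable {d d' : ℤ} {q : Rn n → ℂ} {X : Rn n → 𝓓(Ω, ℂ)}

theorem smul_const_mem_testSymbolClass (hq : q ∈ symbolClass (Rn n) d) (χ : 𝓓(Ω, ℂ)) :
    (fun ξ => q ξ • χ) ∈ testSymbolClass Ω d :=
  Submodule.subset_span ⟨q, hq, χ, rfl⟩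

theorem testSymbolClass_mono (h : d ≤ d') : testSymbolClass Ω d ≤ testSymbolClass Ω d' :=
  Submodule.span_mono fun _ ⟨q, hq, hX⟩ => ⟨q, symbolClass_mono h hq, hX⟩

theorem map_mem_testSymbolClass (T : 𝓓(Ω, ℂ) →ₗ[ℂ] 𝓓(Ω, ℂ)) (hX : X ∈ testSymbolClass Ω d) :
    (fun ξ => T (X ξ)) ∈ testSymbolClass Ω d := by
  suffices h : testSymbolClass Ω d ≤ (testSymbolClass Ω d).comap (T.compLeft (Rn n)) from h hX
  refine Submodule.span_le.2 ?_
  rintro _ ⟨q, hq, χ, rfl⟩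
  change (fun ξ => T (q ξ • χ)) ∈ testSymbolClass Ω d
  simpa only [map_smul] using smul_const_mem_testSymbolClass hq (T χ)

theorem smul_mem_testSymbolClass (hq : q ∈ symbolClass (Rn n) d) (hX : X ∈ testSymbolClass Ω d') :
    (fun ξ => q ξ • X ξ) ∈ testSymbolClass Ω (d + d') := by
  suffices h : testSymbolClass Ω d' ≤ (testSymbolClass Ω (d + d')).comap
    (LinearMap.pi fun ξ => q ξ • LinearMap.proj ξ) from h hX
  refine Submodule.span_le.2 ?_
  rintro _ ⟨r, hr, χ, rfl⟩
  change (fun ξ => q ξ • r ξ • χ) ∈ testSymbolClass Ω (d + d')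
  simpa only [smul_smul] using smul_const_mem_testSymbolClass (mul_mem_symbolClass hq hr) χ

theorem exists_norm_apply_le_sum (hX : X ∈ testSymbolClass Ω d) :
    ∃ C : ℝ, 0 ≤ C ∧ ∃ S : Finset 𝓓(Ω, ℂ), ∀ (ℓ : 𝓓(Ω, ℂ) →ₗ[ℂ] ℂ) (ξ : Rn n),
      ‖ℓ (X ξ)‖ ≤ C * (1 + ‖ξ‖) ^ d * ∑ χ ∈ S, ‖ℓ χ‖ := by
  classical
  induction hX using Submodule.span_induction with
  | mem X hX =>
    obtain ⟨q, ⟨C, hC, hq⟩, χ, rfl⟩ := hX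
    refine ⟨C, hC, {χ}, fun ℓ ξ => ?_⟩
    rw [map_smul, norm_smul, Finset.sum_singleton]
    exact mul_le_mul_of_nonneg_right (hq ξ) (norm_nonneg _)
  | zero => exact ⟨0, le_rfl, ∅, fun ℓ ξ => by simp⟩
  | add X Y _ _ hX hY =>
    obtain ⟨C, hC, S, hX⟩ := hX
    obtain ⟨D, hD, T, hY⟩ := hY
    refine ⟨C + D, add_nonneg hC hD, S ∪ T, fun ℓ ξ => ?_⟩
    rw [Pi.add_apply, map_add, add_mul, add_mul]
    refine norm_add_le_of_le ((hX ℓ ξ).trans ?_) ((hY ℓ ξ).trans ?_) <;> gcongr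
    exacts [Finset.subset_union_left, Finset.subset_union_right]
  | smul c X _ hX =>
    obtain ⟨C, hC, S, hX⟩ := hX
    refine ⟨‖c‖ * C, by positivity, S, fun ℓ ξ => ?_⟩
    rw [Pi.smul_apply, map_smul, norm_smul, mul_assoc, mul_assoc, ← mul_assoc C]
    exact mul_le_mul_of_nonneg_left (hX ℓ ξ) (norm_nonneg c)

theorem apply_mem_symbolClass (ℓ : 𝓓(Ω, ℂ) →ₗ[ℂ] ℂ) (hX : X ∈ testSymbolClass Ω d) :
    (fun ξ => ℓ (X ξ)) ∈ symbolClass (Rn n) d := by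
  obtain ⟨C, hC, S, h⟩ := exists_norm_apply_le_sum hX
  refine ⟨C * ∑ χ ∈ S, ‖ℓ χ‖, by positivity, fun ξ => (h ℓ ξ).trans_eq ?_⟩
  ring

end TestSymbolClass

theorem exists_foldr_partialDeriv_modulate (L : List (Fin n)) (χ : 𝓓(Ω, ℂ)) :
    ∃ X ∈ testSymbolClass Ω ((L.length : ℤ) - 1), ∀ ξ,
      L.foldr (fun i ψ => partialDeriv i ψ) (modulate ξ χ) =
        modulate ξ ((L.map (partialSymbol · (-ξ))).prod • χ + X ξ) := by
  induction L with
  | nil => exact ⟨0, zero_mem _, fun ξ => by simp⟩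
  | cons i L ih =>
    obtain ⟨X, hX, h⟩ := ih
    refine ⟨fun ξ => partialDeriv i (X ξ) + ((L.map (partialSymbol · (-ξ))).prod • partialDeriv i χ
      + partialSymbol i (-ξ) • X ξ), add_mem ?_ (add_mem ?_ ?_), fun ξ => ?_⟩
    · exact testSymbolClass_mono (by simp) (map_mem_testSymbolClass (partialDeriv i) hX)
    · exact testSymbolClass_mono (by simp) (smul_const_mem_testSymbolClass
        (prod_map_partialSymbol_neg_mem_symbolClass L) _)
    · have hi := prod_map_partialSymbol_neg_mem_symbolClass [i]
      simp only [List.map_cons, List.map_nil, List.prod_singleton] at hi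
      exact testSymbolClass_mono (by simp) (smul_mem_testSymbolClass hi hX)
    · rw [List.foldr_cons, h, partialDeriv_modulate, List.map_cons, List.prod_cons]
      congr 1
      simp only [map_add, map_smul]
      module

theorem exists_mderiv_modulate (α : Fin n → ℕ) (χ : 𝓓(Ω, ℂ)) :
    ∃ X ∈ testSymbolClass Ω ((mlen α : ℤ) - 1), ∀ ξ,
      mderiv α (modulate ξ χ) = modulate ξ (monomialSymbol α (-ξ) • χ + X ξ) := by
  simp_rw [mderiv_eq_foldr, monomialSymbol_eq_prod_map, ← length_multiIndexList]
  exact exists_foldr_partialDeriv_modulate _ χ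

/-- The symbol of the constant coefficient operator `∑ a_α ∂^α`. -/
def opSymbol (k : ℕ) (a : (Fin n → ℕ) → ℂ) (ξ : Rn n) : ℂ :=
  ∑ α ∈ multiIndices n 0 k, a α * monomialSymbol α ξ

/-- The part of `opSymbol k a` which is homogeneous of degree `k`. -/
def principalSymbol (k : ℕ) (a : (Fin n → ℕ) → ℂ) (ξ : Rn n) : ℂ :=
  ∑ α ∈ multiIndices n k k, a α * monomialSymbol α ξ

section OpSymbol

variable (k : ℕ) (a : (Fin n → ℕ) → ℂ)

theorem continuous_opSymbol : Continuous (opSymbol k a) :=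
  continuous_finsetSum _ fun α _ => continuous_const.mul (continuous_monomialSymbol α)

theorem continuous_principalSymbol : Continuous (principalSymbol k a) :=
  continuous_finsetSum _ fun α _ => continuous_const.mul (continuous_monomialSymbol α)

theorem opSymbol_adjoint_neg (ξ : Rn n) :
    opSymbol k (fun α => (-1) ^ mlen α * a α) (-ξ) = opSymbol k a ξ := by
  refine Finset.sum_congr rfl fun α _ => ?_
  have h : ((-1 : ℂ) ^ mlen α) * (-1) ^ mlen α = 1 := by rw [← mul_pow]; simp
  rw [monomialSymbol_neg]
  linear_combination a α * monomialSymbol α ξ * h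

theorem integrableOn_testFunction_mul_planeWave (φ : 𝓓(Ω, ℂ)) (ξ : Rn n) :
    IntegrableOn (fun x => φ x * planeWave ξ x) (Ω : Set (Rn n)) := by
  refine (integrable_testFunction (modulate ξ φ) _).congr (.of_forall fun x => ?_)
  exact mul_comm _ _

theorem fourierOn_constCoeffOp (φ : 𝓓(Ω, ℂ)) (ξ : Rn n) :
    fourierOn Ω (constCoeffOp k a φ) ξ = opSymbol k a ξ * fourierOn Ω φ ξ := by
  simp only [fourierOn, constCoeffOp, sum_apply, smul_apply, smul_eq_mul, Finset.sum_mul, mul_assoc]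
  rw [integral_finsetSum _ fun α _ => (integrableOn_testFunction_mul_planeWave _ ξ).const_mul _]
  simp only [integral_const_mul, opSymbol, Finset.sum_mul]
  refine Finset.sum_congr rfl fun α _ => ?_
  rw [← fourierOn, fourierOn_mderiv, fourierOn, mul_assoc]

theorem exists_constCoeffOp_modulate (χ : 𝓓(Ω, ℂ)) :
    ∃ X ∈ testSymbolClass Ω ((k : ℤ) - 1), ∀ ξ,
      constCoeffOp k a (modulate ξ χ) = modulate ξ (opSymbol k a (-ξ) • χ + X ξ) := by
  choose X hX h using fun α : Fin n → ℕ => exists_mderiv_modulate α χ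
  refine ⟨∑ α ∈ multiIndices n 0 k, a α • X α, sum_mem fun α hα => Submodule.smul_mem _ _
    (testSymbolClass_mono (by have := (mem_multiIndices.1 hα).2; lia) (hX α)), fun ξ => ?_⟩
  simp only [constCoeffOp, h, ← map_smul, ← map_sum, opSymbol, Finset.sum_smul, Finset.sum_apply,
    Pi.smul_apply, smul_add, Finset.sum_add_distrib, smul_smul]

theorem exists_adjoint_modulate (χ : 𝓓(Ω, ℂ)) :
    ∃ X ∈ testSymbolClass Ω ((k : ℤ) - 1), ∀ ξ,
      constCoeffOp k (fun α => (-1) ^ mlen α * a α) (modulate ξ χ) =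
        modulate ξ (opSymbol k a ξ • χ + X ξ) := by
  simpa only [opSymbol_adjoint_neg] using
    exists_constCoeffOp_modulate k (fun α => (-1) ^ mlen α * a α) χ

end OpSymbol

section SymbolBounds

variable {k : ℕ} {a : (Fin n → ℕ) → ℂ}

theorem principalSymbol_smul (t : ℝ) (ξ : Rn n) :
    principalSymbol k a (t • ξ) = (t : ℂ) ^ k * principalSymbol k a ξ := by
  rw [principalSymbol, principalSymbol, Finset.mul_sum]
  refine Finset.sum_congr rfl fun α hα => ?_
  obtain ⟨h₁, h₂⟩ := mem_multiIndices.1 hα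
  rw [monomialSymbol_smul, le_antisymm h₂ h₁, mul_left_comm]

theorem principalSymbol_smul_re (t : ℝ) (ξ : Rn n) :
    (principalSymbol k a (t • ξ)).re = t ^ k * (principalSymbol k a ξ).re := by
  rw [principalSymbol_smul, ← Complex.ofReal_pow, Complex.re_ofReal_mul]

variable (k a) in
theorem opSymbol_sub_principalSymbol_mem_symbolClass :
    (fun ξ => opSymbol k a ξ - principalSymbol k a ξ) ∈ symbolClass (Rn n) ((k : ℤ) - 1) := by
  have hsub : multiIndices n k k ⊆ multiIndices n 0 k := fun α hα =>
    mem_multiIndices.2 ⟨Nat.zero_le _, (mem_multiIndices.1 hα).2⟩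
  have heq : (fun ξ => opSymbol k a ξ - principalSymbol k a ξ) =
      ∑ α ∈ multiIndices n 0 k \ multiIndices n k k, a α • monomialSymbol α := by
    ext1 ξ
    rw [opSymbol, principalSymbol, ← Finset.sum_sdiff hsub, add_sub_cancel_right]
    simp
  rw [heq]
  refine sum_mem fun α hα => Submodule.smul_mem _ _ (symbolClass_mono ?_
    (monomialSymbol_mem_symbolClass α))
  rw [Finset.mem_sdiff, mem_multiIndices, mem_multiIndices] at hα
  lia

theorem conj_principalSymbol (hsa : IsFormallySelfAdjointOp k a) (ξ : Rn n) :
    (starRingEnd ℂ) (principalSymbol k a ξ) = principalSymbol k a ξ := by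
  rw [principalSymbol, map_sum]
  refine Finset.sum_congr rfl fun α hα => ?_
  rw [map_mul, conj_monomialSymbol]
  linear_combination monomialSymbol α ξ *
    hsa α (mem_multiIndices.2 ⟨Nat.zero_le _, (mem_multiIndices.1 hα).2⟩)

theorem principalSymbol_ne_zero (hell : IsEllipticOp k a) {ξ : Rn n} (hξ : ξ ≠ 0) :
    principalSymbol k a ξ ≠ 0 := by
  have h : principalSymbol k a ξ = (2 * Real.pi * Complex.I) ^ k *
      ∑ α ∈ multiIndices n k k, a α * ∏ i, ((ξ i : ℝ) : ℂ) ^ α i := by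
    rw [principalSymbol, Finset.mul_sum]
    refine Finset.sum_congr rfl fun α hα => ?_
    obtain ⟨h₁, h₂⟩ := mem_multiIndices.1 hα
    have hm : monomialSymbol α ξ =
        (2 * Real.pi * Complex.I) ^ mlen α * ∏ i, ((ξ i : ℝ) : ℂ) ^ α i := by
      simp_rw [monomialSymbol, partialSymbol, mul_pow _ ((ξ _ : ℝ) : ℂ), Finset.prod_mul_distrib,
        Finset.prod_pow_eq_pow_sum, mlen]
    rw [hm, le_antisymm h₂ h₁, mul_left_comm]
  rw [h]
  exact mul_ne_zero (pow_ne_zero _ (by simp [Real.pi_ne_zero])) (hell ξ hξ)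

theorem exists_testFunction_eq_one {K : Set (Rn n)} (hK : IsCompact K) (hKΩ : K ⊆ Ω) :
    ∃ χ : 𝓓(Ω, ℂ), ∃ U : Set (Rn n), IsOpen U ∧ K ⊆ U ∧ ∀ x ∈ U, χ x = 1 := by
  obtain ⟨L, hL, hKL, hLΩ⟩ := exists_compact_between hK Ω.isOpen hKΩ
  obtain ⟨M, hM, hLM, hMΩ⟩ := exists_compact_between hL Ω.isOpen hLΩ
  obtain ⟨f, hf, -, hsupp, hone⟩ := exists_contMDiff_support_eq_eq_one_iff
    (modelWithCornersSelf ℝ (Rn n)) (n := (⊤ : ℕ∞)) isOpen_interior hL.isClosed hLM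
  have hts : tsupport f ⊆ M := by
    rw [tsupport, hsupp]
    exact closure_minimal interior_subset hM.isClosed
  have hf_compact : HasCompactSupport f := hM.of_isClosed_subset (isClosed_tsupport _) hts
  refine ⟨⟨fun x => (f x : ℂ), Complex.ofRealCLM.contDiff.comp hf.contDiff,
    hf_compact.comp_left Complex.ofReal_zero,
    (tsupport_comp_subset Complex.ofReal_zero f).trans (hts.trans hMΩ)⟩,
    interior L, isOpen_interior, hKL, fun x hx => ?_⟩
  change ((f x : ℝ) : ℂ) = 1
  rw [(hone x).1 (interior_subset hx), Complex.ofReal_one]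

theorem exists_testFunction_integral_norm_sq_pos :
    ∃ χ : 𝓓((⊤ : Opens (Rn n)), ℂ), 0 < ∫ x, ‖χ x‖ ^ 2 := by
  obtain ⟨χ, U, -, hU, hχ⟩ := exists_testFunction_eq_one (Ω := (⊤ : Opens (Rn n)))
    (isCompact_singleton (x := 0)) (fun _ _ => trivial)
  have hcont : Continuous fun x => ‖χ x‖ ^ 2 := by fun_prop
  have hcompact : HasCompactSupport fun x => ‖χ x‖ ^ 2 :=
    χ.hasCompactSupport.comp_left (g := fun z : ℂ => ‖z‖ ^ 2) (by simp)
  exact ⟨χ, hcont.integral_pos_of_hasCompactSupport_nonneg_nonzero (x := 0) hcompact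
    (fun x => by positivity) (by simp [hχ 0 (hU rfl)])⟩

theorem integral_modulate_mul_conj_modulate (φ χ : 𝓓(Ω, ℂ)) (ξ : Rn n) :
    ∫ x, modulate ξ φ x * (starRingEnd ℂ) (modulate ξ χ x) =
      ∫ x, φ x * (starRingEnd ℂ) (χ x) := by
  refine integral_congr_ae (.of_forall fun x => ?_)
  have h : planeWave ξ x * (starRingEnd ℂ) (planeWave ξ x) = 1 := by
    rw [Complex.mul_conj, Complex.normSq_eq_norm_sq, norm_planeWave, one_pow, Complex.ofReal_one]
  simp only [modulate_apply, map_mul]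
  linear_combination φ x * (starRingEnd ℂ) (χ x) * h

theorem testPairing_conjTest_apply (χ φ : 𝓓(Ω, ℂ)) :
    testPairing (conjTest χ) φ = ∫ x, φ x * (starRingEnd ℂ) (χ x) := by
  rw [testPairing_apply ((conjTest χ).continuous.locallyIntegrable.locallyIntegrableOn _),
    setIntegral_mul_testFunction]
  simp only [conjTest_apply, mul_comm]

theorem testPairing_conjTest_self (χ : 𝓓(Ω, ℂ)) :
    testPairing (conjTest χ) χ = (∫ x, ‖χ x‖ ^ 2 : ℝ) := by
  simp [testPairing_conjTest_apply, ← integral_complex_ofReal, Complex.mul_conj,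
    Complex.normSq_eq_norm_sq]

-- Testing `⟨P φ, φ⟩ ≥ -C ‖φ‖²` on wave packets of frequency `-ξ` reads off the symbol at `ξ`.
theorem IsBoundedBelowOp.exists_neg_le_opSymbol_re (hk : 1 ≤ k) (hbb : IsBoundedBelowOp k a) :
    ∃ C : ℝ, 0 ≤ C ∧ ∀ ξ, -(C * (1 + ‖ξ‖) ^ ((k : ℤ) - 1)) ≤ (opSymbol k a ξ).re := by
  obtain ⟨C, hC⟩ := hbb
  obtain ⟨χ, hA⟩ := exists_testFunction_integral_norm_sq_pos (n := n)
  obtain ⟨X, hX, hP⟩ := exists_constCoeffOp_modulate k a χ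
  obtain ⟨D, hD, hDX⟩ := apply_mem_symbolClass (testPairing (conjTest χ)) hX
  set A : ℝ := ∫ x, ‖χ x‖ ^ 2
  refine ⟨(|C| * A + D) / A, by positivity, fun ξ => ?_⟩
  have hnorm : ∫ x, ‖modulate (-ξ) χ x‖ ^ 2 = A := by simp [A]
  have hpair : ∫ x, constCoeffOp k a (modulate (-ξ) χ) x * (starRingEnd ℂ) (modulate (-ξ) χ x) =
      opSymbol k a ξ * A + testPairing (conjTest χ) (X (-ξ)) := by
    rw [hP, integral_modulate_mul_conj_modulate, ← testPairing_conjTest_apply, map_add, map_smul,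
      testPairing_conjTest_self, neg_neg, smul_eq_mul]
  have hlow : -C * A ≤ (opSymbol k a ξ).re * A + (testPairing (conjTest χ) (X (-ξ))).re := by
    have h := hC (modulate (-ξ) χ)
    rwa [hnorm, hpair, Complex.add_re, Complex.re_mul_ofReal] at h
  have hrem : (testPairing (conjTest χ) (X (-ξ))).re ≤ D * (1 + ‖ξ‖) ^ ((k : ℤ) - 1) := by
    simpa using (Complex.re_le_norm _).trans (hDX (-ξ))
  have hone : 1 ≤ (1 + ‖ξ‖) ^ ((k : ℤ) - 1) :=
    one_le_zpow₀ (by linarith [norm_nonneg ξ]) (by lia)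
  have hCA : C * A ≤ |C| * A * (1 + ‖ξ‖) ^ ((k : ℤ) - 1) :=
    (mul_le_mul_of_nonneg_right (le_abs_self C) hA.le).trans
      (le_mul_of_one_le_right (by positivity) hone)
  rw [neg_le, div_mul_eq_mul_div, le_div_iff₀ hA]
  linarith

theorem exists_neg_le_principalSymbol_re (hk : 1 ≤ k) (hbb : IsBoundedBelowOp k a) :
    ∃ C : ℝ, 0 ≤ C ∧ ∀ ξ, -(C * (1 + ‖ξ‖) ^ ((k : ℤ) - 1)) ≤ (principalSymbol k a ξ).re := by
  obtain ⟨C, hC, hop⟩ := hbb.exists_neg_le_opSymbol_re hk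
  obtain ⟨D, hD, hlow⟩ := opSymbol_sub_principalSymbol_mem_symbolClass k a
  refine ⟨C + D, by positivity, fun ξ => ?_⟩
  have h := (Complex.re_le_norm _).trans (hlow ξ)
  rw [Complex.sub_re] at h
  linarith [hop ξ]

theorem principalSymbol_re_nonneg (hk : 1 ≤ k) (hbb : IsBoundedBelowOp k a) (ξ : Rn n) :
    0 ≤ (principalSymbol k a ξ).re := by
  obtain ⟨C, hC, h⟩ := exists_neg_le_principalSymbol_re hk hbb
  obtain ⟨j, rfl⟩ : ∃ j, k = j + 1 := ⟨k - 1, by lia⟩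
  set D : ℝ := C * (1 + ‖ξ‖) ^ j
  by_contra! hneg
  -- By homogeneity the lower bound at `t • ξ` improves by the factor `t` as `t → ∞`.
  have hscale (t : ℝ) (ht : 1 ≤ t) : -D ≤ t * (principalSymbol (j + 1) a ξ).re := by
    have ht₀ : 0 < t := by linarith
    have hgrowth : (1 + ‖t • ξ‖) ^ j ≤ t ^ j * (1 + ‖ξ‖) ^ j := by
      rw [norm_smul, Real.norm_of_nonneg ht₀.le, ← mul_pow]
      gcongr
      linarith
    have ht := h (t • ξ)
    rw [principalSymbol_smul_re, Nat.cast_succ, add_sub_cancel_right, zpow_natCast] at ht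
    refine le_of_mul_le_mul_left (a := t ^ j) ?_ (by positivity)
    calc t ^ j * -D = -(C * (t ^ j * (1 + ‖ξ‖) ^ j)) := by ring
      _ ≤ -(C * (1 + ‖t • ξ‖) ^ j) := by gcongr
      _ ≤ t ^ j * (t * (principalSymbol (j + 1) a ξ).re) := by rwa [← mul_assoc, ← pow_succ]
  set r := (principalSymbol (j + 1) a ξ).re
  have hcontra := hscale (1 + D / -r) (le_add_of_nonneg_right
    (div_nonneg (by positivity) (by linarith)))
  have hcancel : (1 + D / -r) * r = r - D := by
    field_simp [hneg.ne]
    ring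
  linarith

theorem principalSymbol_re_pos (hk : 1 ≤ k) (hell : IsEllipticOp k a)
    (hsa : IsFormallySelfAdjointOp k a) (hbb : IsBoundedBelowOp k a) {ξ : Rn n} (hξ : ξ ≠ 0) :
    0 < (principalSymbol k a ξ).re := by
  refine (principalSymbol_re_nonneg hk hbb ξ).lt_of_ne' fun h => principalSymbol_ne_zero hell hξ ?_
  exact Complex.ext h (Complex.conj_eq_iff_im.1 (conj_principalSymbol hsa ξ))

theorem exists_mul_norm_pow_le_principalSymbol_re (hk : 1 ≤ k) (hell : IsEllipticOp k a)
    (hsa : IsFormallySelfAdjointOp k a) (hbb : IsBoundedBelowOp k a) :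
    ∃ c : ℝ, 0 < c ∧ ∀ ξ, c * ‖ξ‖ ^ k ≤ (principalSymbol k a ξ).re := by
  have hcont : Continuous fun ξ => (principalSymbol k a ξ).re :=
    Complex.continuous_re.comp (continuous_principalSymbol k a)
  obtain ⟨c, hc, hsphere⟩ := (isCompact_sphere (0 : Rn n) 1).exists_forall_le' hcont.continuousOn
    (a := 0) fun ξ hξ => principalSymbol_re_pos hk hell hsa hbb (ne_zero_of_mem_unit_sphere ⟨ξ, hξ⟩)
  refine ⟨c, hc, fun ξ => ?_⟩
  rcases eq_or_ne ξ 0 with rfl | hξ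
  · simpa [show k ≠ 0 by lia] using principalSymbol_re_nonneg hk hbb (0 : Rn n)
  · have hpos : 0 < ‖ξ‖ := norm_pos_iff.2 hξ
    rw [← smul_inv_smul₀ hpos.ne' ξ, principalSymbol_smul_re, smul_inv_smul₀ hpos.ne', mul_comm]
    gcongr
    exact hsphere _ (by simp [norm_smul, hpos.ne'])

theorem exists_mul_pow_le_opSymbol_re_add_pow (hk : 1 ≤ k) (hell : IsEllipticOp k a)
    (hsa : IsFormallySelfAdjointOp k a) (hbb : IsBoundedBelowOp k a) :
    ∃ c : ℝ, 0 < c ∧ ∃ s₀ : ℝ, 1 ≤ s₀ ∧ ∀ s, s₀ ≤ s → ∀ ξ,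
      c * (‖ξ‖ + s) ^ k ≤ (opSymbol k a ξ).re + s ^ k := by
  obtain ⟨c, hc, hlead⟩ := exists_mul_norm_pow_le_principalSymbol_re hk hell hsa hbb
  obtain ⟨C, _, hlow⟩ := opSymbol_sub_principalSymbol_mem_symbolClass k a
  obtain ⟨j, rfl⟩ : ∃ j, k = j + 1 := ⟨k - 1, by lia⟩
  set c₁ := min c 1
  have hc₁ : 0 < c₁ := lt_min hc one_pos
  set c₂ := c₁ / 2 ^ (j + 1) with hc₂_def
  have hc₂ : 0 < c₂ := by positivity
  refine ⟨c₂, hc₂, max 1 (C / c₂), le_max_left _ _, fun s hs ξ => ?_⟩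
  have hs₁ : 1 ≤ s := (le_max_left _ _).trans hs
  have hsC : C ≤ c₂ * s := (div_le_iff₀' hc₂).1 ((le_max_right _ _).trans hs)
  have hξ := norm_nonneg ξ
  have hdiff : (principalSymbol (j + 1) a ξ).re - (opSymbol (j + 1) a ξ).re ≤
      c₂ * (‖ξ‖ + s) ^ (j + 1) := by
    have h := hlow ξ
    rw [Nat.cast_succ, add_sub_cancel_right, zpow_natCast, norm_sub_rev] at h
    calc _ ≤ C * (1 + ‖ξ‖) ^ j := (Complex.re_le_norm _).trans h
      _ ≤ (c₂ * (‖ξ‖ + s)) * (‖ξ‖ + s) ^ j := by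
        gcongr ?_ * ?_ ^ j
        · exact hsC.trans (by gcongr; linarith)
        · linarith
      _ = _ := by ring
  have hconvex : 2 * (c₂ * (‖ξ‖ + s) ^ (j + 1)) ≤ c₁ * (‖ξ‖ ^ (j + 1) + s ^ (j + 1)) :=
    calc 2 * (c₂ * (‖ξ‖ + s) ^ (j + 1))
        ≤ 2 * (c₂ * (2 ^ j * (‖ξ‖ ^ (j + 1) + s ^ (j + 1)))) := by
          gcongr
          exact add_pow_le hξ (by linarith) (j + 1)
      _ = _ := by rw [hc₂_def]; field_simp; ring
  have hprincipal : c₁ * ‖ξ‖ ^ (j + 1) ≤ (principalSymbol (j + 1) a ξ).re :=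
    (mul_le_mul_of_nonneg_right (min_le_left _ _) (by positivity)).trans (hlead ξ)
  have hshift : c₁ * s ^ (j + 1) ≤ s ^ (j + 1) :=
    mul_le_of_le_one_left (by positivity) (min_le_right _ _)
  linarith

theorem exists_norm_opSymbol_add_pow_le (k : ℕ) (a : (Fin n → ℕ) → ℂ) :
    ∃ C : ℝ, 0 ≤ C ∧ ∀ s : ℝ, 1 ≤ s → ∀ ξ,
      ‖opSymbol k a ξ + (s : ℂ) ^ k‖ ≤ C * (‖ξ‖ + s) ^ k := by
  have hmem : opSymbol k a ∈ symbolClass (Rn n) k := by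
    have heq : opSymbol k a = ∑ α ∈ multiIndices n 0 k, a α • monomialSymbol α := by
      ext1 ξ; simp [opSymbol]
    rw [heq]
    exact sum_mem fun α hα => Submodule.smul_mem _ _ (symbolClass_mono
      (by exact_mod_cast (mem_multiIndices.1 hα).2) (monomialSymbol_mem_symbolClass α))
  obtain ⟨C, hC, h⟩ := hmem
  refine ⟨C + 1, by positivity, fun s hs ξ => ?_⟩
  have hξ := norm_nonneg ξ
  rw [add_mul, one_mul]
  refine norm_add_le_of_le ((h ξ).trans ?_) ?_
  · rw [zpow_natCast]
    gcongr ?_ * ?_ ^ k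
    linarith
  · rw [norm_pow, Complex.norm_real, Real.norm_of_nonneg (by linarith)]
    gcongr
    linarith

end SymbolBounds

theorem memLp_indicator_coeFn {X : Type*} [MeasurableSpace X] {μ : Measure X} {s : Set X}
    {p : ℝ≥0∞} (hs : MeasurableSet s) (f : Lp ℂ p (μ.restrict s)) : MemLp (s.indicator f) p μ :=
  (memLp_indicator_iff_restrict hs).2 (Lp.memLp f)

/-- Extension by zero of `L^p` functions from a measurable set. -/
def extendByZero {X : Type*} [MeasurableSpace X] {μ : Measure X} {s : Set X} {p : ℝ≥0∞}
    [Fact (1 ≤ p)] (hs : MeasurableSet s) : Lp ℂ p (μ.restrict s) →ₗᵢ[ℂ] Lp ℂ p μ where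
  toFun f := (memLp_indicator_coeFn hs f).toLp _
  map_add' f g := by
    rw [← MemLp.toLp_add]
    refine MemLp.toLp_congr _ _ ?_
    rw [← Set.indicator_add', ← ae_eq_restrict_iff_indicator_ae_eq hs]
    exact Lp.coeFn_add f g
  map_smul' c f := by
    rw [RingHom.id_apply, ← MemLp.toLp_const_smul]
    refine MemLp.toLp_congr _ _ ?_
    rw [show c • s.indicator f = _ from (Set.indicator_const_smul s c f).symm,
      ← ae_eq_restrict_iff_indicator_ae_eq hs]
    exact Lp.coeFn_smul c f
  norm_map' f := by
    change ‖(memLp_indicator_coeFn hs f).toLp _‖ = ‖f‖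
    rw [Lp.norm_toLp, Lp.norm_def, eLpNorm_indicator_eq_eLpNorm_restrict hs]

theorem coeFn_extendByZero {X : Type*} [MeasurableSpace X] {μ : Measure X} {s : Set X} {p : ℝ≥0∞}
    [Fact (1 ≤ p)] (hs : MeasurableSet s) (f : Lp ℂ p (μ.restrict s)) :
    extendByZero hs f =ᵐ[μ] s.indicator f :=
  (memLp_indicator_coeFn hs f).coeFn_toLp

theorem isFiniteMeasure_restrict (hbd : Bornology.IsBounded (Ω : Set (Rn n))) :
    IsFiniteMeasure (volume.restrict (Ω : Set (Rn n))) :=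
  ⟨by rw [Measure.restrict_apply_univ]; exact hbd.measure_lt_top⟩

theorem integrableOn_of_isBounded (hbd : Bornology.IsBounded (Ω : Set (Rn n))) (f : L2 Ω) :
    IntegrableOn f (Ω : Set (Rn n)) :=
  haveI := isFiniteMeasure_restrict hbd
  (Lp.memLp f).integrable one_le_two

theorem locallyIntegrableOn_L2 (f : L2 Ω) : LocallyIntegrableOn f (Ω : Set (Rn n)) :=
  locallyIntegrableOn_of_locallyIntegrable_restrict ((Lp.memLp f).locallyIntegrable one_le_two)

theorem fourierOn_eq_fourier (f : Rn n → ℂ) :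
    fourierOn Ω f = FourierTransform.fourier ((Ω : Set (Rn n)).indicator f) := by
  ext ξ
  rw [fourierOn, Real.fourier_eq, ← integral_indicator Ω.isOpen.measurableSet]
  congr 1 with x
  by_cases hx : x ∈ (Ω : Set (Rn n)) <;>
    simp [hx, planeWave, Circle.smul_def, mul_comm]

theorem continuous_fourierOn {f : Rn n → ℂ} (hf : IntegrableOn f (Ω : Set (Rn n))) :
    Continuous (fourierOn Ω f) := by
  refine continuous_of_dominated (bound := fun x => ‖f x‖) (fun ξ => ?_) (fun ξ => ?_) hf.norm
    (.of_forall fun x => continuous_const.mul (continuous_planeWave x))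
  · exact hf.aestronglyMeasurable.mul
      (contDiff_planeWave ξ (m := 0)).continuous.aestronglyMeasurable
  · exact .of_forall fun x => by rw [norm_mul, norm_planeWave, mul_one]

theorem fourierOn_congr {f g : Rn n → ℂ} (h : f =ᵐ[volume.restrict (Ω : Set (Rn n))] g) :
    fourierOn Ω f = fourierOn Ω g := by
  ext ξ
  exact integral_congr_ae (by filter_upwards [h] with x hx; rw [hx])

/-- The Fourier transform of the extension by zero. -/
def fourierL2 (Ω : Opens (Rn n)) : L2 Ω →ₗᵢ[ℂ] Lp ℂ 2 (volume : Measure (Rn n)) :=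
  (Lp.fourierTransformₗᵢ (Rn n) ℂ).toLinearIsometry.comp (extendByZero Ω.isOpen.measurableSet)

theorem integral_smul_fourierL2 (v : SchwartzMap (Rn n) ℂ) (f : L2 Ω) :
    ∫ ξ, v ξ • fourierL2 Ω f ξ =
      ∫ x, FourierTransform.fourier v x • (Ω : Set (Rn n)).indicator f x := by
  have hΩ := Ω.isOpen.measurableSet
  have h : Lp.toTemperedDistribution (fourierL2 Ω f) =
      FourierTransform.fourier (Lp.toTemperedDistribution (extendByZero hΩ f)) :=
    (Lp.fourier_toTemperedDistribution_eq (extendByZero hΩ f)).symm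
  have hv := congr($h v)
  rw [TemperedDistribution.fourier_apply, Lp.toTemperedDistribution_apply,
    Lp.toTemperedDistribution_apply] at hv
  refine hv.trans (integral_congr_ae ?_)
  filter_upwards [coeFn_extendByZero hΩ f] with x hx
  rw [hx]

theorem integral_smul_fourierOn (v : SchwartzMap (Rn n) ℂ) {f : Rn n → ℂ}
    (hf : IntegrableOn f (Ω : Set (Rn n))) :
    ∫ ξ, v ξ • fourierOn Ω f ξ =
      ∫ x, FourierTransform.fourier v x • (Ω : Set (Rn n)).indicator f x := by
  rw [SchwartzMap.fourier_coe, fourierOn_eq_fourier]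
  simpa using! (VectorFourier.integral_fourierIntegral_smul_eq_flip (L := innerₗ (Rn n))
    Real.continuous_fourierChar continuous_inner v.integrable
    ((integrable_indicator_iff Ω.isOpen.measurableSet).2 hf)).symm

theorem coeFn_fourierL2 (hbd : Bornology.IsBounded (Ω : Set (Rn n))) (f : L2 Ω) :
    fourierL2 Ω f =ᵐ[volume] fourierOn Ω f := by
  have hf := integrableOn_of_isBounded hbd f
  refine ae_eq_of_integral_contDiff_smul_eq ((Lp.memLp _).locallyIntegrable one_le_two)
    (continuous_fourierOn hf).locallyIntegrable fun g hg hgc => ?_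
  have hg_compact : HasCompactSupport (Complex.ofRealCLM ∘ g) := hgc.comp_left rfl
  have hg_smooth : ContDiff ℝ (⊤ : ℕ∞) (Complex.ofRealCLM ∘ g) := by fun_prop
  have h := (integral_smul_fourierL2 (hg_compact.toSchwartzMap hg_smooth) f).trans
    (integral_smul_fourierOn _ hf).symm
  simpa only [HasCompactSupport.toSchwartzMap_toFun, Function.comp_apply, Complex.ofRealCLM_apply,
    Complex.coe_smul] using h

theorem memLp_testFunction (φ : 𝓓(Ω, ℂ)) (p : ℝ≥0∞) (μ : Measure (Rn n))
    [IsFiniteMeasureOnCompacts μ] : MemLp φ p μ :=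
  φ.continuous.memLp_of_hasCompactSupport φ.hasCompactSupport

/-- A test function as an element of `L²(Ω)`. -/
def testToL2 : 𝓓(Ω, ℂ) →ₗ[ℂ] L2 Ω where
  toFun φ := (memLp_testFunction φ 2 _).toLp φ
  map_add' _ _ := rfl
  map_smul' _ _ := rfl

theorem coeFn_testToL2 (φ : 𝓓(Ω, ℂ)) : testToL2 φ =ᵐ[volume.restrict (Ω : Set (Rn n))] φ :=
  (memLp_testFunction φ 2 _).coeFn_toLp

theorem fourierL2_testToL2 (hbd : Bornology.IsBounded (Ω : Set (Rn n))) (φ : 𝓓(Ω, ℂ)) :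
    fourierL2 Ω (testToL2 φ) =ᵐ[volume] fourierOn Ω φ := by
  rw [← fourierOn_congr (coeFn_testToL2 φ)]
  exact coeFn_fourierL2 hbd _

theorem inner_testToL2 (φ : 𝓓(Ω, ℂ)) (f : L2 Ω) :
    inner ℂ (testToL2 φ) f = ∫ x in (Ω : Set (Rn n)), f x * conjTest φ x := by
  rw [L2.inner_def]
  refine integral_congr_ae ?_
  filter_upwards [coeFn_testToL2 φ] with x hx
  rw [hx, RCLike.inner_apply, conjTest_apply]

theorem inner_testToL2_conjTest (φ : 𝓓(Ω, ℂ)) (f : L2 Ω) :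
    inner ℂ (testToL2 (conjTest φ)) f = ∫ x in (Ω : Set (Rn n)), f x * φ x := by
  rw [inner_testToL2, conjTest_conjTest]

/-- Multiplication by the function `m` on `L²(μ)`. It is zero when `m` is not essentially
bounded. -/
def lpMul {X : Type*} [MeasurableSpace X] (μ : Measure X) (m : X → ℂ) :
    Lp ℂ 2 μ →L[ℂ] Lp ℂ 2 μ :=
  open scoped Classical in
  if h : MemLp m ∞ μ then (ContinuousLinearMap.mul ℂ ℂ).holderL μ ∞ 2 2 (h.toLp m) else 0

section LpMul

variable {X : Type*} [MeasurableSpace X] {μ : Measure X} {m : X → ℂ}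

theorem coeFn_lpMul (h : MemLp m ∞ μ) (f : Lp ℂ 2 μ) :
    lpMul μ m f =ᵐ[μ] fun x => m x * f x := by
  rw [lpMul, dif_pos h]
  filter_upwards [(ContinuousLinearMap.mul ℂ ℂ).coeFn_holder (h.toLp m) f (r := 2),
    h.coeFn_toLp] with x hx hm
  exact hx.trans (by rw [hm]; rfl)

theorem norm_lpMul_le {C : ℝ} (hC : 0 ≤ C) (h : ∀ᵐ x ∂μ, ‖m x‖ ≤ C) : ‖lpMul μ m‖ ≤ C := by
  by_cases hm : MemLp m ∞ μ
  · refine ContinuousLinearMap.opNorm_le_bound _ hC fun f => Lp.norm_le_mul_norm_of_ae_le_mul ?_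
    filter_upwards [coeFn_lpMul hm f, h] with x hx hmx
    rw [hx, norm_mul]
    gcongr
  · rwa [lpMul, dif_neg hm, norm_zero]

theorem lpMul_sub {m₁ m₂ : X → ℂ} (h₁ : MemLp m₁ ∞ μ) (h₂ : MemLp m₂ ∞ μ) :
    lpMul μ m₁ - lpMul μ m₂ = lpMul μ (m₁ - m₂) := by
  refine ContinuousLinearMap.ext fun f => Lp.ext ?_
  rw [sub_apply]
  filter_upwards [coeFn_lpMul h₁ f, coeFn_lpMul h₂ f, coeFn_lpMul (h₁.sub h₂) f,
    Lp.coeFn_sub (lpMul μ m₁ f) (lpMul μ m₂ f)] with x hx₁ hx₂ hx hsub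
  rw [hsub, hx, Pi.sub_apply, Pi.sub_apply, hx₁, hx₂, sub_mul]

theorem lpMul_comp {m₁ m₂ : X → ℂ} (h₁ : MemLp m₁ ∞ μ) (h₂ : MemLp m₂ ∞ μ) :
    lpMul μ m₁ ∘L lpMul μ m₂ = lpMul μ (m₁ * m₂) := by
  refine ContinuousLinearMap.ext fun f => Lp.ext ?_
  rw [ContinuousLinearMap.comp_apply]
  filter_upwards [coeFn_lpMul h₁ (lpMul μ m₂ f), coeFn_lpMul h₂ f,
    coeFn_lpMul (h₂.mul (r := ∞) h₁) f] with x hx₁ hx₂ hx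
  rw [hx, hx₁, hx₂, Pi.mul_apply, mul_assoc]

end LpMul

section SymbolBounds

variable {k : ℕ} {a : (Fin n → ℕ) → ℂ} {c s₀ s : ℝ}

/-- The bound `c (‖ξ‖ + s) ^ k ≤ p(ξ) + s ^ k`, for `s ≥ s₀ ≥ 1`, on the symbol `p` of a formally
self-adjoint operator of order `k ≥ 1`. It is all that is used of ellipticity and of boundedness
from below. -/
structure IsCoerciveSymbol (k : ℕ) (a : (Fin n → ℕ) → ℂ) (c s₀ : ℝ) : Prop where
  one_le_order : 1 ≤ k
  pos : 0 < c
  one_le_shift : 1 ≤ s₀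
  isFormallySelfAdjointOp : IsFormallySelfAdjointOp k a
  mul_pow_le (s : ℝ) : s₀ ≤ s → ∀ ξ : Rn n, c * (‖ξ‖ + s) ^ k ≤ (opSymbol k a ξ).re + s ^ k

/-- The symbol `p(ξ) + s ^ k` of `P + s ^ k`. -/
def shiftedSymbol (k : ℕ) (a : (Fin n → ℕ) → ℂ) (s : ℝ) (ξ : Rn n) : ℂ :=
  opSymbol k a ξ + (s : ℂ) ^ k

/-- The symbol of `∂^α (P + s ^ k)⁻¹` on `ℝⁿ`. -/
def resolventMultiplier (k : ℕ) (a : (Fin n → ℕ) → ℂ) (s : ℝ) (α : Fin n → ℕ) (ξ : Rn n) : ℂ :=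
  monomialSymbol α ξ / shiftedSymbol k a s ξ

theorem continuous_shiftedSymbol : Continuous (shiftedSymbol k a s) :=
  (continuous_opSymbol k a).add continuous_const

namespace IsCoerciveSymbol

variable (h : IsCoerciveSymbol k a c s₀) {α : Fin n → ℕ}

include h

theorem one_le (hs : s₀ ≤ s) : 1 ≤ s := h.one_le_shift.trans hs

theorem mul_pow_le_norm (hs : s₀ ≤ s) (ξ : Rn n) :
    c * (‖ξ‖ + s) ^ k ≤ ‖shiftedSymbol k a s ξ‖ := by
  refine (h.mul_pow_le s hs ξ).trans (le_of_eq_of_le ?_ (Complex.re_le_norm _))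
  rw [shiftedSymbol, Complex.add_re, ← Complex.ofReal_pow, Complex.ofReal_re]

theorem norm_add_pos (hs : s₀ ≤ s) (ξ : Rn n) : 0 < ‖ξ‖ + s := by
  linarith [norm_nonneg ξ, h.one_le hs]

theorem shiftedSymbol_ne_zero (hs : s₀ ≤ s) (ξ : Rn n) : shiftedSymbol k a s ξ ≠ 0 :=
  norm_pos_iff.1 ((mul_pos h.pos (pow_pos (h.norm_add_pos hs ξ) k)).trans_le
    (h.mul_pow_le_norm hs ξ))

theorem norm_resolventMultiplier_mul_le (hs : s₀ ≤ s) (hα : mlen α ≤ k) (ξ : Rn n) :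
    ‖resolventMultiplier k a s α ξ‖ * (‖ξ‖ + s) ^ (k - mlen α) ≤ (2 * Real.pi) ^ k / c := by
  have hpos := h.norm_add_pos hs ξ
  have hc := h.pos
  have hpi : 1 ≤ 2 * Real.pi := by linarith [Real.pi_gt_three]
  have hnum : ‖monomialSymbol α ξ‖ * (‖ξ‖ + s) ^ (k - mlen α) ≤
      (2 * Real.pi) ^ k * (‖ξ‖ + s) ^ k := by
    calc ‖monomialSymbol α ξ‖ * (‖ξ‖ + s) ^ (k - mlen α)
        ≤ ((2 * Real.pi) ^ mlen α * ‖ξ‖ ^ mlen α) * (‖ξ‖ + s) ^ (k - mlen α) := by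
          gcongr; exact norm_monomialSymbol_le α ξ
      _ ≤ ((2 * Real.pi) ^ k * (‖ξ‖ + s) ^ mlen α) * (‖ξ‖ + s) ^ (k - mlen α) := by
          gcongr
          linarith [h.one_le hs]
      _ = _ := by rw [mul_assoc, ← pow_add, Nat.add_sub_cancel' hα]
  rw [resolventMultiplier, norm_div, div_mul_eq_mul_div,
    div_le_div_iff₀ (norm_pos_iff.2 (h.shiftedSymbol_ne_zero hs ξ)) hc]
  calc _ ≤ (2 * Real.pi) ^ k * (‖ξ‖ + s) ^ k * c := by gcongr
    _ = (2 * Real.pi) ^ k * (c * (‖ξ‖ + s) ^ k) := by ring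
    _ ≤ _ := by gcongr; exact h.mul_pow_le_norm hs ξ

theorem norm_resolventMultiplier_le (hs : s₀ ≤ s) (hα : mlen α ≤ k) (ξ : Rn n) :
    ‖resolventMultiplier k a s α ξ‖ ≤ (2 * Real.pi) ^ k / c / s ^ (k - mlen α) := by
  have hs1 := h.one_le hs
  rw [le_div_iff₀ (by positivity)]
  refine le_trans ?_ (h.norm_resolventMultiplier_mul_le hs hα ξ)
  gcongr
  linarith [norm_nonneg ξ]

theorem continuous_resolventMultiplier (hs : s₀ ≤ s) (α : Fin n → ℕ) :
    Continuous (resolventMultiplier k a s α) :=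
  (continuous_monomialSymbol α).div continuous_shiftedSymbol (h.shiftedSymbol_ne_zero hs)

theorem memLp_resolventMultiplier (hs : s₀ ≤ s) (hα : mlen α ≤ k) :
    MemLp (resolventMultiplier k a s α) ∞ (volume : Measure (Rn n)) :=
  memLp_top_of_bound (h.continuous_resolventMultiplier hs α).aestronglyMeasurable _
    (.of_forall (h.norm_resolventMultiplier_le hs hα))

end IsCoerciveSymbol

theorem exists_isCoerciveSymbol (hk : 1 ≤ k) (hell : IsEllipticOp k a)
    (hsa : IsFormallySelfAdjointOp k a) (hbb : IsBoundedBelowOp k a) :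
    ∃ c s₀, IsCoerciveSymbol k a c s₀ := by
  obtain ⟨c, hc, s₀, hs₀, h⟩ := exists_mul_pow_le_opSymbol_re_add_pow hk hell hsa hbb
  exact ⟨c, s₀, hk, hc, hs₀, hsa, h⟩

end SymbolBounds

theorem conj_planeWave (ξ x : Rn n) :
    (starRingEnd ℂ) (planeWave ξ x) = planeWave (-ξ) x := by
  rw [planeWave, ← Circle.coe_inv_eq_conj, ← AddChar.map_neg_eq_inv, planeWave, inner_neg_right]

theorem conj_fourierOn_conjTest (φ : 𝓓(Ω, ℂ)) (ξ : Rn n) :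
    (starRingEnd ℂ) (fourierOn Ω (conjTest φ) ξ) = fourierOn Ω φ (-ξ) := by
  simp only [fourierOn, ← integral_conj, conjTest_apply, map_mul, Complex.conj_conj,
    conj_planeWave]

/-- The adjoint of the Fourier transform on `Ω`, i.e. the inverse Fourier transform followed by
restriction to `Ω`. -/
def fourierL2Adj (Ω : Opens (Rn n)) : Lp ℂ 2 (volume : Measure (Rn n)) →L[ℂ] L2 Ω :=
  ContinuousLinearMap.adjoint (fourierL2 Ω).toContinuousLinearMap

theorem inner_fourierL2Adj (f : L2 Ω) (v : Lp ℂ 2 (volume : Measure (Rn n))) :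
    inner ℂ f (fourierL2Adj Ω v) = inner ℂ (fourierL2 Ω f) v :=
  ContinuousLinearMap.adjoint_inner_right _ _ _

theorem fourierL2Adj_fourierL2 (f : L2 Ω) : fourierL2Adj Ω (fourierL2 Ω f) = f := by
  refine ext_inner_left ℂ fun g => ?_
  rw [inner_fourierL2Adj, LinearIsometry.inner_map_map]

theorem norm_fourierL2Adj_le : ‖fourierL2Adj Ω‖ ≤ 1 := by
  rw [fourierL2Adj, LinearIsometryEquiv.norm_map]
  exact LinearIsometry.norm_toContinuousLinearMap_le _

section Derivatives

variable {k : ℕ} {a : (Fin n → ℕ) → ℂ}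

theorem testPairing_L2 (f : L2 Ω) (φ : 𝓓(Ω, ℂ)) :
    testPairing f φ = ∫ x in (Ω : Set (Rn n)), f x * φ x :=
  testPairing_apply (locallyIntegrableOn_L2 f) φ

variable (hbd : Bornology.IsBounded (Ω : Set (Rn n)))

include hbd

theorem integral_fourierL2Adj_mul (v : Lp ℂ 2 (volume : Measure (Rn n))) (φ : 𝓓(Ω, ℂ)) :
    ∫ x in (Ω : Set (Rn n)), fourierL2Adj Ω v x * φ x = ∫ ξ, v ξ * fourierOn Ω φ (-ξ) := by
  rw [← inner_testToL2_conjTest, inner_fourierL2Adj, L2.inner_def]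
  refine integral_congr_ae ?_
  filter_upwards [fourierL2_testToL2 hbd (conjTest φ)] with ξ hξ
  rw [hξ, RCLike.inner_apply, conj_fourierOn_conjTest]

theorem hasWeakDeriv_fourierL2Adj {α : Fin n → ℕ} {v w : Lp ℂ 2 (volume : Measure (Rn n))}
    (hw : w =ᵐ[volume] fun ξ => monomialSymbol α ξ * v ξ) :
    HasWeakDeriv Ω α (fourierL2Adj Ω v) (fourierL2Adj Ω w) := by
  refine ⟨locallyIntegrableOn_L2 _, locallyIntegrableOn_L2 _, fun φ => ?_⟩
  rw [integral_fourierL2Adj_mul hbd, integral_fourierL2Adj_mul hbd, ← integral_const_mul]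
  refine integral_congr_ae ?_
  filter_upwards [hw] with ξ hξ
  rw [hξ, fourierOn_mderiv, ← neg_neg ξ, monomialSymbol_neg, neg_neg]
  ring

theorem distribEq_fourierL2Adj {v w : Lp ℂ 2 (volume : Measure (Rn n))}
    (hw : w =ᵐ[volume] fun ξ => opSymbol k a ξ * v ξ) :
    DistribEq Ω k a (fourierL2Adj Ω v) (fourierL2Adj Ω w) := by
  intro φ
  rw [integral_fourierL2Adj_mul hbd, integral_fourierL2Adj_mul hbd]
  refine integral_congr_ae ?_
  filter_upwards [hw] with ξ hξ
  rw [hξ, fourierOn_constCoeffOp, opSymbol_adjoint_neg]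
  ring

end Derivatives

/-- The operator `v ↦ ∂^α (P + s ^ k)⁻¹ 𝓕⁻¹ v`, where `P` acts on `ℝⁿ`, followed by restriction
to `Ω`. -/
def freeResolvent (Ω : Opens (Rn n)) (k : ℕ) (a : (Fin n → ℕ) → ℂ) (s : ℝ) (α : Fin n → ℕ) :
    Lp ℂ 2 (volume : Measure (Rn n)) →L[ℂ] L2 Ω :=
  fourierL2Adj Ω ∘L lpMul volume (resolventMultiplier k a s α)

/-- `P + s ^ k` as an operator on test functions. -/
def shiftedOp (k : ℕ) (a : (Fin n → ℕ) → ℂ) (s : ℝ) (φ : 𝓓(Ω, ℂ)) : 𝓓(Ω, ℂ) :=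
  constCoeffOp k a φ + ((s : ℂ) ^ k) • φ

theorem fourierOn_shiftedOp (k : ℕ) (a : (Fin n → ℕ) → ℂ) (s : ℝ) (φ : 𝓓(Ω, ℂ)) (ξ : Rn n) :
    fourierOn Ω (shiftedOp k a s φ) ξ = shiftedSymbol k a s ξ * fourierOn Ω φ ξ := by
  have hop := fourierOn_constCoeffOp k a φ ξ
  simp only [fourierOn] at hop ⊢
  simp only [shiftedOp, add_apply, smul_apply, smul_eq_mul, add_mul, mul_assoc]
  rw [integral_add (integrableOn_testFunction_mul_planeWave _ ξ)
    ((integrableOn_testFunction_mul_planeWave _ ξ).const_mul _), hop, integral_const_mul,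
    shiftedSymbol, add_mul]

theorem monomialSymbol_zero (ξ : Rn n) : monomialSymbol 0 ξ = 1 := by simp [monomialSymbol]

theorem mlen_zero : mlen (0 : Fin n → ℕ) = 0 := by simp [mlen]

section FreeResolvent

variable {k : ℕ} {a : (Fin n → ℕ) → ℂ} {c s₀ s : ℝ} (h : IsCoerciveSymbol k a c s₀) (hs : s₀ ≤ s)
  {α : Fin n → ℕ}

include h hs

theorem norm_freeResolvent_le (hα : mlen α ≤ k) :
    ‖freeResolvent Ω k a s α‖ ≤ (2 * Real.pi) ^ k / c / s ^ (k - mlen α) := by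
  have hc := h.pos
  have hs1 := h.one_le hs
  refine (ContinuousLinearMap.opNorm_comp_le _ _).trans ?_
  rw [← one_mul ((2 * Real.pi) ^ k / c / s ^ (k - mlen α))]
  gcongr
  · exact norm_fourierL2Adj_le
  · exact norm_lpMul_le (by positivity) (.of_forall (h.norm_resolventMultiplier_le hs hα))

variable (hbd : Bornology.IsBounded (Ω : Set (Rn n)))

include hbd

theorem hasWeakDeriv_freeResolvent (hα : mlen α ≤ k) (v : Lp ℂ 2 (volume : Measure (Rn n))) :
    HasWeakDeriv Ω α (freeResolvent Ω k a s 0 v) (freeResolvent Ω k a s α v) := by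
  have h₀ : mlen (0 : Fin n → ℕ) ≤ k := by simp [mlen_zero]
  change HasWeakDeriv Ω α (fourierL2Adj Ω (lpMul volume _ v)) (fourierL2Adj Ω (lpMul volume _ v))
  refine hasWeakDeriv_fourierL2Adj hbd ?_
  filter_upwards [coeFn_lpMul (h.memLp_resolventMultiplier hs h₀) v,
    coeFn_lpMul (h.memLp_resolventMultiplier hs hα) v] with ξ hξ₀ hξα
  rw [hξ₀, hξα, resolventMultiplier, resolventMultiplier, monomialSymbol_zero]
  ring

theorem distribEq_freeResolvent (v : Lp ℂ 2 (volume : Measure (Rn n))) :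
    DistribEq Ω k a (freeResolvent Ω k a s 0 v)
      (fourierL2Adj Ω v - ((s : ℂ) ^ k) • freeResolvent Ω k a s 0 v) := by
  have h₀ : mlen (0 : Fin n → ℕ) ≤ k := by simp [mlen_zero]
  set m := resolventMultiplier k a s 0
  rw [show fourierL2Adj Ω v - ((s : ℂ) ^ k) • freeResolvent Ω k a s 0 v =
    fourierL2Adj Ω (v - ((s : ℂ) ^ k) • lpMul volume m v) by rw [map_sub, map_smul]; rfl]
  change DistribEq Ω k a (fourierL2Adj Ω (lpMul volume m v)) _
  refine distribEq_fourierL2Adj hbd ?_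
  filter_upwards [coeFn_lpMul (h.memLp_resolventMultiplier hs h₀) v,
    Lp.coeFn_sub v (((s : ℂ) ^ k) • lpMul volume m v),
    Lp.coeFn_smul ((s : ℂ) ^ k) (lpMul volume m v)] with ξ hm hsub hsmul
  have hne := h.shiftedSymbol_ne_zero hs ξ
  rw [hsub, Pi.sub_apply, hsmul, Pi.smul_apply, smul_eq_mul, hm, resolventMultiplier,
    monomialSymbol_zero]
  field_simp
  rw [shiftedSymbol]
  ring

theorem freeResolvent_fourierL2_shiftedOp (hα : mlen α ≤ k) (φ : 𝓓(Ω, ℂ)) :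
    freeResolvent Ω k a s α (fourierL2 Ω (testToL2 (shiftedOp k a s φ))) =
      testToL2 (mderiv α φ) := by
  rw [← fourierL2Adj_fourierL2 (testToL2 (mderiv α φ)), freeResolvent,
    ContinuousLinearMap.comp_apply]
  congr 1
  apply Lp.ext
  filter_upwards [fourierL2_testToL2 hbd (mderiv α φ),
    fourierL2_testToL2 hbd (shiftedOp k a s φ),
    coeFn_lpMul (h.memLp_resolventMultiplier hs hα)
      (fourierL2 Ω (testToL2 (shiftedOp k a s φ)))] with ξ hderiv hshift hmul
  have hne := h.shiftedSymbol_ne_zero hs ξ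
  rw [hmul, hderiv, hshift, fourierOn_mderiv, fourierOn_shiftedOp, resolventMultiplier]
  field_simp

end FreeResolvent

section Superposition

variable {X H : Type*} [MeasurableSpace X] {μ : Measure X} [NormedAddCommGroup H]
  [InnerProductSpace ℂ H] [CompleteSpace H]

/-- The operator `v ↦ ∫ v(x) K(x) dμ(x)` as a function of the square integrable kernel `K`. -/
def superposition : Lp H 2 μ →L[ℂ] Lp ℂ 2 μ →L[ℂ] H :=
  ((ContinuousLinearMap.lsmul ℂ ℂ).lpPairing μ 2 2).flip

theorem superposition_apply (K : Lp H 2 μ) (v : Lp ℂ 2 μ) :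
    superposition K v = ∫ x, v x • K x ∂μ :=
  (ContinuousLinearMap.lsmul ℂ ℂ).lpPairing_eq_integral v K

theorem inner_superposition (K : Lp H 2 μ) (f : H) (v : Lp ℂ 2 μ) :
    inner ℂ f (superposition K v) = ∫ x, v x * inner ℂ f (K x) ∂μ := by
  have hint : Integrable (fun x => v x • K x) μ :=
    memLp_one_iff_integrable.1 ((Lp.memLp K).smul (Lp.memLp v))
  rw [superposition_apply, ← integral_inner hint]
  simp only [inner_smul_right]

theorem superposition_indicatorConstLp {s : Set X} (hs : MeasurableSet s) (hμs : μ s ≠ ∞) (y : H) :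
    superposition (indicatorConstLp 2 hs hμs y) =
      ContinuousLinearMap.toSpanSingleton ℂ y ∘L
        innerSL ℂ (indicatorConstLp 2 hs hμs (1 : ℂ)) := by
  ext v
  rw [superposition_apply, ContinuousLinearMap.comp_apply, innerSL_apply_apply,
    L2.inner_indicatorConstLp_one, ContinuousLinearMap.toSpanSingleton_apply,
    ← integral_smul_const, ← integral_indicator hs]
  refine integral_congr_ae ?_
  filter_upwards [indicatorConstLp_coeFn (p := 2) (hs := hs) (hμs := hμs) (c := y)] with x hx
  by_cases hxs : x ∈ s <;> simp [hx, hxs]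

theorem isCompactOperator_superposition (K : Lp H 2 μ) : IsCompactOperator (superposition K) := by
  refine Lp.induction ENNReal.ofNat_ne_top (fun K => IsCompactOperator (superposition K)) ?_ ?_
    ?_ K
  · intro y s hs hμs
    rw [Lp.simpleFunc.coe_indicatorConst, superposition_indicatorConstLp]
    exact ((isCompactOperator_id (E := ℂ)).comp_clm (innerSL ℂ _)).clm_comp
      (ContinuousLinearMap.toSpanSingleton ℂ y)
  · intro f g hf hg _ ihf ihg
    rw [map_add]
    exact ihf.add ihg
  · exact isClosed_setOfPred_isCompactOperator.preimage superposition.continuous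

end Superposition

theorem norm_planeWave_sub_le (ξ η x : Rn n) :
    ‖planeWave ξ x - planeWave η x‖ ≤ 2 * Real.pi * ‖x‖ * ‖ξ - η‖ := by
  have h : planeWave ξ x - planeWave η x = planeWave η x *
      (Complex.exp (Complex.I * (2 * Real.pi * -inner ℝ x (ξ - η) : ℝ)) - 1) := by
    rw [mul_sub, mul_one, planeWave_eq_exp, planeWave_eq_exp, ← Complex.exp_add,
      inner_sub_right (𝕜 := ℝ)]
    congr 2
    push_cast
    ring
  rw [h, norm_mul, norm_planeWave, one_mul]
  refine Real.norm_exp_I_mul_ofReal_sub_one_le.trans ?_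
  rw [norm_mul, norm_neg, Real.norm_of_nonneg Real.two_pi_pos.le, mul_assoc (2 * Real.pi)]
  gcongr
  exact norm_inner_le_norm (𝕜 := ℝ) x (ξ - η)

theorem memLp_indicator_one {B : Set (Rn n)} (hB : MeasurableSet B) :
    MemLp (B.indicator (1 : Rn n → ℂ)) ∞ volume :=
  (memLp_top_const 1).indicator hB

section BoundedDomain

variable (hbd : Bornology.IsBounded (Ω : Set (Rn n)))

include hbd

theorem memLp_planeWave (ξ : Rn n) :
    MemLp (planeWave ξ) 2 (volume.restrict (Ω : Set (Rn n))) :=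
  haveI := isFiniteMeasure_restrict hbd
  .of_bound (contDiff_planeWave ξ (m := 0)).continuous.aestronglyMeasurable 1
    (.of_forall fun x => (norm_planeWave ξ x).le)

omit hbd in
/-- The plane wave `planeWave ξ` as an element of `L²(Ω)`. -/
def planeWaveL2 (hbd : Bornology.IsBounded (Ω : Set (Rn n))) (ξ : Rn n) : L2 Ω :=
  (memLp_planeWave hbd ξ).toLp (planeWave ξ)

theorem coeFn_planeWaveL2 (ξ : Rn n) :
    planeWaveL2 hbd ξ =ᵐ[volume.restrict (Ω : Set (Rn n))] planeWave ξ :=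
  (memLp_planeWave hbd ξ).coeFn_toLp

theorem inner_planeWaveL2_neg (f : L2 Ω) (ξ : Rn n) :
    inner ℂ f (planeWaveL2 hbd (-ξ)) = (starRingEnd ℂ) (fourierOn Ω f ξ) := by
  rw [L2.inner_def, fourierOn, ← integral_conj]
  refine integral_congr_ae ?_
  filter_upwards [coeFn_planeWaveL2 hbd (-ξ)] with x hx
  rw [hx, RCLike.inner_apply, map_mul, conj_planeWave, mul_comm]

theorem continuous_planeWaveL2 : Continuous (planeWaveL2 hbd) := by
  have := isFiniteMeasure_restrict hbd
  obtain ⟨R, hR₀, hR⟩ := hbd.exists_pos_norm_le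
  set m : ℝ := (measureUnivNNReal (volume.restrict (Ω : Set (Rn n))) : ℝ) ^ (2 : ℝ≥0∞).toReal⁻¹
  refine (LipschitzWith.of_dist_le' (K := m * (2 * Real.pi * R)) fun ξ η => ?_).continuous
  rw [dist_eq_norm, dist_eq_norm, mul_assoc]
  refine Lp.norm_le_of_ae_bound (by positivity) ?_
  filter_upwards [Lp.coeFn_sub (planeWaveL2 hbd ξ) (planeWaveL2 hbd η),
    coeFn_planeWaveL2 hbd ξ, coeFn_planeWaveL2 hbd η,
    ae_restrict_mem Ω.isOpen.measurableSet] with x hsub hξ hη hx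
  rw [hsub, Pi.sub_apply, hξ, hη]
  refine (norm_planeWave_sub_le ξ η x).trans ?_
  gcongr
  exact hR x hx

theorem isCompactOperator_fourierL2Adj_lpMul_ball (R : ℝ) : IsCompactOperator
    (fourierL2Adj Ω ∘L lpMul volume ((Metric.ball (0 : Rn n) R).indicator 1)) := by
  set B := Metric.ball (0 : Rn n) R
  have hB : MeasurableSet B := measurableSet_ball
  have : IsFiniteMeasure (volume.restrict B) :=
    ⟨by rw [Measure.restrict_apply_univ]; exact measure_ball_lt_top⟩
  have hK : MemLp (B.indicator fun ξ => planeWaveL2 hbd (-ξ)) 2 volume := by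
    rw [memLp_indicator_iff_restrict hB]
    have hcont := (continuous_planeWaveL2 hbd).comp continuous_neg
    obtain ⟨C, hC⟩ := (isCompact_closedBall (0 : Rn n) R).exists_bound_of_continuousOn
      hcont.continuousOn
    refine MemLp.of_bound hcont.aestronglyMeasurable C ?_
    filter_upwards [ae_restrict_mem hB] with ξ hξ using hC ξ (Metric.ball_subset_closedBall hξ)
  have h : fourierL2Adj Ω ∘L lpMul volume (B.indicator 1) = superposition (hK.toLp _) := by
    ext1 v
    refine ext_inner_left ℂ fun f => ?_
    rw [ContinuousLinearMap.comp_apply, inner_fourierL2Adj, L2.inner_def, inner_superposition]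
    refine integral_congr_ae ?_
    filter_upwards [hK.coeFn_toLp, coeFn_fourierL2 hbd f,
      coeFn_lpMul (memLp_indicator_one hB) v] with ξ hξ hf hv
    by_cases hmem : ξ ∈ B
    · rw [Set.indicator_of_mem hmem] at hξ hv
      rw [hξ, hv, hf, RCLike.inner_apply, inner_planeWaveL2_neg hbd f ξ, Pi.one_apply, one_mul]
    · rw [Set.indicator_of_notMem hmem] at hξ hv
      rw [hξ, hv, inner_zero_right, zero_mul, inner_zero_right, mul_zero]
  rw [h]
  exact isCompactOperator_superposition _

theorem IsCoerciveSymbol.isCompactOperator_freeResolvent {k : ℕ} {a : (Fin n → ℕ) → ℂ}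
    {c s₀ s : ℝ} (h : IsCoerciveSymbol k a c s₀) (hs : s₀ ≤ s) {α : Fin n → ℕ} (hα : mlen α < k) :
    IsCompactOperator (freeResolvent Ω k a s α) := by
  have hc := h.pos
  set A : ℝ := (2 * Real.pi) ^ k / c
  set m := resolventMultiplier k a s α
  let truncation (j : ℕ) : Lp ℂ 2 (volume : Measure (Rn n)) →L[ℂ] L2 Ω :=
    (fourierL2Adj Ω ∘L lpMul volume ((Metric.ball (0 : Rn n) j).indicator 1)) ∘L lpMul volume m
  have hbound (j : ℕ) : ‖truncation j - freeResolvent Ω k a s α‖ ≤ A / (j + 1) := by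
    have hball := memLp_indicator_one (measurableSet_ball (x := (0 : Rn n)) (ε := j))
    have hm := h.memLp_resolventMultiplier hs hα.le
    change ‖(_ ∘L _) ∘L _ - _‖ ≤ _
    rw [ContinuousLinearMap.comp_assoc, freeResolvent, ← ContinuousLinearMap.comp_sub,
      lpMul_comp hball hm, lpMul_sub (hm.mul (r := ∞) hball) hm, ← one_mul (A / (j + 1))]
    refine (ContinuousLinearMap.opNorm_comp_le _ _).trans (mul_le_mul norm_fourierL2Adj_le
      (norm_lpMul_le (by positivity) (.of_forall fun ξ => ?_)) (norm_nonneg _) zero_le_one)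
    by_cases hξ : ξ ∈ Metric.ball (0 : Rn n) j
    · rw [Pi.sub_apply, Pi.mul_apply, Set.indicator_of_mem hξ, Pi.one_apply, one_mul, sub_self,
        norm_zero]
      positivity
    · rw [Pi.sub_apply, Pi.mul_apply, Set.indicator_of_notMem hξ, zero_mul, zero_sub, norm_neg,
        le_div_iff₀ (by positivity)]
      rw [mem_ball_zero_iff, not_lt] at hξ
      refine le_trans ?_ (h.norm_resolventMultiplier_mul_le hs hα.le ξ)
      gcongr
      calc (j : ℝ) + 1 ≤ ‖ξ‖ + s := add_le_add hξ (h.one_le hs)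
        _ ≤ _ := le_self_pow₀ (by linarith [norm_nonneg ξ, h.one_le hs]) (by lia)
  refine isCompactOperator_of_tendsto (l := Filter.atTop) (F := truncation) ?_
    (.of_forall fun j => (isCompactOperator_fourierL2Adj_lpMul_ball hbd j).comp_clm _)
  rw [tendsto_iff_norm_sub_tendsto_zero]
  refine squeeze_zero (fun _ => norm_nonneg _) hbound ?_
  simpa [div_eq_mul_inv] using tendsto_one_div_add_atTop_nhds_zero_nat.const_mul A

end BoundedDomain

/-- Multiplication by the bounded function `χ` on `L²(Ω)`. -/
def cutoffOp (Ω : Opens (Rn n)) (χ : Rn n → ℂ) : L2 Ω →L[ℂ] L2 Ω :=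
  lpMul (volume.restrict (Ω : Set (Rn n))) χ

theorem coeFn_cutoffOp (χ : 𝓓(Ω, ℂ)) (f : L2 Ω) :
    cutoffOp Ω χ f =ᵐ[volume.restrict (Ω : Set (Rn n))] fun x => χ x * f x :=
  coeFn_lpMul (memLp_testFunction χ ∞ _) f

theorem eLpNorm_le_of_norm_le_add_sum {X ι E F G : Type*} [MeasurableSpace X] {μ : Measure X}
    [NormedAddCommGroup E] [NormedAddCommGroup F] [NormedAddCommGroup G] {p : ℝ≥0∞} (hp : 1 ≤ p)
    {S : Finset ι} {u : X → E} {v : X → F} {w : ι → X → G} {C : ℝ} {B : ℝ} {K : ι → ℝ}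
    (hC : 0 ≤ C) (hB : 0 ≤ B) (hK : ∀ i, 0 ≤ K i)
    (hv : AEStronglyMeasurable v μ) (hw : ∀ i, AEStronglyMeasurable (w i) μ)
    (h : ∀ᵐ x ∂μ, ‖u x‖ ≤ ‖v x‖ + C * ∑ i ∈ S, ‖w i x‖)
    (hvB : eLpNorm v p μ ≤ ENNReal.ofReal B) (hwK : ∀ i, eLpNorm (w i) p μ ≤ ENNReal.ofReal (K i)) :
    eLpNorm u p μ ≤ ENNReal.ofReal (B + C * ∑ i ∈ S, K i) := by
  have hwn : ∀ i ∈ S, AEStronglyMeasurable (fun x => ‖w i x‖) μ := fun i _ => (hw i).norm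
  have hsum : eLpNorm (∑ i ∈ S, fun x => ‖w i x‖) p μ ≤ ENNReal.ofReal (∑ i ∈ S, K i) := by
    rw [ENNReal.ofReal_sum_of_nonneg fun i _ => hK i]
    refine (eLpNorm_sum_le hwn hp).trans (Finset.sum_le_sum fun i _ => ?_)
    rw [eLpNorm_norm]
    exact hwK i
  calc eLpNorm u p μ
      ≤ eLpNorm ((fun x => ‖v x‖) + C • ∑ i ∈ S, fun x => ‖w i x‖) p μ :=
        eLpNorm_mono_ae_real (by simpa [Finset.sum_apply] using h)
    _ ≤ eLpNorm (fun x => ‖v x‖) p μ + eLpNorm (C • ∑ i ∈ S, fun x => ‖w i x‖) p μ :=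
        eLpNorm_add_le hv.norm ((Finset.aestronglyMeasurable_sum _ hwn).const_smul C) hp
    _ ≤ ENNReal.ofReal B + ENNReal.ofReal C * ENNReal.ofReal (∑ i ∈ S, K i) := by
        rw [eLpNorm_norm, eLpNorm_const_smul, Real.enorm_of_nonneg hC]
        gcongr
    _ = ENNReal.ofReal (B + C * ∑ i ∈ S, K i) := by
        rw [← ENNReal.ofReal_mul hC,
          ENNReal.ofReal_add hB (mul_nonneg hC (Finset.sum_nonneg fun i _ => hK i))]

theorem exists_clm_of_eLpNorm_le {X E : Type*} [MeasurableSpace X] {μ : Measure X}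
    [NormedAddCommGroup E] [NormedSpace ℂ E] (A : E →L[ℂ] Lp ℂ 2 μ) {m : X → ℂ}
    (hm : AEStronglyMeasurable m μ) {C : ℝ} (hC : 0 ≤ C)
    (h : ∀ f, eLpNorm (fun x => m x * A f x) 2 μ ≤ ENNReal.ofReal (C * ‖f‖)) :
    ∃ Q : E →L[ℂ] Lp ℂ 2 μ, (∀ f, Q f =ᵐ[μ] fun x => m x * A f x) ∧ ‖Q‖ ≤ C := by
  have hmem : ∀ f, MemLp (fun x => m x * A f x) 2 μ := fun f =>
    ⟨hm.mul (Lp.aestronglyMeasurable _), (h f).trans_lt ENNReal.ofReal_lt_top⟩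
  let L : E →ₗ[ℂ] Lp ℂ 2 μ :=
    { toFun f := (hmem f).toLp _
      map_add' f g := by
        rw [← MemLp.toLp_add]
        refine MemLp.toLp_congr _ _ ?_
        rw [map_add]
        filter_upwards [Lp.coeFn_add (A f) (A g)] with x hx
        rw [hx, Pi.add_apply, Pi.add_apply, mul_add]
      map_smul' z f := by
        rw [RingHom.id_apply, ← MemLp.toLp_const_smul]
        refine MemLp.toLp_congr _ _ ?_
        rw [map_smul]
        filter_upwards [Lp.coeFn_smul z (A f)] with x hx
        rw [hx, Pi.smul_apply, Pi.smul_apply, mul_smul_comm] }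
  have hL : ∀ f, ‖L f‖ ≤ C * ‖f‖ := fun f => by
    change ‖(hmem f).toLp _‖ ≤ _
    rw [Lp.norm_toLp]
    exact ENNReal.toReal_le_of_le_ofReal (by positivity) (h f)
  exact ⟨L.mkContinuous C hL, fun f => (hmem f).coeFn_toLp, L.mkContinuous_norm_le hC hL⟩

section InteriorRegularity

variable {k : ℕ} {a : (Fin n → ℕ) → ℂ} {c s₀ s : ℝ}

theorem testPairing_eq_inner (f : L2 Ω) (φ : 𝓓(Ω, ℂ)) :
    testPairing f φ = inner ℂ (testToL2 (conjTest φ)) f := by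
  rw [testPairing_L2, inner_testToL2_conjTest]

theorem distribEq_iff_testPairing {u g : L2 Ω} :
    DistribEq Ω k a u g ↔ ∀ φ : 𝓓(Ω, ℂ), testPairing g φ =
      testPairing u (constCoeffOp k (fun α => (-1) ^ mlen α * a α) φ) := by
  simp only [DistribEq, testPairing_L2]

theorem DistribEq.add {u v f g : L2 Ω} (hu : DistribEq Ω k a u f) (hv : DistribEq Ω k a v g) :
    DistribEq Ω k a (u + v) (f + g) := by
  rw [distribEq_iff_testPairing] at *
  intro φ
  rw [testPairing_eq_inner, inner_add_right, ← testPairing_eq_inner, ← testPairing_eq_inner, hu, hv,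
    testPairing_eq_inner (u + v), inner_add_right, ← testPairing_eq_inner, ← testPairing_eq_inner]

theorem DistribEq.smul {u f : L2 Ω} (hu : DistribEq Ω k a u f) (z : ℂ) :
    DistribEq Ω k a (z • u) (z • f) := by
  rw [distribEq_iff_testPairing] at *
  intro φ
  rw [testPairing_eq_inner, inner_smul_right, ← testPairing_eq_inner, hu,
    testPairing_eq_inner (z • u), inner_smul_right, ← testPairing_eq_inner]

/-- The equation is tested against `χ` times a plane wave; the commutator of `P` with `χ` only
contributes the lower order symbol `X`. -/
theorem shiftedSymbol_mul_testPairing {w g : L2 Ω}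
    (hw : DistribEq Ω k a w (g - ((s : ℂ) ^ k) • w)) {χ η : 𝓓(Ω, ℂ)} {ξ : Rn n}
    (hη : constCoeffOp k (fun α => (-1) ^ mlen α * a α) (modulate ξ χ) =
      modulate ξ (opSymbol k a ξ • χ + η)) :
    shiftedSymbol k a s ξ * testPairing w (modulate ξ χ) =
      testPairing g (modulate ξ χ) - testPairing w (modulate ξ η) := by
  have htest := distribEq_iff_testPairing.1 hw (modulate ξ χ)
  rw [hη, testPairing_eq_inner, inner_sub_right, inner_smul_right, ← testPairing_eq_inner,
    ← testPairing_eq_inner, map_add, map_add, map_smul, map_smul, smul_eq_mul] at htest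
  rw [shiftedSymbol]
  linear_combination -htest

section

variable (hbd : Bornology.IsBounded (Ω : Set (Rn n)))

include hbd

theorem coeFn_fourierL2_cutoffOp (χ : 𝓓(Ω, ℂ)) (w : L2 Ω) :
    fourierL2 Ω (cutoffOp Ω χ w) =ᵐ[volume] fun ξ => testPairing w (modulate ξ χ) := by
  refine (coeFn_fourierL2 hbd _).trans (.of_forall fun ξ => ?_)
  rw [fourierOn_congr (coeFn_cutoffOp χ w), fourierOn]
  refine Eq.trans ?_ (testPairing_L2 w (modulate ξ χ)).symm
  refine integral_congr_ae (.of_forall fun x => ?_)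
  simp only [modulate_apply]
  ring

theorem aestronglyMeasurable_testPairing_modulate (χ : 𝓓(Ω, ℂ)) (w : L2 Ω) :
    AEStronglyMeasurable (fun ξ => testPairing w (modulate ξ χ)) volume :=
  (Lp.aestronglyMeasurable _).congr (coeFn_fourierL2_cutoffOp hbd χ w)

theorem eLpNorm_testPairing_modulate_le (χ : 𝓓(Ω, ℂ)) (w : L2 Ω) :
    eLpNorm (fun ξ => testPairing w (modulate ξ χ)) 2 volume ≤
      ENNReal.ofReal (‖cutoffOp Ω χ‖ * ‖w‖) := by
  rw [← eLpNorm_congr_ae (coeFn_fourierL2_cutoffOp hbd χ w),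
    ← ENNReal.ofReal_toReal (Lp.eLpNorm_ne_top _), ← Lp.norm_def, LinearIsometry.norm_map]
  exact ENNReal.ofReal_le_ofReal ((cutoffOp Ω χ).le_opNorm w)

end

namespace IsCoerciveSymbol

variable (h : IsCoerciveSymbol k a c s₀)

include h

theorem exists_pow_mul_norm_testPairing_le {j : ℕ} (hj : j + 1 ≤ k) (χ : 𝓓(Ω, ℂ)) :
    ∃ C : ℝ, 0 ≤ C ∧ ∃ S : Finset 𝓓(Ω, ℂ), ∀ s, s₀ ≤ s → ∀ w g : L2 Ω,
      DistribEq Ω k a w (g - ((s : ℂ) ^ k) • w) → ∀ ξ,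
      c * ((‖ξ‖ + s) ^ (j + 1) * ‖testPairing w (modulate ξ χ)‖) ≤
        ‖testPairing g (modulate ξ χ)‖ +
          C * ∑ φ ∈ S, (‖ξ‖ + s) ^ j * ‖testPairing w (modulate ξ φ)‖ := by
  obtain ⟨i, rfl⟩ := Nat.exists_eq_add_of_le hj
  obtain ⟨X, hX, hP⟩ := exists_adjoint_modulate (j + 1 + i) a χ
  obtain ⟨C, hC, S, hS⟩ := exists_norm_apply_le_sum hX
  refine ⟨C, hC, S, fun s hs w g hw ξ => ?_⟩
  have hpos := h.norm_add_pos hs ξ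
  have hD : 1 ≤ ‖ξ‖ + s := by linarith [norm_nonneg ξ, h.one_le hs]
  set D := ‖ξ‖ + s
  have hexp : ((j + 1 + i : ℕ) : ℤ) - 1 = (j + i : ℕ) := by omega
  have herror : ‖testPairing w (modulate ξ (X ξ))‖ ≤
      C * D ^ (j + i) * ∑ φ ∈ S, ‖testPairing w (modulate ξ φ)‖ := by
    refine (hS (testPairing w ∘ₗ modulate ξ) ξ).trans ?_
    rw [hexp, zpow_natCast]
    simp only [LinearMap.comp_apply]
    gcongr
    linarith [h.one_le hs]
  have hmain : c * D ^ (j + 1 + i) * ‖testPairing w (modulate ξ χ)‖ ≤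
      ‖testPairing g (modulate ξ χ)‖ + ‖testPairing w (modulate ξ (X ξ))‖ := by
    refine (mul_le_mul_of_nonneg_right (h.mul_pow_le_norm hs ξ) (norm_nonneg _)).trans ?_
    rw [← norm_mul, shiftedSymbol_mul_testPairing hw (hP ξ)]
    exact norm_sub_le _ _
  refine le_of_mul_le_mul_left ?_ (pow_pos hpos i)
  rw [← Finset.mul_sum]
  calc D ^ i * (c * (D ^ (j + 1) * ‖testPairing w (modulate ξ χ)‖))
      = c * D ^ (j + 1 + i) * ‖testPairing w (modulate ξ χ)‖ := by ring
    _ ≤ D ^ i * ‖testPairing g (modulate ξ χ)‖ +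
        C * D ^ (j + i) * ∑ φ ∈ S, ‖testPairing w (modulate ξ φ)‖ :=
      hmain.trans (add_le_add (le_mul_of_one_le_left (norm_nonneg _) (one_le_pow₀ hD)) herror)
    _ = _ := by ring

variable (hbd : Bornology.IsBounded (Ω : Set (Rn n)))

include hbd

/-- This is the interior elliptic estimate with parameter; each step of the induction on `j` gains
one order of regularity from the estimates for the cut-offs which occur in `[P, χ]`. -/
theorem exists_eLpNorm_pow_mul_testPairing_le {j : ℕ} (hj : j ≤ k) (χ : 𝓓(Ω, ℂ)) :
    ∃ C : ℝ, 0 ≤ C ∧ ∀ s, s₀ ≤ s → ∀ w g : L2 Ω, DistribEq Ω k a w (g - ((s : ℂ) ^ k) • w) →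
      eLpNorm (fun ξ => (‖ξ‖ + s) ^ j • testPairing w (modulate ξ χ)) 2 volume ≤
        ENNReal.ofReal (C * (‖w‖ + ‖g‖)) := by
  induction j generalizing χ with
  | zero =>
    refine ⟨‖cutoffOp Ω χ‖, norm_nonneg _, fun s _ w g _ => ?_⟩
    simp only [pow_zero, one_smul]
    refine (eLpNorm_testPairing_modulate_le hbd χ w).trans (ENNReal.ofReal_le_ofReal ?_)
    gcongr
    linarith [norm_nonneg g]
  | succ j ih =>
    obtain ⟨C, hC, S, hS⟩ := h.exists_pow_mul_norm_testPairing_le hj χ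
    choose K hK hKle using ih (Nat.le_of_succ_le hj)
    have hc := h.pos
    have hKsum := Finset.sum_nonneg fun φ (_ : φ ∈ S) => hK φ
    refine ⟨c⁻¹ * (‖cutoffOp Ω χ‖ + C * ∑ φ ∈ S, K φ), by positivity, fun s hs w g hw => ?_⟩
    have hmeas : ∀ φ : 𝓓(Ω, ℂ), AEStronglyMeasurable
        (fun ξ => (‖ξ‖ + s) ^ j • testPairing w (modulate ξ φ)) volume := fun φ =>
      ((continuous_norm.add continuous_const).pow j).aestronglyMeasurable.smul
        (aestronglyMeasurable_testPairing_modulate hbd φ w)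
    have hscaled := eLpNorm_le_of_norm_le_add_sum one_le_two (S := S)
      (u := c • fun ξ => (‖ξ‖ + s) ^ (j + 1) • testPairing w (modulate ξ χ)) hC
      (mul_nonneg (norm_nonneg (cutoffOp Ω χ)) (norm_nonneg g))
      (fun φ => mul_nonneg (hK φ) (add_nonneg (norm_nonneg w) (norm_nonneg g)))
      (aestronglyMeasurable_testPairing_modulate hbd χ g) hmeas
      (.of_forall fun ξ => by
        have hpos := h.norm_add_pos hs ξ
        simp only [Pi.smul_apply, norm_smul, norm_pow, Real.norm_of_nonneg hpos.le,
          Real.norm_of_nonneg hc.le]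
        exact hS s hs w g hw ξ)
      (eLpNorm_testPairing_modulate_le hbd χ g) (fun φ => hKle φ s hs w g hw)
    rw [eLpNorm_const_smul, Real.enorm_of_nonneg hc.le] at hscaled
    rw [mul_assoc, ENNReal.ofReal_mul (by positivity), ENNReal.ofReal_inv_of_pos hc,
      ← ENNReal.mul_le_iff_le_inv (ENNReal.ofReal_pos.2 hc).ne' ENNReal.ofReal_ne_top]
    refine hscaled.trans (ENNReal.ofReal_le_ofReal ?_)
    rw [← Finset.sum_mul, add_mul, ← mul_assoc]
    gcongr
    linarith [norm_nonneg w]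

theorem exists_cutoffOp_eq_freeResolvent (χ : 𝓓(Ω, ℂ)) :
    ∃ C : ℝ, 0 ≤ C ∧ ∀ s, s₀ ≤ s → ∀ {E : Type} [NormedAddCommGroup E] [NormedSpace ℂ E]
      (A B : E →L[ℂ] L2 Ω), (∀ f, DistribEq Ω k a (A f) (B f - ((s : ℂ) ^ k) • A f)) →
      ∃ Q : E →L[ℂ] Lp ℂ 2 (volume : Measure (Rn n)), ‖Q‖ ≤ C * (‖A‖ + ‖B‖) ∧
        ∀ f, cutoffOp Ω χ (A f) = freeResolvent Ω k a s 0 (Q f) := by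
  obtain ⟨K, hK, hest⟩ := h.exists_eLpNorm_pow_mul_testPairing_le hbd le_rfl χ
  obtain ⟨M, hM, hsymbol⟩ := exists_norm_opSymbol_add_pow_le k a
  refine ⟨M * K, by positivity, fun s hs E _ _ A B hAB => ?_⟩
  have hbound (f : E) : eLpNorm (fun ξ => shiftedSymbol k a s ξ *
      fourierL2 Ω (cutoffOp Ω χ (A f)) ξ) 2 volume ≤
        ENNReal.ofReal (M * K * (‖A‖ + ‖B‖) * ‖f‖) := by
    refine (eLpNorm_le_mul_eLpNorm_of_ae_le_mul (c := M)
      (g := fun ξ => (‖ξ‖ + s) ^ k • testPairing (A f) (modulate ξ χ)) ?_ 2).trans ?_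
    · filter_upwards [coeFn_fourierL2_cutoffOp hbd χ (A f)] with ξ hξ
      rw [hξ, norm_mul, norm_smul, norm_pow, Real.norm_of_nonneg (h.norm_add_pos hs ξ).le,
        ← mul_assoc]
      gcongr
      exact hsymbol s (h.one_le hs) ξ
    · rw [mul_assoc, mul_assoc, ENNReal.ofReal_mul hM]
      gcongr
      refine (hest s hs (A f) (B f) (hAB f)).trans (ENNReal.ofReal_le_ofReal ?_)
      gcongr
      rw [add_mul]
      exact add_le_add (A.le_opNorm f) (B.le_opNorm f)
  obtain ⟨Q, hQ, hQn⟩ := exists_clm_of_eLpNorm_le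
    ((fourierL2 Ω).toContinuousLinearMap ∘L cutoffOp Ω χ ∘L A)
    continuous_shiftedSymbol.aestronglyMeasurable (by positivity) hbound
  refine ⟨Q, hQn, fun f => ?_⟩
  rw [← fourierL2Adj_fourierL2 (cutoffOp Ω χ (A f)), freeResolvent,
    ContinuousLinearMap.comp_apply]
  congr 1
  have h₀ : mlen (0 : Fin n → ℕ) ≤ k := by simp [mlen_zero]
  apply Lp.ext
  filter_upwards [hQ f, coeFn_lpMul (h.memLp_resolventMultiplier hs h₀) (Q f)] with ξ hξ hmul
  rw [hmul, hξ, resolventMultiplier, monomialSymbol_zero, one_div]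
  exact (inv_mul_cancel_left₀ (h.shiftedSymbol_ne_zero hs ξ) _).symm

end IsCoerciveSymbol

end InteriorRegularity

section BlockPerturbation

variable {H : Type*} [NormedAddCommGroup H] [InnerProductSpace ℂ H]

/-- The operator `(1 - Π) + z Π`, where `Π` is the orthogonal projection onto `K`. It serves to
rebalance the two blocks of an operator before a coercivity argument. -/
def blockScaling (K : Submodule ℂ H) [K.HasOrthogonalProjection] (z : ℂ) : H →L[ℂ] H :=
  1 - K.starProjection + z • K.starProjection

section

variable (K : Submodule ℂ H) [K.HasOrthogonalProjection]

theorem blockScaling_inv_mul_blockScaling {z : ℂ} (hz : z ≠ 0) :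
    blockScaling K z⁻¹ * blockScaling K z = 1 := by
  have hproj : K.starProjection * K.starProjection = K.starProjection :=
    K.isIdempotentElem_starProjection
  simp only [blockScaling, add_mul, mul_add, sub_mul, mul_sub, one_mul, mul_one, smul_mul_assoc,
    mul_smul_comm, hproj, sub_self, zero_add, smul_inv_smul₀ hz]
  abel

theorem norm_blockScaling_le (z : ℂ) : ‖blockScaling K z‖ ≤ 1 + ‖z‖ := by
  refine norm_add_le_of_le ?_ ?_
  · rw [ContinuousLinearMap.one_def, ← Submodule.starProjection_orthogonal]
    exact Kᗮ.starProjection_norm_le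
  · rw [norm_smul]
    exact mul_le_of_le_one_right (norm_nonneg z) K.starProjection_norm_le

theorem inner_blockScaling (z : ℂ) (x v : H) :
    inner ℂ x (blockScaling K z v) =
      inner ℂ (x - K.starProjection x) v + inner ℂ (K.starProjection x) (z • v) := by
  rw [show blockScaling K z v = v - K.starProjection v + z • K.starProjection v from rfl,
    inner_add_right, inner_sub_right, inner_sub_left, inner_smul_right, inner_smul_right,
    Submodule.inner_starProjection_left_eq_right]

theorem norm_sq_eq_sub_starProjection_add (x : H) :
    ‖x‖ ^ 2 = ‖x - K.starProjection x‖ ^ 2 + ‖K.starProjection x‖ ^ 2 := by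
  rw [K.norm_sq_eq_add_norm_sq_starProjection x, K.starProjection_orthogonal_val, add_comm]

/-- The operator `(1 - Π) + V Π + E`, where `Π` is the orthogonal projection onto `K`. -/
def blockPerturbation (V E : H →L[ℂ] H) : H →L[ℂ] H :=
  1 - K.starProjection + V ∘L K.starProjection + E

variable {K} {V : H →L[ℂ] H} {M d : ℝ} {c : ℂ}

/-- Scaling the block of `K` by a large multiple of `c` absorbs the off-diagonal entry of `V`. -/
theorem half_mul_sq_norm_le_re_inner_blockScaling (hd : 0 < d) (hV : ‖V‖ ≤ M)
    (hVd : ∀ y ∈ K, d * ‖y‖ ^ 2 ≤ (inner ℂ y (c • V y)).re) (x : H) :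
    1 / 2 * ‖x‖ ^ 2 ≤ (inner ℂ x (blockScaling K ((((M ^ 2 + 1) / (2 * d) : ℝ) : ℂ) * c)
      (blockPerturbation K V 0 x))).re := by
  set t : ℝ := (M ^ 2 + 1) / (2 * d) with ht
  set y := x - K.starProjection x
  set w := K.starProjection x
  have hwK : w ∈ K := K.starProjection_apply_mem x
  have hwy : inner ℂ w y = 0 := Submodule.inner_right_of_mem_orthogonal hwK
    (K.sub_starProjection_mem_orthogonal x)
  have hoff : -(‖y‖ * (M * ‖w‖)) ≤ (inner ℂ y (V w)).re := by
    refine neg_le_of_abs_le ((Complex.abs_re_le_norm _).trans ((norm_inner_le_norm _ _).trans ?_))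
    gcongr
    exact V.le_of_opNorm_le hV w
  have hdiag : (M ^ 2 + 1) / 2 * ‖w‖ ^ 2 ≤ t * (inner ℂ w (c • V w)).re :=
    calc (M ^ 2 + 1) / 2 * ‖w‖ ^ 2 = t * (d * ‖w‖ ^ 2) := by rw [ht]; field_simp
      _ ≤ _ := mul_le_mul_of_nonneg_left (hVd w hwK) (by positivity)
  have hyy : (inner ℂ y y).re = ‖y‖ ^ 2 := inner_self_eq_norm_sq (𝕜 := ℂ) y
  have happly : blockPerturbation K V 0 x = y + V w := by
    simp [blockPerturbation, y, w]
  have hsplit : inner ℂ x (blockScaling K ((t : ℂ) * c) (y + V w)) =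
      inner ℂ y y + inner ℂ y (V w) + (t : ℂ) * inner ℂ w (c • V w) := by
    rw [inner_blockScaling, mul_smul, inner_smul_right, smul_add c y, inner_add_right,
      inner_add_right, inner_smul_right _ y, hwy, mul_zero, zero_add]
  rw [norm_sq_eq_sub_starProjection_add K x, happly, hsplit, Complex.add_re, Complex.add_re,
    Complex.re_ofReal_mul, hyy]
  nlinarith [sq_nonneg (‖y‖ - M * ‖w‖), norm_nonneg y, norm_nonneg w]

end

variable [CompleteSpace H]

theorem exists_inverse_of_coercive (T : H →L[ℂ] H) {κ : ℝ} (hκ : 0 < κ)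
    (hT : ∀ x, κ * ‖x‖ ^ 2 ≤ (inner ℂ x (T x)).re) :
    ∃ R : H →L[ℂ] H, T * R = 1 ∧ R * T = 1 ∧ ‖R‖ ≤ κ⁻¹ := by
  have hnorm : ∀ x, κ * ‖x‖ ^ 2 ≤ ‖inner ℂ x (T x)‖ := fun x =>
    (hT x).trans (Complex.re_le_norm _)
  obtain ⟨⟨T', R, hTR, hRT⟩, rfl⟩ := ContinuousLinearMap.isUnit_of_forall_le_norm_inner_map T
    (c := ⟨κ, hκ.le⟩) hκ fun x => by
      rw [norm_inner_symm, mul_comm]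
      exact hnorm x
  refine ⟨R, hTR, hRT, ContinuousLinearMap.opNorm_le_bound _ (by positivity) fun f => ?_⟩
  rcases (norm_nonneg (R f)).eq_or_lt with h0 | hpos
  · rw [← h0]; positivity
  · rw [← div_eq_inv_mul, le_div_iff₀ hκ]
    refine le_of_mul_le_mul_left ?_ hpos
    calc ‖R f‖ * (‖R f‖ * κ) = κ * ‖R f‖ ^ 2 := by ring
      _ ≤ ‖inner ℂ (R f) (T' (R f))‖ := hnorm (R f)
      _ ≤ ‖R f‖ * ‖T' (R f)‖ := norm_inner_le_norm _ _
      _ = ‖R f‖ * ‖f‖ := by rw [show T' (R f) = f from DFunLike.congr_fun hTR f]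

theorem exists_inverse_blockPerturbation (M : ℝ) {d : ℝ} (hd : 0 < d) {c : ℂ} (hc : c ≠ 0) :
    ∃ η : ℝ, 0 < η ∧ ∃ C : ℝ, 0 ≤ C ∧ ∀ (K : Submodule ℂ H) [K.HasOrthogonalProjection]
      (V E : H →L[ℂ] H), ‖V‖ ≤ M → (∀ y ∈ K, d * ‖y‖ ^ 2 ≤ (inner ℂ y (c • V y)).re) → ‖E‖ ≤ η →
      ∃ R : H →L[ℂ] H, ‖R‖ ≤ C ∧ blockPerturbation K V E * R = 1 ∧
        R * blockPerturbation K V E = 1 := by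
  set z : ℂ := (((M ^ 2 + 1) / (2 * d) : ℝ) : ℂ) * c
  have hz : z ≠ 0 := mul_ne_zero (Complex.ofReal_ne_zero.2 (by positivity)) hc
  set B : ℝ := 1 + ‖z‖
  have hB : 0 < B := by positivity
  refine ⟨1 / (4 * B), by positivity, 4 * B, by positivity, fun K _ V E hV hK hE => ?_⟩
  have hJ := norm_blockScaling_le K z
  have hJinv := blockScaling_inv_mul_blockScaling K hz
  set J := blockScaling K z
  have hcoercive (x : H) : 1 / 4 * ‖x‖ ^ 2 ≤ (inner ℂ x ((J * blockPerturbation K V E) x)).re := by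
    have hsplit : (J * blockPerturbation K V E) x = J (blockPerturbation K V 0 x) + J (E x) := by
      simp [blockPerturbation]
    have hE' : ‖inner ℂ x (J (E x))‖ ≤ 1 / 4 * ‖x‖ ^ 2 :=
      calc ‖inner ℂ x (J (E x))‖ ≤ ‖x‖ * (B * (1 / (4 * B) * ‖x‖)) :=
            (norm_inner_le_norm _ _).trans (by
              gcongr
              exact (J.le_of_opNorm_le hJ _).trans (by gcongr; exact E.le_of_opNorm_le hE x))
        _ = 1 / 4 * ‖x‖ ^ 2 := by field_simp
    rw [hsplit, inner_add_right, Complex.add_re]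
    linarith [half_mul_sq_norm_le_re_inner_blockScaling hd hV hK x,
      neg_le_of_abs_le ((Complex.abs_re_le_norm _).trans hE')]
  obtain ⟨R, hR, hR', hRn⟩ := exists_inverse_of_coercive _ (by norm_num) hcoercive
  refine ⟨R * J, ?_, ?_, by rwa [mul_assoc]⟩
  · calc ‖R * J‖ ≤ (1 / 4)⁻¹ * B := (norm_mul_le _ _).trans (by gcongr)
      _ = 4 * B := by norm_num
  · calc blockPerturbation K V E * (R * J)
        = blockScaling K z⁻¹ * J * blockPerturbation K V E * (R * J) := by rw [hJinv, one_mul]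
      _ = blockScaling K z⁻¹ * (J * blockPerturbation K V E * R) * J := by simp only [mul_assoc]
      _ = 1 := by rw [hR, mul_one, hJinv]

end BlockPerturbation

theorem tsupport_partialDeriv_subset (i : Fin n) (φ : 𝓓(Ω, ℂ)) :
    tsupport (partialDeriv i φ) ⊆ tsupport φ := by
  have h : (partialDeriv i φ : Rn n → ℂ) =
      (fun L => L (EuclideanSpace.single i 1)) ∘ fderiv ℝ φ := funext (partialDeriv_apply i φ)
  rw [h]
  exact (tsupport_comp_subset (g := fun L : Rn n →L[ℝ] ℂ => L (EuclideanSpace.single i 1)) rfl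
    _).trans (tsupport_fderiv_subset ℝ)

theorem tsupport_mderiv_subset (α : Fin n → ℕ) (φ : 𝓓(Ω, ℂ)) :
    tsupport (mderiv α φ) ⊆ tsupport φ := by
  rw [mderiv_eq_foldr]
  induction multiIndexList α with
  | nil => rfl
  | cons i L ih => exact (tsupport_partialDeriv_subset i _).trans ih

theorem mderiv_zero (φ : 𝓓(Ω, ℂ)) : mderiv 0 φ = φ := by
  rw [mderiv_eq_foldr, List.length_eq_zero_iff.1 ((length_multiIndexList _).trans mlen_zero),
    List.foldr_nil]

theorem hasWeakDeriv_zero_self {f : Rn n → ℂ} (hf : LocallyIntegrableOn f (Ω : Set (Rn n))) :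
    HasWeakDeriv Ω 0 f f :=
  ⟨hf, hf, fun φ => by rw [mderiv_zero, mlen_zero, pow_zero, one_mul]⟩

theorem integrable_mul_testFunction {f : Rn n → ℂ} (hf : LocallyIntegrableOn f (Ω : Set (Rn n)))
    (φ : 𝓓(Ω, ℂ)) : Integrable fun x => f x * φ x :=
  (φ.integrable_bilin (ContinuousLinearMap.mul ℝ ℂ) hf).congr (.of_forall fun _ => mul_comm _ _)

theorem setIntegral_mul_testFunction_congr {U : Set (Rn n)} {φ : 𝓓(Ω, ℂ)} (hφ : tsupport φ ⊆ U)
    {f₁ f₂ : Rn n → ℂ} (h : ∀ᵐ x ∂volume.restrict (Ω : Set (Rn n)), x ∈ U → f₁ x = f₂ x) :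
    ∫ x in (Ω : Set (Rn n)), f₁ x * φ x = ∫ x in (Ω : Set (Rn n)), f₂ x * φ x := by
  refine integral_congr_ae ?_
  filter_upwards [h] with x hx
  by_cases hxφ : x ∈ tsupport φ
  · rw [hx (hφ hxφ)]
  · rw [image_eq_zero_of_notMem_tsupport hxφ, mul_zero, mul_zero]

theorem ae_eq_on_of_forall_setIntegral_mul_testFunction_eq {U : Set (Rn n)} (hU : IsOpen U)
    {f₁ f₂ : Rn n → ℂ} (h₁ : LocallyIntegrableOn f₁ (Ω : Set (Rn n)))
    (h₂ : LocallyIntegrableOn f₂ (Ω : Set (Rn n)))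
    (h : ∀ φ : 𝓓(Ω, ℂ), tsupport φ ⊆ U → ∫ x in (Ω : Set (Rn n)), f₁ x * φ x =
      ∫ x in (Ω : Set (Rn n)), f₂ x * φ x) :
    ∀ᵐ x ∂volume.restrict (Ω : Set (Rn n)), x ∈ U → f₁ x = f₂ x := by
  rw [ae_restrict_iff' Ω.isOpen.measurableSet]
  have hzero := (hU.inter Ω.isOpen).ae_eq_zero_of_integral_contDiff_smul_eq_zero (f := f₁ - f₂)
    (μ := volume) ((h₁.sub h₂).mono_set Set.inter_subset_right) fun g hg hgc hgs => ?_
  · filter_upwards [hzero] with x hx hxΩ hxU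
    exact sub_eq_zero.1 (hx ⟨hxU, hxΩ⟩)
  · have hts : tsupport (fun x => (g x : ℂ)) ⊆ U ∩ Ω :=
      (tsupport_comp_subset Complex.ofReal_zero g).trans hgs
    let φ : 𝓓(Ω, ℂ) := ⟨fun x => (g x : ℂ), Complex.ofRealCLM.contDiff.comp hg,
      hgc.comp_left Complex.ofReal_zero, hts.trans Set.inter_subset_right⟩
    have hφ := h φ (hts.trans Set.inter_subset_left)
    rw [setIntegral_mul_testFunction, setIntegral_mul_testFunction, ← sub_eq_zero,
      ← integral_sub (integrable_mul_testFunction h₁ φ) (integrable_mul_testFunction h₂ φ)] at hφ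
    refine Eq.trans (integral_congr_ae (.of_forall fun x => ?_)) hφ
    change g x • (f₁ x - f₂ x) = f₁ x * g x - f₂ x * g x
    rw [Complex.real_smul]
    ring

namespace HasWeakDeriv

variable {α : Fin n → ℕ} {f₁ f₂ g₁ g₂ : Rn n → ℂ}

theorem ae_eq_on (h₁ : HasWeakDeriv Ω α f₁ g₁) (h₂ : HasWeakDeriv Ω α f₂ g₂) {U : Set (Rn n)}
    (hU : IsOpen U) (h : ∀ᵐ x ∂volume.restrict (Ω : Set (Rn n)), x ∈ U → f₁ x = f₂ x) :
    ∀ᵐ x ∂volume.restrict (Ω : Set (Rn n)), x ∈ U → g₁ x = g₂ x := by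
  refine ae_eq_on_of_forall_setIntegral_mul_testFunction_eq hU h₁.2.1 h₂.2.1 fun φ hφ => ?_
  rw [h₁.2.2, h₂.2.2,
    setIntegral_mul_testFunction_congr ((tsupport_mderiv_subset α φ).trans hφ) h]

theorem ae_eq (h₁ : HasWeakDeriv Ω α f₁ g₁) (h₂ : HasWeakDeriv Ω α f₁ g₂) :
    g₁ =ᵐ[volume.restrict (Ω : Set (Rn n))] g₂ := by
  filter_upwards [h₁.ae_eq_on h₂ isOpen_univ (.of_forall fun _ _ => rfl)] with x hx
  exact hx (Set.mem_univ x)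

theorem add (h₁ : HasWeakDeriv Ω α f₁ g₁) (h₂ : HasWeakDeriv Ω α f₂ g₂) :
    HasWeakDeriv Ω α (f₁ + f₂) (g₁ + g₂) := by
  have hadd : ∀ {u v : Rn n → ℂ}, LocallyIntegrableOn u (Ω : Set (Rn n)) →
      LocallyIntegrableOn v (Ω : Set (Rn n)) → ∀ φ : 𝓓(Ω, ℂ),
      ∫ x in (Ω : Set (Rn n)), (u + v) x * φ x =
        (∫ x in (Ω : Set (Rn n)), u x * φ x) + ∫ x in (Ω : Set (Rn n)), v x * φ x := by
    intro u v hu hv φ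
    simp only [Pi.add_apply, add_mul]
    exact integral_add (integrable_mul_testFunction hu φ).integrableOn
      (integrable_mul_testFunction hv φ).integrableOn
  refine ⟨h₁.1.add h₂.1, h₁.2.1.add h₂.2.1, fun φ => ?_⟩
  rw [hadd h₁.2.1 h₂.2.1, hadd h₁.1 h₂.1, h₁.2.2, h₂.2.2, mul_add]

end HasWeakDeriv

theorem exists_ae_eq_of_ae_eq_on_inter {X ι Y : Type*} [TopologicalSpace X]
    [SecondCountableTopology X] [MeasurableSpace X] {μ : Measure X} [Inhabited Y] {U : ι → Set X}
    (hU : ∀ i, IsOpen (U i)) {d : ι → X → Y}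
    (h : ∀ i j, ∀ᵐ x ∂μ, x ∈ U i ∩ U j → d i x = d j x) :
    ∃ D : X → Y, ∀ i, ∀ᵐ x ∂μ, x ∈ U i → D x = d i x := by
  classical
  obtain ⟨T, hT, hTU⟩ := isOpen_iUnion_countable U hU
  have hmem : ∀ i, ∀ x ∈ U i, ∃ j ∈ T, x ∈ U j := fun i x hx => by
    simpa only [Set.mem_iUnion, exists_prop] using hTU.ge (Set.mem_iUnion_of_mem i hx)
  refine ⟨fun x => if hx : ∃ j ∈ T, x ∈ U j then d hx.choose x else default, fun i => ?_⟩
  filter_upwards [(ae_ball_iff hT).2 fun j _ => h j i] with x hx hxi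
  have hex := hmem i x hxi
  rw [dif_pos hex]
  exact hx _ hex.choose_spec.1 ⟨hex.choose_spec.2, hxi⟩

theorem exists_hasWeakDeriv_of_cutoffOp (w : L2 Ω) (α : Fin n → ℕ)
    (h : ∀ χ : 𝓓(Ω, ℂ), ∃ d : L2 Ω, HasWeakDeriv Ω α (cutoffOp Ω χ w) d) :
    ∃ D : Rn n → ℂ, HasWeakDeriv Ω α w D := by
  choose d hd using h
  let ι := {p : 𝓓(Ω, ℂ) × Opens (Rn n) // ∀ x ∈ p.2, p.1 x = 1}
  have hcutoff (i : ι) : ∀ᵐ x ∂volume.restrict (Ω : Set (Rn n)), x ∈ i.1.2 →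
      cutoffOp Ω i.1.1 w x = w x := by
    filter_upwards [coeFn_cutoffOp i.1.1 w] with x hx hxi
    rw [hx, i.2 x hxi, one_mul]
  obtain ⟨D, hD⟩ := exists_ae_eq_of_ae_eq_on_inter (μ := volume.restrict (Ω : Set (Rn n)))
    (fun i : ι => i.1.2.isOpen) (d := fun i x => d i.1.1 x) fun i j =>
      (hd i.1.1).ae_eq_on (hd j.1.1) (i.1.2.isOpen.inter j.1.2.isOpen) <| by
        filter_upwards [hcutoff i, hcutoff j] with x hxi hxj hx
        rw [hxi hx.1, hxj hx.2]
  have hcover {K : Set (Rn n)} (hK : IsCompact K) (hKΩ : K ⊆ Ω) :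
      ∃ i : ι, K ⊆ i.1.2 := by
    obtain ⟨χ, U, hU, hKU, hχ⟩ := exists_testFunction_eq_one hK hKΩ
    exact ⟨⟨(χ, ⟨U, hU⟩), hχ⟩, hKU⟩
  refine ⟨D, locallyIntegrableOn_L2 w, fun x hx => ?_, fun φ => ?_⟩
  · obtain ⟨i, hi⟩ := hcover isCompact_singleton (Set.singleton_subset_iff.2 hx)
    obtain ⟨V, hV, hint⟩ := locallyIntegrableOn_L2 (d i.1.1) x hx
    refine ⟨i.1.2 ∩ Ω ∩ V, Filter.inter_mem (Filter.inter_mem (mem_nhdsWithin_of_mem_nhds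
      (i.1.2.isOpen.mem_nhds (hi rfl))) self_mem_nhdsWithin) hV, ?_⟩
    have hdD : d i.1.1 =ᵐ[volume.restrict (i.1.2 ∩ Ω : Set (Rn n))] D := by
      rw [← Measure.restrict_restrict i.1.2.isOpen.measurableSet, Filter.EventuallyEq,
        ae_restrict_iff' i.1.2.isOpen.measurableSet]
      filter_upwards [hD i] with y hy hyi
      exact (hy hyi).symm
    exact (hint.mono_set Set.inter_subset_right).congr_fun_ae
      (ae_restrict_of_ae_restrict_of_subset Set.inter_subset_left hdD)
  · obtain ⟨i, hi⟩ := hcover φ.hasCompactSupport φ.tsupport_subset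
    rw [setIntegral_mul_testFunction_congr hi (hD i), (hd i.1.1).2.2 φ,
      setIntegral_mul_testFunction_congr ((tsupport_mderiv_subset α φ).trans hi) (hcutoff i)]

section ShiftedKernel

variable {k : ℕ} {a : (Fin n → ℕ) → ℂ} {c s₀ s : ℝ}

theorem mderiv_add (α : Fin n → ℕ) (φ ψ : 𝓓(Ω, ℂ)) :
    mderiv α (φ + ψ) = mderiv α φ + mderiv α ψ := by
  simp only [mderiv_eq_foldr]
  induction multiIndexList α with
  | nil => rfl
  | cons i L ih => simp only [List.foldr_cons, ih, map_add]

theorem mderiv_smul (α : Fin n → ℕ) (z : ℂ) (φ : 𝓓(Ω, ℂ)) :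
    mderiv α (z • φ) = z • mderiv α φ := by
  simp only [mderiv_eq_foldr]
  induction multiIndexList α with
  | nil => rfl
  | cons i L ih => simp only [List.foldr_cons, ih, map_smul]

/-- The map `φ ↦ (P + s ^ k) φ` from test functions to `L²(Ω)`. -/
def shiftedOpL2 (Ω : Opens (Rn n)) (k : ℕ) (a : (Fin n → ℕ) → ℂ) (s : ℝ) :
    𝓓(Ω, ℂ) →ₗ[ℂ] L2 Ω where
  toFun φ := testToL2 (shiftedOp k a s φ)
  map_add' φ ψ := by
    rw [← map_add]
    simp only [shiftedOp, constCoeffOp, mderiv_add, smul_add, Finset.sum_add_distrib]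
    rw [add_add_add_comm]
  map_smul' z φ := by
    rw [RingHom.id_apply, ← map_smul]
    simp only [shiftedOp, constCoeffOp, mderiv_smul, smul_add, Finset.smul_sum, smul_comm z]

theorem shiftedOpL2_apply (φ : 𝓓(Ω, ℂ)) :
    shiftedOpL2 Ω k a s φ = testToL2 (shiftedOp k a s φ) := rfl

/-- The kernel of the maximal realization of `P + s ^ k` in `L²(Ω)`, for a formally self-adjoint
`P`; it is introduced as the orthogonal complement of the range of the minimal one. -/
def shiftedKernel (Ω : Opens (Rn n)) (k : ℕ) (a : (Fin n → ℕ) → ℂ) (s : ℝ) :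
    Submodule ℂ (L2 Ω) :=
  (LinearMap.range (shiftedOpL2 Ω k a s))ᗮ

instance : (shiftedKernel Ω k a s).HasOrthogonalProjection := by
  unfold shiftedKernel
  infer_instance

theorem shiftedOp_conjTest (hsa : IsFormallySelfAdjointOp k a) (φ : 𝓓(Ω, ℂ)) :
    shiftedOp k a s (conjTest φ) =
      conjTest (shiftedOp k (fun α => (-1) ^ mlen α * a α) s φ) := by
  ext x
  simp only [shiftedOp, constCoeffOp, mderiv_conjTest, add_apply, sum_apply, smul_apply,
    conjTest_apply, smul_eq_mul, map_add, map_sum, map_mul, map_pow, Complex.conj_ofReal, map_neg,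
    map_one]
  congr 1
  exact Finset.sum_congr rfl fun α hα => by rw [hsa α hα]

theorem mem_shiftedKernel_iff (hsa : IsFormallySelfAdjointOp k a) {w : L2 Ω} :
    w ∈ shiftedKernel Ω k a s ↔ DistribEq Ω k a w (-(((s : ℂ) ^ k) • w)) := by
  have hpairing (φ : 𝓓(Ω, ℂ)) : inner ℂ (shiftedOpL2 Ω k a s (conjTest φ)) w =
      testPairing w (constCoeffOp k (fun α => (-1) ^ mlen α * a α) φ) -
        testPairing (-(((s : ℂ) ^ k) • w) : L2 Ω) φ := by
    rw [shiftedOpL2_apply, shiftedOp_conjTest hsa, ← testPairing_eq_inner, shiftedOp, map_add,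
      map_smul, testPairing_eq_inner (-_), inner_neg_right, inner_smul_right,
      ← testPairing_eq_inner, sub_neg_eq_add, smul_eq_mul]
  rw [shiftedKernel, Submodule.mem_orthogonal, distribEq_iff_testPairing]
  constructor
  · intro hw φ
    have hφ := hw _ ⟨conjTest φ, rfl⟩
    rw [hpairing] at hφ
    exact (sub_eq_zero.1 hφ).symm
  · rintro hw _ ⟨φ, rfl⟩
    rw [← conjTest_conjTest φ, hpairing, sub_eq_zero]
    exact (hw _).symm

theorem mem_shiftedKernel_orthogonal_iff {y : L2 Ω} :
    y ∈ (shiftedKernel Ω k a s)ᗮ ↔ y ∈ closure (Set.range (shiftedOpL2 Ω k a s)) := by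
  rw [shiftedKernel, Submodule.orthogonal_orthogonal_eq_closure, ← SetLike.mem_coe,
    Submodule.topologicalClosure_coe, LinearMap.coe_range]

theorem DistribEq.right_unique {u f g : L2 Ω} (hf : DistribEq Ω k a u f)
    (hg : DistribEq Ω k a u g) : f = g := by
  refine Lp.ext ?_
  filter_upwards [ae_eq_on_of_forall_setIntegral_mul_testFunction_eq isOpen_univ
    (locallyIntegrableOn_L2 f) (locallyIntegrableOn_L2 g) fun φ _ => (hf φ).trans (hg φ).symm]
    with x hx
  exact hx (Set.mem_univ x)

theorem eLpNorm_sub_testFunction (u : L2 Ω) (φ : 𝓓(Ω, ℂ)) :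
    eLpNorm (fun x => u x - φ x) 2 (volume.restrict (Ω : Set (Rn n))) =
      ENNReal.ofReal ‖u - testToL2 φ‖ := by
  rw [Lp.norm_def, ENNReal.ofReal_toReal (Lp.eLpNorm_ne_top _)]
  refine eLpNorm_congr_ae ?_
  filter_upwards [Lp.coeFn_sub u (testToL2 φ), coeFn_testToL2 φ] with x hsub hφ
  rw [hsub, Pi.sub_apply, hφ]

theorem memH0_iff {u : L2 Ω} : MemH0 Ω k u ↔ ∃ D : (Fin n → ℕ) → L2 Ω,
    (∀ α ∈ multiIndices n 0 k, HasWeakDeriv Ω α u (D α)) ∧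
    ∀ δ : ℝ, 0 < δ → ∃ φ : 𝓓(Ω, ℂ), ∀ α ∈ multiIndices n 0 k,
      ‖D α - testToL2 (mderiv α φ)‖ < δ := by
  refine exists_congr fun D => and_congr_right fun _ => forall_congr' fun δ =>
    forall_congr' fun hδ => exists_congr fun φ => forall_congr' fun α => forall_congr' fun _ => ?_
  rw [eLpNorm_sub_testFunction, ENNReal.ofReal_lt_ofReal_iff hδ]

section

variable (h : IsCoerciveSymbol k a c s₀) (hs : s₀ ≤ s)
  (hbd : Bornology.IsBounded (Ω : Set (Rn n)))

include h hs hbd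

theorem memH0_freeResolvent {y : L2 Ω} (hy : y ∈ (shiftedKernel Ω k a s)ᗮ) :
    MemH0 Ω k (freeResolvent Ω k a s 0 (fourierL2 Ω y)) := by
  refine memH0_iff.2 ⟨fun α => freeResolvent Ω k a s α (fourierL2 Ω y), fun α hα =>
    hasWeakDeriv_freeResolvent h hs hbd (mem_multiIndices.1 hα).2 _, fun δ hδ => ?_⟩
  set A : ℝ := ∑ α ∈ multiIndices n 0 k, ‖freeResolvent Ω k a s α‖ + 1
  have hA : 0 < A := by positivity
  obtain ⟨_, ⟨φ, rfl⟩, hφ⟩ :=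
    Metric.mem_closure_iff.1 (mem_shiftedKernel_orthogonal_iff.1 hy) (δ / A) (by positivity)
  refine ⟨φ, fun α hα => ?_⟩
  have hαA : ‖freeResolvent Ω k a s α‖ < A := (Finset.single_le_sum
    (f := fun α => ‖freeResolvent Ω k a s α‖) (fun _ _ => norm_nonneg _) hα).trans_lt
      (lt_add_one _)
  rw [← freeResolvent_fourierL2_shiftedOp h hs hbd (mem_multiIndices.1 hα).2, ← map_sub, ← map_sub]
  calc _ ≤ ‖freeResolvent Ω k a s α‖ * ‖fourierL2 Ω (y - testToL2 (shiftedOp k a s φ))‖ :=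
        (freeResolvent Ω k a s α).le_opNorm _
    _ ≤ ‖freeResolvent Ω k a s α‖ * (δ / A) := by
        rw [LinearIsometry.norm_map, ← shiftedOpL2_apply, ← dist_eq_norm]
        gcongr
    _ < A * (δ / A) := by gcongr
    _ = δ := by field_simp

theorem exists_eq_freeResolvent_of_memH0 {u : L2 Ω} (hu : MemH0 Ω k u) :
    ∃ y ∈ (shiftedKernel Ω k a s)ᗮ, u = freeResolvent Ω k a s 0 (fourierL2 Ω y) := by
  obtain ⟨D, hD, happrox⟩ := memH0_iff.1 hu
  have h₀ : (0 : Fin n → ℕ) ∈ multiIndices n 0 k :=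
    mem_multiIndices.2 ⟨Nat.zero_le _, by simp [mlen_zero]⟩
  have hD₀ : D 0 = u :=
    Lp.ext ((hD 0 h₀).ae_eq (hasWeakDeriv_zero_self (locallyIntegrableOn_L2 u)))
  choose φ hφ using fun j : ℕ => happrox (1 / ((j : ℝ) + 1)) (by positivity)
  have hlim : ∀ α ∈ multiIndices n 0 k,
      Filter.Tendsto (fun j => testToL2 (mderiv α (φ j))) Filter.atTop (nhds (D α)) :=
    fun α hα => tendsto_iff_norm_sub_tendsto_zero.2 <| squeeze_zero (fun _ => norm_nonneg _)
      (fun j => by rw [norm_sub_rev]; exact (hφ j α hα).le) tendsto_one_div_add_atTop_nhds_zero_nat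
  have hlimu : Filter.Tendsto (fun j => testToL2 (φ j)) Filter.atTop (nhds u) := by
    simpa only [mderiv_zero, hD₀] using hlim 0 h₀
  set y : L2 Ω := ∑ α ∈ multiIndices n 0 k, a α • D α + ((s : ℂ) ^ k) • u
  have hlimy : Filter.Tendsto (fun j => shiftedOpL2 Ω k a s (φ j)) Filter.atTop (nhds y) := by
    have hop (j : ℕ) : shiftedOpL2 Ω k a s (φ j) = ∑ α ∈ multiIndices n 0 k,
        a α • testToL2 (mderiv α (φ j)) + ((s : ℂ) ^ k) • testToL2 (φ j) := by
      simp only [shiftedOpL2_apply, shiftedOp, constCoeffOp, map_add, map_sum, map_smul]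
    simp only [hop]
    exact (tendsto_finsetSum _ fun α hα => (hlim α hα).const_smul _).add (hlimu.const_smul _)
  refine ⟨y, mem_shiftedKernel_orthogonal_iff.2
    (mem_closure_of_tendsto hlimy (.of_forall fun j => ⟨φ j, rfl⟩)), ?_⟩
  have hresolvent := ((freeResolvent Ω k a s 0).continuous.tendsto _).comp
    (((fourierL2 Ω).continuous.tendsto y).comp hlimy)
  refine tendsto_nhds_unique hlimu (hresolvent.congr fun j => ?_)
  exact (freeResolvent_fourierL2_shiftedOp h hs hbd (mem_multiIndices.1 h₀).2 (φ j)).trans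
    (by rw [mderiv_zero])

theorem distribEq_freeResolvent_fourierL2 (g : L2 Ω) :
    DistribEq Ω k a (freeResolvent Ω k a s 0 (fourierL2 Ω g))
      (g - ((s : ℂ) ^ k) • freeResolvent Ω k a s 0 (fourierL2 Ω g)) := by
  simpa only [fourierL2Adj_fourierL2] using distribEq_freeResolvent h hs hbd (fourierL2 Ω g)

theorem sub_freeResolvent_mem_shiftedKernel_iff {w g : L2 Ω} :
    w - freeResolvent Ω k a s 0 (fourierL2 Ω g) ∈ shiftedKernel Ω k a s ↔
      DistribEq Ω k a w (g - ((s : ℂ) ^ k) • w) := by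
  rw [mem_shiftedKernel_iff h.isFormallySelfAdjointOp]
  have hfree := distribEq_freeResolvent_fourierL2 h hs hbd g
  constructor <;> intro hw
  · convert hw.add hfree using 1 <;> module
  · convert hw.add (hfree.smul (-1)) using 1 <;> module

end

section

variable (h : IsCoerciveSymbol k a c s₀) (hbd : Bornology.IsBounded (Ω : Set (Rn n)))

include h hbd

theorem exists_cutoffOp_comp_starProjection_eq (χ : 𝓓(Ω, ℂ)) :
    ∃ C : ℝ, 0 ≤ C ∧ ∀ s, s₀ ≤ s → ∃ Q : L2 Ω →L[ℂ] Lp ℂ 2 (volume : Measure (Rn n)), ‖Q‖ ≤ C ∧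
      cutoffOp Ω χ ∘L (shiftedKernel Ω k a s).starProjection = freeResolvent Ω k a s 0 ∘L Q := by
  obtain ⟨C, hC, hfactor⟩ := h.exists_cutoffOp_eq_freeResolvent hbd χ
  refine ⟨C, hC, fun s hs => ?_⟩
  obtain ⟨Q, hQ, hcut⟩ := hfactor s hs (shiftedKernel Ω k a s).starProjection 0 fun f => by
    rw [zero_apply, zero_sub]
    exact (mem_shiftedKernel_iff h.isFormallySelfAdjointOp).1
      (Submodule.starProjection_apply_mem _ f)
  rw [norm_zero, add_zero] at hQ
  exact ⟨Q, hQ.trans (mul_le_of_le_one_right hC (Submodule.starProjection_norm_le _)),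
    ContinuousLinearMap.ext hcut⟩

theorem exists_norm_cutoffOp_comp_starProjection_le (χ : 𝓓(Ω, ℂ)) :
    ∃ C : ℝ, 0 ≤ C ∧ ∀ s, s₀ ≤ s →
      ‖cutoffOp Ω χ ∘L (shiftedKernel Ω k a s).starProjection‖ ≤ C / s ^ k := by
  obtain ⟨C, hC, hfactor⟩ := exists_cutoffOp_comp_starProjection_eq h hbd χ
  have hc := h.pos
  refine ⟨(2 * Real.pi) ^ k / c * C, by positivity, fun s hs => ?_⟩
  have hs1 := h.one_le hs
  obtain ⟨Q, hQ, hcut⟩ := hfactor s hs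
  have hfree : ‖freeResolvent Ω k a s 0‖ ≤ (2 * Real.pi) ^ k / c / s ^ k := by
    simpa only [mlen_zero, Nat.sub_zero] using
      norm_freeResolvent_le (Ω := Ω) h hs (α := 0) (by simp [mlen_zero])
  rw [hcut]
  calc _ ≤ ‖freeResolvent Ω k a s 0‖ * ‖Q‖ := ContinuousLinearMap.opNorm_comp_le _ _
    _ ≤ ((2 * Real.pi) ^ k / c / s ^ k) * C := by gcongr
    _ = _ := by ring

end

end ShiftedKernel

section Coercivity

theorem re_inner_L2 {X : Type*} [MeasurableSpace X] {μ : Measure X} (f g : Lp ℂ 2 μ) :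
    (inner ℂ f g).re = ∫ x, (inner ℂ (f x) (g x)).re ∂μ := by
  rw [L2.inner_def]
  exact (integral_re (L2.integrable_inner (𝕜 := ℂ) f g)).symm

theorem sq_norm_L2 {X : Type*} [MeasurableSpace X] {μ : Measure X} (f : Lp ℂ 2 μ) :
    ‖f‖ ^ 2 = ∫ x, ‖f x‖ ^ 2 ∂μ := by
  rw [← inner_self_eq_norm_sq (𝕜 := ℂ) f]
  refine (re_inner_L2 f f).trans (integral_congr_ae (.of_forall fun x => ?_))
  exact inner_self_eq_norm_sq (𝕜 := ℂ) (f x)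

theorem mul_sq_norm_le_re_inner_add {X : Type*} [MeasurableSpace X] {μ : Measure X}
    {u v w : Lp ℂ 2 μ} {δ L : ℝ}
    (h : ∀ᵐ x ∂μ, δ * ‖u x‖ ^ 2 ≤ (inner ℂ (u x) (v x)).re + L * ‖w x‖ ^ 2) :
    δ * ‖u‖ ^ 2 ≤ (inner ℂ u v).re + L * ‖w‖ ^ 2 := by
  have hint (f : Lp ℂ 2 μ) : Integrable (fun x => ‖f x‖ ^ 2) μ := (Lp.memLp f).integrable_norm_pow
    two_ne_zero
  have hinner : Integrable (fun x => (inner ℂ (u x) (v x)).re) μ :=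
    (L2.integrable_inner (𝕜 := ℂ) u v).re
  rw [sq_norm_L2, sq_norm_L2, re_inner_L2, ← integral_const_mul, ← integral_const_mul,
    ← integral_add hinner ((hint w).const_mul L)]
  exact integral_mono_ae ((hint u).const_mul δ) (hinner.add ((hint w).const_mul L)) h

theorem exists_ae_norm_le {X E : Type*} [MeasurableSpace X] {μ : Measure X} [NormedAddCommGroup E]
    {f : X → E} (hf : MemLp f ∞ μ) : ∃ M : ℝ, 0 ≤ M ∧ ∀ᵐ x ∂μ, ‖f x‖ ≤ M := by
  refine ⟨(eLpNorm f ∞ μ).toReal, ENNReal.toReal_nonneg, ?_⟩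
  filter_upwards [enorm_ae_le_eLpNormEssSup f μ] with x hx
  rw [eLpNorm_exponent_top, ← toReal_enorm]
  exact ENNReal.toReal_mono (by simpa using hf.2.ne) hx

variable {V : Rn n → ℂ} (hbd : Bornology.IsBounded (Ω : Set (Rn n)))
  (hV : MemLp V ∞ (volume.restrict (Ω : Set (Rn n))))

include hbd hV

theorem exists_testFunction_coercive (hVc : CoerciveNearBoundary Ω V) :
    ∃ z : ℂ, z ≠ 0 ∧ ∃ δ : ℝ, 0 < δ ∧ ∃ L : ℝ, 0 ≤ L ∧ ∃ χ : 𝓓(Ω, ℂ),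
      ∀ᵐ x ∂volume.restrict (Ω : Set (Rn n)), δ ≤ (z * V x).re + L * ‖χ x‖ ^ 2 := by
  obtain ⟨U, hU, hfr, z, δ, hz, hδ, hVU⟩ := hVc
  have hΩU : closure (Ω : Set (Rn n)) \ U ⊆ Ω := by
    rintro x ⟨hx, hxU⟩
    by_contra hxΩ
    exact hxU (hfr ⟨hx, by rwa [Ω.isOpen.interior_eq]⟩)
  obtain ⟨χ, O, -, hΩO, hχ⟩ := exists_testFunction_eq_one (hbd.isCompact_closure.diff hU) hΩU
  obtain ⟨M, hM, hVM⟩ := exists_ae_norm_le hV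
  refine ⟨z, hz, δ, hδ, δ + ‖z‖ * M, by positivity, χ, ?_⟩
  filter_upwards [hVU, hVM, ae_restrict_mem Ω.isOpen.measurableSet] with x hxU hxM hxΩ
  by_cases hx : x ∈ U
  · have hpos : 0 ≤ (δ + ‖z‖ * M) * ‖χ x‖ ^ 2 := by positivity
    linarith [hxU hx]
  · rw [hχ x (hΩO ⟨subset_closure hxΩ, hx⟩), norm_one, one_pow, mul_one]
    have hre : -(‖z‖ * M) ≤ (z * V x).re := neg_le_of_abs_le <|
      (Complex.abs_re_le_norm _).trans (by rw [norm_mul]; gcongr)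
    linarith

/-- Elements of the kernel of `P + s ^ k` concentrate near `∂Ω` as `s → ∞`, and there `V` takes
values in a half-plane. -/
theorem exists_coercive_on_shiftedKernel {k : ℕ} {a : (Fin n → ℕ) → ℂ} {c s₀ : ℝ}
    (h : IsCoerciveSymbol k a c s₀) (hVc : CoerciveNearBoundary Ω V) :
    ∃ z : ℂ, z ≠ 0 ∧ ∃ d : ℝ, 0 < d ∧ ∃ s₁ : ℝ, s₀ ≤ s₁ ∧ ∀ s, s₁ ≤ s →
      ∀ x ∈ shiftedKernel Ω k a s,
        d * ‖x‖ ^ 2 ≤ (inner ℂ x (z • lpMul (volume.restrict (Ω : Set (Rn n))) V x)).re := by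
  obtain ⟨z, hz, δ, hδ, L, hL, χ, hχ⟩ := exists_testFunction_coercive hbd hV hVc
  obtain ⟨C, -, hcut⟩ := exists_norm_cutoffOp_comp_starProjection_le h hbd χ
  refine ⟨z, hz, δ / 2, by positivity, max s₀ (2 * L * C ^ 2 / δ), le_max_left _ _,
    fun s hs x hx => ?_⟩
  have hs₀ : s₀ ≤ s := (le_max_left _ _).trans hs
  have hs1 := h.one_le hs₀
  have hcutoff : ‖cutoffOp Ω χ x‖ ≤ C / s ^ k * ‖x‖ := by
    simpa only [ContinuousLinearMap.comp_apply, Submodule.starProjection_eq_self_iff.2 hx]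
      using ContinuousLinearMap.le_of_opNorm_le _ (hcut s hs₀) x
  have hsmall : L * (C / s ^ k) ^ 2 ≤ δ / 2 :=
    calc L * (C / s ^ k) ^ 2 ≤ L * (C ^ 2 / s) := by
          rw [div_pow, ← pow_mul]
          gcongr
          exact le_self_pow₀ hs1 (by have := h.one_le_order; lia)
      _ ≤ δ / 2 := by
          have hsL := (div_le_iff₀ hδ).1 ((le_max_right _ _).trans hs)
          rw [← mul_div_assoc, div_le_iff₀ (by positivity)]
          linarith
  have hcutoff_sq : L * ‖cutoffOp Ω χ x‖ ^ 2 ≤ δ / 2 * ‖x‖ ^ 2 :=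
    calc L * ‖cutoffOp Ω χ x‖ ^ 2 ≤ L * (C / s ^ k * ‖x‖) ^ 2 := by gcongr
      _ = L * (C / s ^ k) ^ 2 * ‖x‖ ^ 2 := by ring
      _ ≤ _ := by gcongr
  have hpointwise : δ * ‖x‖ ^ 2 ≤ (inner ℂ x (z • lpMul (volume.restrict (Ω : Set (Rn n))) V x)).re
      + L * ‖cutoffOp Ω χ x‖ ^ 2 := by
    refine mul_sq_norm_le_re_inner_add ?_
    filter_upwards [Lp.coeFn_smul z (lpMul (volume.restrict (Ω : Set (Rn n))) V x),
      coeFn_lpMul hV x, coeFn_cutoffOp χ x, hχ] with t hsmul hmul hcutoff hcoercive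
    have hre : (z * (V t * x t) * (starRingEnd ℂ) (x t)).re = (z * V t).re * ‖x t‖ ^ 2 := by
      rw [← mul_assoc, mul_assoc, Complex.mul_conj, Complex.re_mul_ofReal,
        Complex.normSq_eq_norm_sq]
    rw [hsmul, Pi.smul_apply, hmul, hcutoff, smul_eq_mul, RCLike.inner_apply, hre, norm_mul,
      mul_pow, ← mul_assoc, ← add_mul]
    gcongr
  linarith

end Coercivity

theorem HasWeakDeriv.congr_left {α : Fin n → ℕ} {f f' g : Rn n → ℂ} (h : HasWeakDeriv Ω α f g)
    (hf : f =ᵐ[volume.restrict (Ω : Set (Rn n))] f') : HasWeakDeriv Ω α f' g := by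
  refine ⟨h.1.congr hf, h.2.1, fun φ => (h.2.2 φ).trans ?_⟩
  congr 1
  refine integral_congr_ae ?_
  filter_upwards [hf] with x hx
  rw [hx]

namespace LowerOrderEq

variable {e : ℕ} {W : (Fin n → ℕ) → Rn n → ℂ}

theorem right_unique {w z₁ z₂ : L2 Ω} (h₁ : LowerOrderEq Ω e W w z₁)
    (h₂ : LowerOrderEq Ω e W w z₂) : z₁ = z₂ := by
  obtain ⟨D₁, hD₁, hz₁⟩ := h₁
  obtain ⟨D₂, hD₂, hz₂⟩ := h₂
  refine Lp.ext ?_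
  filter_upwards [hz₁, hz₂, (Finset.eventually_all _).2 fun α hα => (hD₁ α hα).ae_eq (hD₂ α hα)]
    with x hx₁ hx₂ hD
  rw [hx₁, hx₂]
  exact Finset.sum_congr rfl fun α hα => by rw [hD α hα]

theorem add {u v p q : L2 Ω} (hu : LowerOrderEq Ω e W u p) (hv : LowerOrderEq Ω e W v q) :
    LowerOrderEq Ω e W (u + v) (p + q) := by
  obtain ⟨D₁, hD₁, hp⟩ := hu
  obtain ⟨D₂, hD₂, hq⟩ := hv
  refine ⟨D₁ + D₂, fun α hα => ((hD₁ α hα).add (hD₂ α hα)).congr_left (Lp.coeFn_add u v).symm, ?_⟩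
  filter_upwards [hp, hq, Lp.coeFn_add p q] with x hpx hqx hadd
  rw [hadd, Pi.add_apply, hpx, hqx, ← Finset.sum_add_distrib]
  simp only [Pi.add_apply, mul_add]

end LowerOrderEq

/-- The operator `W (P + s ^ k)⁻¹`, as a function of the Fourier transform of the right-hand side;
`P + s ^ k` is inverted on the whole space and the result is restricted to `Ω`. -/
def lowerOrderResolvent (Ω : Opens (Rn n)) (k : ℕ) (a : (Fin n → ℕ) → ℂ) (s : ℝ) (e : ℕ)
    (W : (Fin n → ℕ) → Rn n → ℂ) : Lp ℂ 2 (volume : Measure (Rn n)) →L[ℂ] L2 Ω :=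
  ∑ α ∈ multiIndices n 1 e,
    lpMul (volume.restrict (Ω : Set (Rn n))) (W α) ∘L freeResolvent Ω k a s α

section LowerOrder

variable {k e : ℕ} {a : (Fin n → ℕ) → ℂ} {c s₀ s : ℝ} {W : (Fin n → ℕ) → Rn n → ℂ}

theorem coeFn_lowerOrderResolvent
    (hW : ∀ α ∈ multiIndices n 1 e, MemLp (W α) ∞ (volume.restrict (Ω : Set (Rn n))))
    (v : Lp ℂ 2 (volume : Measure (Rn n))) :
    ∀ᵐ x ∂volume.restrict (Ω : Set (Rn n)), lowerOrderResolvent Ω k a s e W v x =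
      ∑ α ∈ multiIndices n 1 e, W α x * freeResolvent Ω k a s α v x := by
  rw [lowerOrderResolvent, sum_apply]
  filter_upwards [Lp.coeFn_fun_finsetSum (multiIndices n 1 e) fun α =>
      (lpMul (volume.restrict (Ω : Set (Rn n))) (W α) ∘L freeResolvent Ω k a s α) v,
    (Finset.eventually_all _).2 fun α hα => coeFn_lpMul (hW α hα) (freeResolvent Ω k a s α v)]
    with x hsum hmul
  rw [hsum]
  exact Finset.sum_congr rfl hmul

theorem exists_norm_lowerOrderResolvent_le (h : IsCoerciveSymbol k a c s₀) (he : e < k) :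
    ∃ C : ℝ, 0 ≤ C ∧ ∀ s, s₀ ≤ s → ‖lowerOrderResolvent Ω k a s e W‖ ≤ C / s ^ (k - e) := by
  have hc := h.pos
  refine ⟨∑ α ∈ multiIndices n 1 e, ‖lpMul (volume.restrict (Ω : Set (Rn n))) (W α)‖ *
    ((2 * Real.pi) ^ k / c), by positivity, fun s hs => ?_⟩
  have hs1 := h.one_le hs
  rw [Finset.sum_div]
  refine (norm_sum_le _ _).trans (Finset.sum_le_sum fun α hα => ?_)
  have hαe : mlen α ≤ e := (mem_multiIndices.1 hα).2
  calc _ ≤ ‖lpMul (volume.restrict (Ω : Set (Rn n))) (W α)‖ * ‖freeResolvent Ω k a s α‖ :=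
        ContinuousLinearMap.opNorm_comp_le _ _
    _ ≤ ‖lpMul (volume.restrict (Ω : Set (Rn n))) (W α)‖ *
          ((2 * Real.pi) ^ k / c / s ^ (k - mlen α)) := by
        gcongr
        exact norm_freeResolvent_le h hs (by lia)
    _ ≤ ‖lpMul (volume.restrict (Ω : Set (Rn n))) (W α)‖ *
          ((2 * Real.pi) ^ k / c / s ^ (k - e)) := by gcongr
    _ = _ := (mul_div_assoc _ _ _).symm

section

variable (h : IsCoerciveSymbol k a c s₀) (hs : s₀ ≤ s)
  (hbd : Bornology.IsBounded (Ω : Set (Rn n)))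

include h hs hbd

theorem isCompactOperator_lowerOrderResolvent (he : e < k) :
    IsCompactOperator (lowerOrderResolvent Ω k a s e W) :=
  (compactOperator (RingHom.id ℂ) (Lp ℂ 2 (volume : Measure (Rn n))) (L2 Ω)).sum_mem fun _ hα =>
    (h.isCompactOperator_freeResolvent hbd hs ((mem_multiIndices.1 hα).2.trans_lt he)).clm_comp _

theorem exists_hasWeakDeriv_of_distribEq {w g : L2 Ω}
    (hw : DistribEq Ω k a w (g - ((s : ℂ) ^ k) • w)) {α : Fin n → ℕ} (hα : mlen α ≤ k) :
    ∃ D : Rn n → ℂ, HasWeakDeriv Ω α w D := by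
  refine exists_hasWeakDeriv_of_cutoffOp w α fun χ => ?_
  obtain ⟨C, -, hfactor⟩ := h.exists_cutoffOp_eq_freeResolvent hbd χ
  obtain ⟨Q, -, hQ⟩ := hfactor s hs (ContinuousLinearMap.toSpanSingleton ℂ w)
    (ContinuousLinearMap.toSpanSingleton ℂ g) fun z => by
      simpa only [ContinuousLinearMap.toSpanSingleton_apply, smul_sub, smul_comm z] using hw.smul z
  have hcut : cutoffOp Ω χ w = freeResolvent Ω k a s 0 (Q 1) := by
    simpa only [ContinuousLinearMap.toSpanSingleton_apply, one_smul] using hQ 1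
  rw [hcut]
  exact ⟨_, hasWeakDeriv_freeResolvent h hs hbd hα _⟩

variable (he : e < k)
  (hW : ∀ α ∈ multiIndices n 1 e, MemLp (W α) ∞ (volume.restrict (Ω : Set (Rn n))))

include he hW

theorem lowerOrderEq_freeResolvent (v : Lp ℂ 2 (volume : Measure (Rn n))) :
    LowerOrderEq Ω e W (freeResolvent Ω k a s 0 v) (lowerOrderResolvent Ω k a s e W v) :=
  ⟨fun α => freeResolvent Ω k a s α v, fun _ hα => hasWeakDeriv_freeResolvent h hs hbd
    ((mem_multiIndices.1 hα).2.trans he.le) v, coeFn_lowerOrderResolvent hW v⟩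

theorem lowerOrderEq_of_cutoffOp_eq_freeResolvent {U : Set (Rn n)} (hU : IsOpen U) {χ : 𝓓(Ω, ℂ)}
    (hχ : ∀ x ∈ U, χ x = 1)
    (hWU : ∀ α ∈ multiIndices n 1 e, ∀ᵐ x ∂volume.restrict (Ω : Set (Rn n)), x ∉ U → W α x = 0)
    {w g : L2 Ω} (hw : DistribEq Ω k a w (g - ((s : ℂ) ^ k) • w))
    {v : Lp ℂ 2 (volume : Measure (Rn n))} (hv : cutoffOp Ω χ w = freeResolvent Ω k a s 0 v) :
    LowerOrderEq Ω e W w (lowerOrderResolvent Ω k a s e W v) := by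
  have hle : ∀ α ∈ multiIndices n 1 e, mlen α ≤ k := fun α hα =>
    (mem_multiIndices.1 hα).2.trans he.le
  choose! D hD using fun α (hα : mlen α ≤ k) => exists_hasWeakDeriv_of_distribEq h hs hbd hw hα
  refine ⟨D, fun α hα => hD α (hle α hα), ?_⟩
  have hDU : ∀ α ∈ multiIndices n 1 e, ∀ᵐ x ∂volume.restrict (Ω : Set (Rn n)), x ∈ U →
      freeResolvent Ω k a s α v x = D α x := fun α hα => by
    refine (hasWeakDeriv_freeResolvent h hs hbd (hle α hα) v).ae_eq_on (hD α (hle α hα)) hU ?_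
    rw [← hv]
    filter_upwards [coeFn_cutoffOp χ w] with x hx hxU
    rw [hx, hχ x hxU, one_mul]
  filter_upwards [coeFn_lowerOrderResolvent (k := k) (a := a) (s := s) hW v,
    (Finset.eventually_all _).2 hDU, (Finset.eventually_all _).2 hWU] with x hx hDx hWx
  rw [hx]
  refine Finset.sum_congr rfl fun α hα => ?_
  by_cases hxU : x ∈ U
  · rw [hDx α hα hxU]
  · rw [hWx α hα hxU, zero_mul, zero_mul]

end

theorem exists_testFunction_eq_one_of_vanishing (hW : ∀ α ∈ multiIndices n 1 e,
      ∃ K : Set (Rn n), IsCompact K ∧ K ⊆ Ω ∧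
        ∀ᵐ x ∂volume.restrict (Ω : Set (Rn n)), x ∉ K → W α x = 0) :
    ∃ χ : 𝓓(Ω, ℂ), ∃ U : Set (Rn n), IsOpen U ∧ (∀ x ∈ U, χ x = 1) ∧
      ∀ α ∈ multiIndices n 1 e, ∀ᵐ x ∂volume.restrict (Ω : Set (Rn n)), x ∉ U → W α x = 0 := by
  choose! K hK hKΩ hKW using hW
  obtain ⟨χ, U, hU, hKU, hχ⟩ := exists_testFunction_eq_one
    ((multiIndices n 1 e).isCompact_biUnion hK) (Set.iUnion₂_subset hKΩ)
  refine ⟨χ, U, hU, hχ, fun α hα => ?_⟩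
  filter_upwards [hKW α hα] with x hx hxU
  exact hx fun hxK => hxU (hKU (Set.mem_biUnion hα hxK))

end LowerOrder

/-- The operator `∂^α (P + s ^ k)⁻¹` on `L²(Ω)`: extend by zero, invert `P + s ^ k` on the whole
space, restrict to `Ω`. -/
def restrictedResolvent (Ω : Opens (Rn n)) (k : ℕ) (a : (Fin n → ℕ) → ℂ) (s : ℝ)
    (α : Fin n → ℕ) : L2 Ω →L[ℂ] L2 Ω :=
  freeResolvent Ω k a s α ∘L (fourierL2 Ω).toContinuousLinearMap

/-- The operator `W (P + s ^ k)⁻¹` on `L²(Ω)`, with `(P + s ^ k)⁻¹` as in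
`restrictedResolvent`. -/
def lowerOrderRestrictedResolvent (Ω : Opens (Rn n)) (k : ℕ) (a : (Fin n → ℕ) → ℂ) (s : ℝ) (e : ℕ)
    (W : (Fin n → ℕ) → Rn n → ℂ) : L2 Ω →L[ℂ] L2 Ω :=
  lowerOrderResolvent Ω k a s e W ∘L (fourierL2 Ω).toContinuousLinearMap

/-- The pair `(G (1 - Π) z, G g + Π z)`, where `G = (P + s ^ k)⁻¹` and `Π` projects onto the kernel
of `P + s ^ k`. For fixed `g` these pairs are exactly the `(u, w)` with `u ∈ H^k_0(Ω)` and
`(P + s ^ k) w = g`. -/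
def bornCoordinates (Ω : Opens (Rn n)) (k : ℕ) (a : (Fin n → ℕ) → ℂ) (s : ℝ) (g z : L2 Ω) :
    L2 Ω × L2 Ω :=
  (restrictedResolvent Ω k a s 0 ((shiftedKernel Ω k a s)ᗮ.starProjection z),
    restrictedResolvent Ω k a s 0 g + (shiftedKernel Ω k a s).starProjection z)

/-- The contribution `μ W G (1 - Π) + λ^{-ν} L Π` of `W` to `B + λ` in the coordinates
`bornCoordinates`, where `L` stands for `W` on the kernel of `P + s ^ k`. -/
def lowerOrderPerturbation (Ω : Opens (Rn n)) (k : ℕ) (a : (Fin n → ℕ) → ℂ) (s : ℝ) (e : ℕ)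
    (W : (Fin n → ℕ) → Rn n → ℂ) (L : L2 Ω →L[ℂ] L2 Ω) (μ ν : ℕ) (lam : ℝ) : L2 Ω →L[ℂ] L2 Ω :=
  (μ : ℂ) • (lowerOrderRestrictedResolvent Ω k a s e W ∘L
    (shiftedKernel Ω k a s)ᗮ.starProjection) +
  ((lam : ℂ) ^ ν)⁻¹ • (L ∘L (shiftedKernel Ω k a s).starProjection)

/-- The coupling term `(λ^{-ν} W + V) (P + s ^ k)⁻¹`. -/
def bornCoupling (Ω : Opens (Rn n)) (k : ℕ) (a : (Fin n → ℕ) → ℂ) (s : ℝ) (e : ℕ)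
    (W : (Fin n → ℕ) → Rn n → ℂ) (V : Rn n → ℂ) (ν : ℕ) (lam : ℝ) : L2 Ω →L[ℂ] L2 Ω :=
  lpMul (volume.restrict (Ω : Set (Rn n))) V ∘L restrictedResolvent Ω k a s 0 +
    ((lam : ℂ) ^ ν)⁻¹ • lowerOrderRestrictedResolvent Ω k a s e W

section BornCoordinates

variable {k e : ℕ} {a : (Fin n → ℕ) → ℂ} {c s₀ s lam : ℝ} {W : (Fin n → ℕ) → Rn n → ℂ}
  {V : Rn n → ℂ} {μ ν : ℕ} {L S : L2 Ω →L[ℂ] L2 Ω}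

theorem norm_comp_fourierL2_le {E : Type*} [NormedAddCommGroup E] [NormedSpace ℂ E]
    (T : Lp ℂ 2 (volume : Measure (Rn n)) →L[ℂ] E) :
    ‖T ∘L (fourierL2 Ω).toContinuousLinearMap‖ ≤ ‖T‖ :=
  (ContinuousLinearMap.opNorm_comp_le _ _).trans
    (mul_le_of_le_one_right (norm_nonneg _) (fourierL2 Ω).norm_toContinuousLinearMap_le)

theorem norm_restrictedResolvent_le (h : IsCoerciveSymbol k a c s₀) (hs : s₀ ≤ s)
    {α : Fin n → ℕ} (hα : mlen α ≤ k) :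
    ‖restrictedResolvent Ω k a s α‖ ≤ (2 * Real.pi) ^ k / c / s ^ (k - mlen α) :=
  (norm_comp_fourierL2_le _).trans (norm_freeResolvent_le h hs hα)

theorem norm_restrictedResolvent_zero_le (h : IsCoerciveSymbol k a c s₀) (hs : s₀ ≤ s) :
    ‖restrictedResolvent Ω k a s 0‖ ≤ (2 * Real.pi) ^ k / c / s ^ k := by
  simpa only [mlen_zero, Nat.sub_zero] using
    norm_restrictedResolvent_le h hs (α := 0) (by simp [mlen_zero])

theorem bornGraph_iff (hV : MemLp V ∞ (volume.restrict (Ω : Set (Rn n))))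
    {u w Pu Pw Wu Ww : L2 Ω} (hu : MemH0 Ω k u) (hPu : DistribEq Ω k a u Pu)
    (hPw : DistribEq Ω k a w Pw) (hWu : LowerOrderEq Ω e W u Wu) (hWw : LowerOrderEq Ω e W w Ww)
    (q : L2 Ω × L2 Ω) :
    BornGraph Ω k e a W V μ ν lam (u, w) q ↔
      q = (Pu + (μ : ℂ) • Wu + (((lam : ℂ) ^ ν)⁻¹ • Ww +
        lpMul (volume.restrict (Ω : Set (Rn n))) V w), Pw) := by
  have hcoe : (Pu + (μ : ℂ) • Wu + (((lam : ℂ) ^ ν)⁻¹ • Ww +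
        lpMul (volume.restrict (Ω : Set (Rn n))) V w) : L2 Ω)
      =ᵐ[volume.restrict (Ω : Set (Rn n))] fun x =>
        (Pu x + (μ : ℂ) * Wu x) + (((lam : ℂ) ^ ν)⁻¹ * Ww x + V x * w x) := by
    refine (Lp.coeFn_add _ _).trans (.add ((Lp.coeFn_add _ _).trans (.add .rfl
      (Lp.coeFn_smul _ _))) ((Lp.coeFn_add _ _).trans (.add (Lp.coeFn_smul _ _) ?_)))
    exact coeFn_lpMul hV w
  constructor
  · rintro ⟨-, -, Pu', Wu', Ww', hPu', hWu', hWw', hq₁, hq₂⟩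
    obtain rfl := hPu'.right_unique hPu
    obtain rfl := hWu'.right_unique hWu
    obtain rfl := hWw'.right_unique hWw
    exact Prod.ext (Lp.ext (Filter.EventuallyEq.trans hq₁ hcoe.symm)) (hq₂.right_unique hPw)
  · rintro rfl
    exact ⟨hu, ⟨Pw, hPw⟩, Pu, Wu, Ww, hPu, hWu, hWw, hcoe, hPw⟩

theorem exists_lowerOrderEq_of_mem_shiftedKernel (h : IsCoerciveSymbol k a c s₀)
    (hbd : Bornology.IsBounded (Ω : Set (Rn n))) (he : e < k)
    (hW : ∀ α ∈ multiIndices n 1 e, MemLp (W α) ∞ (volume.restrict (Ω : Set (Rn n))))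
    (hWK : ∀ α ∈ multiIndices n 1 e, ∃ K : Set (Rn n), IsCompact K ∧ K ⊆ Ω ∧
      ∀ᵐ x ∂volume.restrict (Ω : Set (Rn n)), x ∉ K → W α x = 0) :
    ∃ C : ℝ, 0 ≤ C ∧ ∀ s, s₀ ≤ s → ∃ L : L2 Ω →L[ℂ] L2 Ω, ‖L‖ ≤ C / s ^ (k - e) ∧
      ∀ x ∈ shiftedKernel Ω k a s, LowerOrderEq Ω e W x (L x) := by
  obtain ⟨χ, U, hU, hχ, hWU⟩ := exists_testFunction_eq_one_of_vanishing hWK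
  obtain ⟨C₁, hC₁, hcut⟩ := exists_cutoffOp_comp_starProjection_eq h hbd χ
  obtain ⟨C₂, hC₂, hnorm⟩ := exists_norm_lowerOrderResolvent_le (Ω := Ω) (W := W) h he
  refine ⟨C₂ * C₁, by positivity, fun s hs => ?_⟩
  obtain ⟨Q, hQ, hQe⟩ := hcut s hs
  have hs1 := h.one_le hs
  refine ⟨lowerOrderResolvent Ω k a s e W ∘L Q, ?_, fun x hx => ?_⟩
  · calc _ ≤ ‖lowerOrderResolvent Ω k a s e W‖ * ‖Q‖ := ContinuousLinearMap.opNorm_comp_le _ _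
      _ ≤ C₂ / s ^ (k - e) * C₁ := by
          gcongr
          exact hnorm s hs
      _ = _ := by ring
  · refine lowerOrderEq_of_cutoffOp_eq_freeResolvent h hs hbd he hW hU hχ hWU (g := 0)
      (v := Q x) ?_ ?_
    · rw [zero_sub]
      exact (mem_shiftedKernel_iff h.isFormallySelfAdjointOp).1 hx
    · simpa only [ContinuousLinearMap.comp_apply, Submodule.starProjection_eq_self_iff.2 hx] using
        congr($hQe x)

section

variable (h : IsCoerciveSymbol k a c s₀) (hs : s₀ ≤ s)
  (hbd : Bornology.IsBounded (Ω : Set (Rn n)))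

include h hs hbd

theorem isCompactOperator_restrictedResolvent {α : Fin n → ℕ} (hα : mlen α < k) :
    IsCompactOperator (restrictedResolvent Ω k a s α) :=
  (h.isCompactOperator_freeResolvent hbd hs hα).comp_clm _

theorem isCompactOperator_restrictedResolvent_zero :
    IsCompactOperator (restrictedResolvent Ω k a s 0) :=
  isCompactOperator_restrictedResolvent h hs hbd (mlen_zero.trans_lt h.one_le_order)

theorem exists_eq_bornCoordinates {u w g : L2 Ω} (hu : MemH0 Ω k u)
    (hw : DistribEq Ω k a w (g - ((s : ℂ) ^ k) • w)) :
    ∃ z, (u, w) = bornCoordinates Ω k a s g z := by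
  obtain ⟨y, hy, hyu⟩ := exists_eq_freeResolvent_of_memH0 h hs hbd hu
  have hx := (sub_freeResolvent_mem_shiftedKernel_iff h hs hbd).2 hw
  set x := w - freeResolvent Ω k a s 0 (fourierL2 Ω g)
  have hproj : (shiftedKernel Ω k a s).starProjection (y + x) = x := by
    rw [map_add, (Submodule.starProjection_apply_eq_zero_iff _).2 hy,
      Submodule.starProjection_eq_self_iff.2 hx, zero_add]
  refine ⟨y + x, Prod.ext ?_ ?_⟩
  · rw [bornCoordinates, Submodule.starProjection_orthogonal_val, hproj, add_sub_cancel_right]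
    exact hyu
  · rw [bornCoordinates, hproj]
    exact (add_sub_cancel _ _).symm

theorem distribEq_restrictedResolvent_add {x : L2 Ω} (g : L2 Ω)
    (hx : x ∈ shiftedKernel Ω k a s) :
    DistribEq Ω k a (restrictedResolvent Ω k a s 0 g + x)
      (g - ((s : ℂ) ^ k) • (restrictedResolvent Ω k a s 0 g + x)) := by
  refine (sub_freeResolvent_mem_shiftedKernel_iff h hs hbd).1 ?_
  convert hx
  exact add_sub_cancel_left _ _

variable (he : e < k)
  (hW : ∀ α ∈ multiIndices n 1 e, MemLp (W α) ∞ (volume.restrict (Ω : Set (Rn n))))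
  (hV : MemLp V ∞ (volume.restrict (Ω : Set (Rn n))))
  (hL : ∀ x ∈ shiftedKernel Ω k a s, LowerOrderEq Ω e W x (L x))

include he hW hV hL

theorem bornGraph_bornCoordinates_iff (g z : L2 Ω) (q : L2 Ω × L2 Ω) :
    BornGraph Ω k e a W V μ ν lam (bornCoordinates Ω k a s g z) q ↔
      q = (blockPerturbation (shiftedKernel Ω k a s) (lpMul (volume.restrict (Ω : Set (Rn n))) V)
          (lowerOrderPerturbation Ω k a s e W L μ ν lam) z + bornCoupling Ω k a s e W V ν lam g -
            ((s : ℂ) ^ k) • (bornCoordinates Ω k a s g z).1,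
        g - ((s : ℂ) ^ k) • (bornCoordinates Ω k a s g z).2) := by
  have hx := (shiftedKernel Ω k a s).starProjection_apply_mem z
  have hy := (shiftedKernel Ω k a s)ᗮ.starProjection_apply_mem z
  have hgraph := bornGraph_iff (μ := μ) (ν := ν) (lam := lam) hV (memH0_freeResolvent h hs hbd hy)
    (distribEq_freeResolvent_fourierL2 h hs hbd _) (distribEq_restrictedResolvent_add h hs hbd g hx)
    (lowerOrderEq_freeResolvent h hs hbd he hW _)
    ((lowerOrderEq_freeResolvent h hs hbd he hW (fourierL2 Ω g)).add (hL _ hx)) q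
  refine hgraph.trans (Eq.congr_right (Prod.ext ?_ rfl))
  simp only [blockPerturbation, lowerOrderPerturbation, bornCoupling, bornCoordinates,
    restrictedResolvent, lowerOrderRestrictedResolvent, add_apply, sub_apply, smul_apply,
    ContinuousLinearMap.comp_apply, one_apply_eq_self, map_add,
    LinearIsometry.coe_toContinuousLinearMap, Submodule.starProjection_orthogonal_val]
  module

theorem existsUnique_bornGraph {u w : L2 Ω} (hu : MemH0 Ω k u) (hw : MemHP Ω k a w) :
    ∃! q : L2 Ω × L2 Ω, BornGraph Ω k e a W V μ ν lam (u, w) q := by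
  obtain ⟨Pw, hPw⟩ := hw
  obtain ⟨z, hz⟩ := exists_eq_bornCoordinates h hs hbd (g := Pw + ((s : ℂ) ^ k) • w) hu
    (by rwa [add_sub_cancel_right])
  simp only [hz, bornGraph_bornCoordinates_iff h hs hbd he hW hV hL, existsUnique_eq]

theorem bornGraph_sub_iff
    (hS : blockPerturbation (shiftedKernel Ω k a s)
      (lpMul (volume.restrict (Ω : Set (Rn n))) V)
      (lowerOrderPerturbation Ω k a s e W L μ ν lam) * S = 1)
    (hS' : S * blockPerturbation (shiftedKernel Ω k a s)
      (lpMul (volume.restrict (Ω : Set (Rn n))) V)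
      (lowerOrderPerturbation Ω k a s e W L μ ν lam) = 1)
    (f g : L2 Ω) (p : L2 Ω × L2 Ω) :
    BornGraph Ω k e a W V μ ν lam p (f - ((s : ℂ) ^ k) • p.1, g - ((s : ℂ) ^ k) • p.2) ↔
      p = bornCoordinates Ω k a s g (S (f - bornCoupling Ω k a s e W V ν lam g)) := by
  set T := blockPerturbation (shiftedKernel Ω k a s) (lpMul (volume.restrict (Ω : Set (Rn n))) V)
    (lowerOrderPerturbation Ω k a s e W L μ ν lam) with hT
  have hST (z : L2 Ω) : S (T z) = z := congr($hS' z)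
  have hTS (z : L2 Ω) : T (S z) = z := congr($hS z)
  have hcoord (z : L2 Ω) := bornGraph_bornCoordinates_iff (μ := μ) (ν := ν) (lam := lam)
    h hs hbd he hW hV hL g z
  constructor
  · intro hp
    have hp₂ : DistribEq Ω k a p.2 (g - ((s : ℂ) ^ k) • p.2) := by
      obtain ⟨-, -, -, -, -, -, -, -, -, hp₂⟩ := hp
      exact hp₂
    obtain ⟨z, hz⟩ := exists_eq_bornCoordinates h hs hbd hp.1 hp₂
    obtain rfl : p = bornCoordinates Ω k a s g z := hz
    have hf := sub_left_injective congr(Prod.fst $((hcoord z _).1 hp))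
    rw [show f = _ from hf, add_sub_cancel_right, hST]
  · rintro rfl
    rw [hcoord, ← hT, hTS, sub_add_cancel]

end

end BornCoordinates

section BornInverse

variable {k e : ℕ} {a : (Fin n → ℕ) → ℂ} {c s₀ s lam : ℝ} {W : (Fin n → ℕ) → Rn n → ℂ}
  {V : Rn n → ℂ} {μ ν : ℕ} {L : L2 Ω →L[ℂ] L2 Ω}

theorem norm_inv_ofReal_pow (hlam : 0 ≤ lam) (ν : ℕ) :
    ‖((lam : ℂ) ^ ν)⁻¹‖ = (lam ^ ν)⁻¹ := by
  rw [norm_inv, norm_pow, Complex.norm_of_nonneg hlam]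

theorem norm_comp_starProjection_le {E : Type*} [NormedAddCommGroup E] [InnerProductSpace ℂ E]
    (K : Submodule ℂ E) [K.HasOrthogonalProjection] (T : E →L[ℂ] E) :
    ‖T ∘L K.starProjection‖ ≤ ‖T‖ :=
  (ContinuousLinearMap.opNorm_comp_le _ _).trans
    (mul_le_of_le_one_right (norm_nonneg _) K.starProjection_norm_le)

theorem norm_lowerOrderPerturbation_le (hlam : 1 ≤ lam) :
    ‖lowerOrderPerturbation Ω k a s e W L μ ν lam‖ ≤
      μ * ‖lowerOrderRestrictedResolvent Ω k a s e W‖ + ‖L‖ := by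
  refine (norm_add_le _ _).trans (add_le_add ?_ ?_)
  · rw [norm_smul, Complex.norm_natCast]
    gcongr
    exact norm_comp_starProjection_le _ _
  · rw [norm_smul, norm_inv_ofReal_pow (zero_le_one.trans hlam)]
    exact (mul_le_of_le_one_left (norm_nonneg _)
      (inv_le_one_of_one_le₀ (one_le_pow₀ hlam))).trans (norm_comp_starProjection_le _ _)

theorem norm_bornCoupling_le (hlam : 0 ≤ lam) :
    ‖bornCoupling Ω k a s e W V ν lam‖ ≤
      ‖lpMul (volume.restrict (Ω : Set (Rn n))) V‖ * ‖restrictedResolvent Ω k a s 0‖ +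
        (lam ^ ν)⁻¹ * ‖lowerOrderRestrictedResolvent Ω k a s e W‖ := by
  refine (norm_add_le _ _).trans (add_le_add (ContinuousLinearMap.opNorm_comp_le _ _) ?_)
  rw [norm_smul, norm_inv_ofReal_pow hlam]

theorem inv_pow_div_pow_sub_le (hs : 1 ≤ s) (he : e ≤ k) (ν : ℕ) :
    ((s ^ k) ^ ν)⁻¹ / s ^ (k - e) ≤ s ^ ((1 - ν) * e) / s ^ k := by
  have : 0 < s := zero_lt_one.trans_le hs
  rw [inv_div_left, ← pow_mul, ← pow_add, ← one_div, div_le_div_iff₀ (by positivity)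
    (by positivity), one_mul, ← pow_add]
  refine pow_le_pow_right₀ hs ?_
  cases ν with
  | zero => omega
  | succ ν => nlinarith [Nat.zero_le (k * ν)]

theorem exists_norm_bornCoupling_le (h : IsCoerciveSymbol k a c s₀) (he : e < k) :
    ∃ C : ℝ, 0 ≤ C ∧ ∀ s, s₀ ≤ s →
      ‖bornCoupling Ω k a s e W V ν (s ^ k)‖ ≤ C * (s ^ ((1 - ν) * e) / s ^ k) := by
  obtain ⟨C, hC, hWG⟩ := exists_norm_lowerOrderResolvent_le (Ω := Ω) (W := W) h he
  have hc := h.pos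
  refine ⟨‖lpMul (volume.restrict (Ω : Set (Rn n))) V‖ * ((2 * Real.pi) ^ k / c) + C,
    by positivity, fun s hs => ?_⟩
  have hs1 := h.one_le hs
  calc ‖bornCoupling Ω k a s e W V ν (s ^ k)‖
    _ ≤ ‖lpMul (volume.restrict (Ω : Set (Rn n))) V‖ * ((2 * Real.pi) ^ k / c / s ^ k) +
          ((s ^ k) ^ ν)⁻¹ * (C / s ^ (k - e)) := by
        refine (norm_bornCoupling_le (by positivity)).trans ?_
        gcongr
        · exact norm_restrictedResolvent_zero_le h hs
        · exact (norm_comp_fourierL2_le _).trans (hWG s hs)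
    _ = ‖lpMul (volume.restrict (Ω : Set (Rn n))) V‖ * ((2 * Real.pi) ^ k / c) * (1 / s ^ k) +
          C * (((s ^ k) ^ ν)⁻¹ / s ^ (k - e)) := by ring
    _ ≤ ‖lpMul (volume.restrict (Ω : Set (Rn n))) V‖ * ((2 * Real.pi) ^ k / c) *
            (s ^ ((1 - ν) * e) / s ^ k) + C * (s ^ ((1 - ν) * e) / s ^ k) := by
        refine add_le_add (mul_le_mul_of_nonneg_left ?_ (by positivity))
          (mul_le_mul_of_nonneg_left ?_ hC)
        · gcongr
          exact one_le_pow₀ hs1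
        · exact inv_pow_div_pow_sub_le hs1 he.le ν
    _ = _ := by ring

theorem isCompactOperator_bornCoupling (h : IsCoerciveSymbol k a c s₀) (hs : s₀ ≤ s)
    (hbd : Bornology.IsBounded (Ω : Set (Rn n))) (he : e < k) :
    IsCompactOperator (bornCoupling Ω k a s e W V ν lam) :=
  ((isCompactOperator_restrictedResolvent_zero h hs hbd).clm_comp _).add
    (((isCompactOperator_lowerOrderResolvent h hs hbd he).comp_clm _).smul _)

theorem exists_bornGraph_sub_iff (h : IsCoerciveSymbol k a c s₀)
    (hbd : Bornology.IsBounded (Ω : Set (Rn n))) (he : e < k)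
    (hW : ∀ α ∈ multiIndices n 1 e, MemLp (W α) ∞ (volume.restrict (Ω : Set (Rn n))))
    (hWK : ∀ α ∈ multiIndices n 1 e, ∃ K : Set (Rn n), IsCompact K ∧ K ⊆ Ω ∧
      ∀ᵐ x ∂volume.restrict (Ω : Set (Rn n)), x ∉ K → W α x = 0)
    (hV : MemLp V ∞ (volume.restrict (Ω : Set (Rn n)))) (hVc : CoerciveNearBoundary Ω V)
    (μ ν : ℕ) :
    ∃ s₁ : ℝ, s₀ ≤ s₁ ∧ ∃ C : ℝ, 0 ≤ C ∧ ∀ s, s₁ ≤ s → ∃ S : L2 Ω →L[ℂ] L2 Ω, ‖S‖ ≤ C ∧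
      (∀ u w : L2 Ω, MemH0 Ω k u → MemHP Ω k a w →
        ∃! q : L2 Ω × L2 Ω, BornGraph Ω k e a W V μ ν (s ^ k) (u, w) q) ∧
      ∀ f g p, BornGraph Ω k e a W V μ ν (s ^ k) p
          (f - ((s ^ k : ℝ) : ℂ) • p.1, g - ((s ^ k : ℝ) : ℂ) • p.2) ↔
        p = bornCoordinates Ω k a s g (S (f - bornCoupling Ω k a s e W V ν (s ^ k) g)) := by
  obtain ⟨z, hz, d, hd, s₁, hs₁, hcoer⟩ := exists_coercive_on_shiftedKernel hbd hV h hVc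
  obtain ⟨η, hη, C, hC, hinv⟩ := exists_inverse_blockPerturbation (H := L2 Ω)
    ‖lpMul (volume.restrict (Ω : Set (Rn n))) V‖ hd hz
  obtain ⟨C₁, hC₁, hker⟩ := exists_lowerOrderEq_of_mem_shiftedKernel h hbd he hW hWK
  obtain ⟨C₂, hC₂, hfree⟩ := exists_norm_lowerOrderResolvent_le (Ω := Ω) (W := W) h he
  refine ⟨max s₁ ((μ * C₂ + C₁) / η), hs₁.trans (le_max_left _ _), C, hC, fun s hs => ?_⟩
  obtain ⟨hss₁, hsη⟩ := max_le_iff.1 hs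
  have hs₀ := hs₁.trans hss₁
  have hs1 := h.one_le hs₀
  obtain ⟨L, hLn, hL⟩ := hker s hs₀
  have hsmall : ‖lowerOrderPerturbation Ω k a s e W L μ ν (s ^ k)‖ ≤ η := by
    calc _ ≤ μ * ‖lowerOrderRestrictedResolvent Ω k a s e W‖ + ‖L‖ :=
          norm_lowerOrderPerturbation_le (one_le_pow₀ hs1)
      _ ≤ μ * (C₂ / s ^ (k - e)) + C₁ / s ^ (k - e) := by
          gcongr
          exact (norm_comp_fourierL2_le _).trans (hfree s hs₀)
      _ = (μ * C₂ + C₁) / s ^ (k - e) := by ring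
      _ ≤ (μ * C₂ + C₁) / s := by
          gcongr
          exact le_self_pow₀ hs1 (Nat.sub_ne_zero_of_lt he)
      _ ≤ η := div_le_of_le_mul₀ (by positivity) hη.le
          (by rwa [div_le_iff₀' hη] at hsη)
  obtain ⟨S, hSn, hS, hS'⟩ := hinv _ _ _ le_rfl (hcoer s hss₁) hsmall
  refine ⟨S, hSn, fun u w => existsUnique_bornGraph h hs₀ hbd he hW hV hL, fun f g p => ?_⟩
  rw [Complex.ofReal_pow]
  exact bornGraph_sub_iff h hs₀ hbd he hW hV hL hS hS' f g p

end BornInverse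

/-- The operator `∂^α G (1 - Π) S`, with `G` and `Π` as in `bornCoordinates`. With `S` the inverse
of `B + λ` in these coordinates, it is `∂^α R₁₁`. -/
def derivBornResolvent₁₁ (Ω : Opens (Rn n)) (k : ℕ) (a : (Fin n → ℕ) → ℂ) (s : ℝ)
    (S : L2 Ω →L[ℂ] L2 Ω) (α : Fin n → ℕ) : L2 Ω →L[ℂ] L2 Ω :=
  restrictedResolvent Ω k a s α ∘L (shiftedKernel Ω k a s)ᗮ.starProjection ∘L S

/-- The component `R₂₁ = Π S` of the inverse of `B + λ`. -/
def bornResolvent₂₁ (Ω : Opens (Rn n)) (k : ℕ) (a : (Fin n → ℕ) → ℂ) (s : ℝ)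
    (S : L2 Ω →L[ℂ] L2 Ω) : L2 Ω →L[ℂ] L2 Ω :=
  (shiftedKernel Ω k a s).starProjection ∘L S

/-- The component `R₂₂ = G - Π S X` of the inverse of `B + λ`, where `X` is the coupling term
`bornCoupling`. -/
def bornResolvent₂₂ (Ω : Opens (Rn n)) (k : ℕ) (a : (Fin n → ℕ) → ℂ) (s : ℝ)
    (S X : L2 Ω →L[ℂ] L2 Ω) : L2 Ω →L[ℂ] L2 Ω :=
  restrictedResolvent Ω k a s 0 + bornResolvent₂₁ Ω k a s S ∘L (-X)

/-- `B` is well defined on all of `H^k_0(Ω) × H^k_P(Ω)`, the `R`'s form `(B + λ)⁻¹`, the `D`'s are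
the derivatives of its first row and the `cR`'s the cut-offs of its second row. The compactness
properties of these operators are included, the bounds on their norms are not. -/
def IsBornResolvent (Ω : Opens (Rn n)) (k e : ℕ) (a : (Fin n → ℕ) → ℂ)
    (W : (Fin n → ℕ) → Rn n → ℂ) (V : Rn n → ℂ) (μ ν : ℕ) (lam : ℝ)
    (R₁₁ R₁₂ R₂₁ R₂₂ : L2 Ω →L[ℂ] L2 Ω) (D₁₁ D₁₂ : (Fin n → ℕ) → (L2 Ω →L[ℂ] L2 Ω))
    (cR₂₁ cR₂₂ : 𝓓(Ω, ℂ) → (L2 Ω →L[ℂ] L2 Ω)) : Prop :=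
  (∀ u w : L2 Ω, MemH0 Ω k u → MemHP Ω k a w →
    ∃! q : L2 Ω × L2 Ω, BornGraph Ω k e a W V μ ν lam (u, w) q) ∧
  (∀ f g : L2 Ω, ∃! p : L2 Ω × L2 Ω,
    BornGraph Ω k e a W V μ ν lam p (f - (lam : ℂ) • p.1, g - (lam : ℂ) • p.2)) ∧
  (∀ f g : L2 Ω, BornGraph Ω k e a W V μ ν lam (R₁₁ f + R₁₂ g, R₂₁ f + R₂₂ g)
    (f - (lam : ℂ) • (R₁₁ f + R₁₂ g), g - (lam : ℂ) • (R₂₁ f + R₂₂ g))) ∧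
  (∀ α : Fin n → ℕ, mlen α ≤ k → IsDerivOp Ω α R₁₁ (D₁₁ α) ∧ IsDerivOp Ω α R₁₂ (D₁₂ α)) ∧
  (∀ χ : 𝓓(Ω, ℂ), IsCutoffOp Ω χ R₂₁ (cR₂₁ χ) ∧ IsCutoffOp Ω χ R₂₂ (cR₂₂ χ)) ∧
  IsCompactOperator R₁₁ ∧ IsCompactOperator R₁₂ ∧ IsCompactOperator R₂₂ ∧
  (∀ χ : 𝓓(Ω, ℂ), IsCompactOperator (cR₂₁ χ)) ∧
  (∀ α : Fin n → ℕ, 1 ≤ mlen α → mlen α < k →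
    IsCompactOperator (D₁₁ α) ∧ IsCompactOperator (D₁₂ α) ∧ ∀ χ : 𝓓(Ω, ℂ),
      (∃ T : L2 Ω →L[ℂ] L2 Ω, IsDerivOp Ω α (cR₂₁ χ) T ∧ IsCompactOperator T) ∧
      (∃ T : L2 Ω →L[ℂ] L2 Ω, IsDerivOp Ω α (cR₂₂ χ) T ∧ IsCompactOperator T))

theorem IsDerivOp.comp {α : Fin n → ℕ} {R T : L2 Ω →L[ℂ] L2 Ω} (h : IsDerivOp Ω α R T)
    (Y : L2 Ω →L[ℂ] L2 Ω) : IsDerivOp Ω α (R ∘L Y) (T ∘L Y) :=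
  fun f => h (Y f)

theorem isCutoffOp_cutoffOp (χ : 𝓓(Ω, ℂ)) (R : L2 Ω →L[ℂ] L2 Ω) :
    IsCutoffOp Ω χ R (cutoffOp Ω χ ∘L R) :=
  fun f => coeFn_cutoffOp χ (R f)

section BornResolvent

variable {k e : ℕ} {a : (Fin n → ℕ) → ℂ} {c s₀ s lam : ℝ} {W : (Fin n → ℕ) → Rn n → ℂ}
  {V : Rn n → ℂ} {μ ν : ℕ} {S X : L2 Ω →L[ℂ] L2 Ω}

theorem bornCoordinates_sub (f g : L2 Ω) :
    bornCoordinates Ω k a s g (S (f - X g)) =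
      (derivBornResolvent₁₁ Ω k a s S 0 f + (derivBornResolvent₁₁ Ω k a s S 0 ∘L (-X)) g,
        bornResolvent₂₁ Ω k a s S f + bornResolvent₂₂ Ω k a s S X g) := by
  simp only [bornCoordinates, derivBornResolvent₁₁, bornResolvent₂₁, bornResolvent₂₂,
    ContinuousLinearMap.comp_apply, add_apply, neg_apply, map_sub, map_neg, Prod.mk.injEq]
  exact ⟨sub_eq_add_neg _ _, by abel⟩

theorem norm_derivBornResolvent₁₁_le (h : IsCoerciveSymbol k a c s₀) (hs : s₀ ≤ s)
    {α : Fin n → ℕ} (hα : mlen α ≤ k) :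
    ‖derivBornResolvent₁₁ Ω k a s S α‖ ≤ (2 * Real.pi) ^ k / c / s ^ (k - mlen α) * ‖S‖ := by
  refine (ContinuousLinearMap.opNorm_comp_le
    (restrictedResolvent Ω k a s α ∘L (shiftedKernel Ω k a s)ᗮ.starProjection) S).trans ?_
  gcongr
  exact (norm_comp_starProjection_le _ _).trans (norm_restrictedResolvent_le h hs hα)

theorem norm_bornResolvent₂₁_le : ‖bornResolvent₂₁ Ω k a s S‖ ≤ ‖S‖ :=
  (ContinuousLinearMap.opNorm_comp_le _ _).trans
    (mul_le_of_le_one_left (norm_nonneg _) (Submodule.starProjection_norm_le _))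

theorem norm_bornResolvent₂₂_le (h : IsCoerciveSymbol k a c s₀) (hs : s₀ ≤ s) :
    ‖bornResolvent₂₂ Ω k a s S X‖ ≤ (2 * Real.pi) ^ k / c / s ^ k + ‖S‖ * ‖X‖ := by
  refine (norm_add_le _ _).trans (add_le_add (norm_restrictedResolvent_zero_le h hs) ?_)
  refine (ContinuousLinearMap.opNorm_comp_le _ _).trans ?_
  rw [norm_neg]
  gcongr
  exact norm_bornResolvent₂₁_le

section

variable (h : IsCoerciveSymbol k a c s₀) (hs : s₀ ≤ s)
  (hbd : Bornology.IsBounded (Ω : Set (Rn n)))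

include h

theorem distribEq_bornResolvent₂₁ (f : L2 Ω) :
    DistribEq Ω k a (bornResolvent₂₁ Ω k a s S f)
      ((0 : L2 Ω →L[ℂ] L2 Ω) f - ((s : ℂ) ^ k) • bornResolvent₂₁ Ω k a s S f) := by
  rw [zero_apply, zero_sub]
  exact (mem_shiftedKernel_iff h.isFormallySelfAdjointOp).1 (Submodule.starProjection_apply_mem _ _)

include hs hbd

theorem isDerivOp_derivBornResolvent₁₁ {α : Fin n → ℕ} (hα : mlen α ≤ k) :
    IsDerivOp Ω α (derivBornResolvent₁₁ Ω k a s S 0) (derivBornResolvent₁₁ Ω k a s S α) :=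
  fun _ => hasWeakDeriv_freeResolvent h hs hbd hα _

theorem isCompactOperator_derivBornResolvent₁₁ {α : Fin n → ℕ} (hα : mlen α < k) :
    IsCompactOperator (derivBornResolvent₁₁ Ω k a s S α) :=
  (isCompactOperator_restrictedResolvent h hs hbd hα).comp_clm _

theorem isCompactOperator_bornResolvent₂₂ (hX : IsCompactOperator X) :
    IsCompactOperator (bornResolvent₂₂ Ω k a s S X) := by
  have hneg : IsCompactOperator (-X : L2 Ω →L[ℂ] L2 Ω) := hX.neg
  exact (isCompactOperator_restrictedResolvent_zero h hs hbd).add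
    (hneg.clm_comp (bornResolvent₂₁ Ω k a s S))

theorem distribEq_bornResolvent₂₂ (f : L2 Ω) :
    DistribEq Ω k a (bornResolvent₂₂ Ω k a s S X f)
      (ContinuousLinearMap.id ℂ _ f - ((s : ℂ) ^ k) • bornResolvent₂₂ Ω k a s S X f) :=
  distribEq_restrictedResolvent_add h hs hbd f (Submodule.starProjection_apply_mem _ _)

theorem isCompactOperator_cutoffOp_comp {A B : L2 Ω →L[ℂ] L2 Ω}
    (hAB : ∀ f, DistribEq Ω k a (A f) (B f - ((s : ℂ) ^ k) • A f)) (χ : 𝓓(Ω, ℂ)) :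
    IsCompactOperator (cutoffOp Ω χ ∘L A) ∧ ∀ α : Fin n → ℕ, mlen α < k →
      ∃ T : L2 Ω →L[ℂ] L2 Ω, IsDerivOp Ω α (cutoffOp Ω χ ∘L A) T ∧ IsCompactOperator T := by
  obtain ⟨C, -, hC⟩ := h.exists_cutoffOp_eq_freeResolvent hbd χ
  obtain ⟨Q, -, hQ⟩ := hC s hs A B hAB
  have hfactor : cutoffOp Ω χ ∘L A = freeResolvent Ω k a s 0 ∘L Q := by
    ext1 f
    exact hQ f
  have hcompact (α : Fin n → ℕ) (hα : mlen α < k) :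
      IsCompactOperator (freeResolvent Ω k a s α ∘L Q) :=
    (h.isCompactOperator_freeResolvent hbd hs hα).comp_clm Q
  rw [hfactor]
  exact ⟨hcompact 0 (mlen_zero.trans_lt h.one_le_order), fun α hα =>
    ⟨freeResolvent Ω k a s α ∘L Q, fun f => hasWeakDeriv_freeResolvent h hs hbd hα.le (Q f),
      hcompact α hα⟩⟩

theorem isBornResolvent_of_bornGraph_sub_iff
    (hwd : ∀ u w : L2 Ω, MemH0 Ω k u → MemHP Ω k a w →
      ∃! q : L2 Ω × L2 Ω, BornGraph Ω k e a W V μ ν lam (u, w) q)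
    (hiff : ∀ f g p,
      BornGraph Ω k e a W V μ ν lam p (f - (lam : ℂ) • p.1, g - (lam : ℂ) • p.2) ↔
        p = bornCoordinates Ω k a s g (S (f - X g)))
    (hX : IsCompactOperator X) :
    IsBornResolvent Ω k e a W V μ ν lam (derivBornResolvent₁₁ Ω k a s S 0)
      (derivBornResolvent₁₁ Ω k a s S 0 ∘L (-X)) (bornResolvent₂₁ Ω k a s S)
      (bornResolvent₂₂ Ω k a s S X) (derivBornResolvent₁₁ Ω k a s S)
      (fun α => derivBornResolvent₁₁ Ω k a s S α ∘L (-X))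
      (fun χ => cutoffOp Ω χ ∘L bornResolvent₂₁ Ω k a s S)
      (fun χ => cutoffOp Ω χ ∘L bornResolvent₂₂ Ω k a s S X) := by
  have hderiv {α : Fin n → ℕ} (hα : mlen α ≤ k) :=
    isDerivOp_derivBornResolvent₁₁ (S := S) h hs hbd hα
  have hcomp {α : Fin n → ℕ} (hα : mlen α < k) :=
    isCompactOperator_derivBornResolvent₁₁ (S := S) h hs hbd hα
  have hzero : mlen (0 : Fin n → ℕ) < k := mlen_zero.trans_lt h.one_le_order
  have hcut₁ := isCompactOperator_cutoffOp_comp h hs hbd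
    (distribEq_bornResolvent₂₁ (S := S) h)
  have hcut₂ := isCompactOperator_cutoffOp_comp h hs hbd
    (distribEq_bornResolvent₂₂ (S := S) (X := X) h hs hbd)
  exact ⟨hwd, fun f g => ⟨_, (hiff f g _).2 rfl, fun p => (hiff f g p).1⟩,
    fun f g => (hiff f g _).2 (bornCoordinates_sub f g).symm,
    fun α hα => ⟨hderiv hα, (hderiv hα).comp _⟩,
    fun χ => ⟨isCutoffOp_cutoffOp χ _, isCutoffOp_cutoffOp χ _⟩,
    hcomp hzero, (hcomp hzero).comp_clm _, isCompactOperator_bornResolvent₂₂ h hs hbd hX,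
    fun χ => (hcut₁ χ).1, fun α _ hα => ⟨hcomp hα, (hcomp hα).comp_clm _,
      fun χ => ⟨(hcut₁ χ).2 α hα, (hcut₂ χ).2 α hα⟩⟩⟩

end

end BornResolvent

theorem exists_isBornResolvent {k e : ℕ} {a : (Fin n → ℕ) → ℂ} {c s₀ : ℝ}
    {W : (Fin n → ℕ) → Rn n → ℂ} {V : Rn n → ℂ} (h : IsCoerciveSymbol k a c s₀)
    (hbd : Bornology.IsBounded (Ω : Set (Rn n))) (he : e < k)
    (hW : ∀ α ∈ multiIndices n 1 e, MemLp (W α) ∞ (volume.restrict (Ω : Set (Rn n))))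
    (hWK : ∀ α ∈ multiIndices n 1 e, ∃ K : Set (Rn n), IsCompact K ∧ K ⊆ Ω ∧
      ∀ᵐ x ∂volume.restrict (Ω : Set (Rn n)), x ∉ K → W α x = 0)
    (hV : MemLp V ∞ (volume.restrict (Ω : Set (Rn n)))) (hVc : CoerciveNearBoundary Ω V)
    (μ ν : ℕ) :
    ∃ s₁ : ℝ, 1 ≤ s₁ ∧ ∃ C₁₁ C₁₂ C₂₁ C₂₂ : ℝ, ∃ C : 𝓓(Ω, ℂ) → ℝ, ∀ s, s₁ ≤ s →
      ∃ R₁₁ R₁₂ R₂₁ R₂₂ : L2 Ω →L[ℂ] L2 Ω, ∃ D₁₁ D₁₂ : (Fin n → ℕ) → (L2 Ω →L[ℂ] L2 Ω),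
      ∃ cR₂₁ cR₂₂ : 𝓓(Ω, ℂ) → (L2 Ω →L[ℂ] L2 Ω),
        IsBornResolvent Ω k e a W V μ ν (s ^ k) R₁₁ R₁₂ R₂₁ R₂₂ D₁₁ D₁₂ cR₂₁ cR₂₂ ∧
        (∀ α, mlen α ≤ k → ‖D₁₁ α‖ ≤ C₁₁ * (s ^ mlen α / s ^ k)) ∧
        (∀ α, mlen α ≤ k →
          ‖D₁₂ α‖ ≤ C₁₂ * (s ^ ((1 - ν) * e) * s ^ mlen α / (s ^ k * s ^ k))) ∧
        ‖R₂₁‖ ≤ C₂₁ ∧ ‖R₂₂‖ ≤ C₂₂ * (s ^ ((1 - ν) * e) / s ^ k) ∧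
        ∀ χ, ‖cR₂₁ χ‖ ≤ C χ / s ^ k := by
  obtain ⟨s₁, hs₁, C, hC, hS⟩ := exists_bornGraph_sub_iff h hbd he hW hWK hV hVc μ ν
  obtain ⟨C', _, hX⟩ := exists_norm_bornCoupling_le (Ω := Ω) (W := W) (V := V) (ν := ν) h he
  choose Cχ hCχ hχ using exists_norm_cutoffOp_comp_starProjection_le h hbd
  have hc := h.pos
  set A : ℝ := (2 * Real.pi) ^ k / c
  refine ⟨s₁, h.one_le hs₁, A * C, A * C * C', C, A + C * C', fun χ => Cχ χ * C,
    fun s hs => ?_⟩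
  obtain ⟨S, hSn, hwd, hiff⟩ := hS s hs
  have hs₀ := hs₁.trans hs
  have hs1 := h.one_le hs₀
  set X := bornCoupling Ω k a s e W V ν (s ^ k)
  have hD (α : Fin n → ℕ) (hα : mlen α ≤ k) :
      ‖derivBornResolvent₁₁ Ω k a s S α‖ ≤ A * C * (s ^ mlen α / s ^ k) := by
    calc _ ≤ A / s ^ (k - mlen α) * C :=
          (norm_derivBornResolvent₁₁_le h hs₀ hα).trans (by gcongr)
      _ = _ := by rw [← Nat.sub_add_cancel hα, Nat.add_sub_cancel, pow_add]; field_simp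
  refine ⟨_, _, _, _, _, _, _, _, isBornResolvent_of_bornGraph_sub_iff h hs₀ hbd hwd hiff
    (isCompactOperator_bornCoupling h hs₀ hbd he), hD, fun α hα => ?_,
    norm_bornResolvent₂₁_le.trans hSn, ?_, fun χ => ?_⟩
  · refine (ContinuousLinearMap.opNorm_comp_le _ _).trans ?_
    calc _ ≤ A * C * (s ^ mlen α / s ^ k) * (C' * (s ^ ((1 - ν) * e) / s ^ k)) := by
          rw [norm_neg]
          gcongr
          exacts [hD α hα, hX s hs₀]
      _ = _ := by ring
  · calc _ ≤ A / s ^ k + ‖S‖ * ‖X‖ := norm_bornResolvent₂₂_le h hs₀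
      _ ≤ A * (s ^ ((1 - ν) * e) / s ^ k) + C * (C' * (s ^ ((1 - ν) * e) / s ^ k)) := by
          rw [mul_div_assoc']
          gcongr
          exacts [le_mul_of_one_le_right (by positivity) (one_le_pow₀ hs1), hX s hs₀]
      _ = _ := by ring
  · calc _ ≤ ‖cutoffOp Ω χ ∘L (shiftedKernel Ω k a s).starProjection‖ * ‖S‖ :=
          ContinuousLinearMap.opNorm_comp_le
            (cutoffOp Ω χ ∘L (shiftedKernel Ω k a s).starProjection) S
      _ ≤ Cχ χ / s ^ k * C := by
          gcongr
          exacts [div_nonneg (hCχ χ) (by positivity), hχ χ s hs₀]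
      _ = _ := by ring

theorem rpow_one_div_pow {lam : ℝ} (hlam : 0 ≤ lam) (k j : ℕ) :
    (lam ^ (1 / (k : ℝ))) ^ j = lam ^ ((j : ℝ) / k) := by
  rw [← Real.rpow_mul_natCast hlam, one_div_mul_eq_div]

theorem le_mul_rpow_of_exponent_le {b C x y lam : ℝ} (hb : 0 ≤ b) (hlam : 1 ≤ lam) (hxy : x ≤ y)
    (h : b ≤ C * lam ^ x) : b ≤ C * lam ^ y := by
  have hpos : 0 < lam ^ x := Real.rpow_pos_of_pos (zero_lt_one.trans_le hlam) x
  exact h.trans (mul_le_mul_of_nonneg_left (Real.rpow_le_rpow_of_exponent_le hlam hxy)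
    (nonneg_of_mul_nonneg_left (hb.trans h) hpos))

end

-- For `ν ≥ 1` the truncated difference `1 - ν` in the exponents is `0`.
theorem proposition1_general {n : ℕ} (k : ℕ) (hk : 1 ≤ k)
    (a : (Fin n → ℕ) → ℂ) (hell : IsEllipticOp k a) (hsa : IsFormallySelfAdjointOp k a)
    (hbb : IsBoundedBelowOp k a)
    (Ω : Opens (Rn n)) (hbd : Bornology.IsBounded (Ω : Set (Rn n)))
    (V : Rn n → ℂ) (hV : MemLp V ∞ (volume.restrict (Ω : Set (Rn n))))
    (hVc : CoerciveNearBoundary Ω V)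
    (e : ℕ) (he : e < k) (W : (Fin n → ℕ) → Rn n → ℂ)
    (hW : ∀ α ∈ multiIndices n 1 e, MemLp (W α) ∞ (volume.restrict (Ω : Set (Rn n))))
    (hWK : ∀ α ∈ multiIndices n 1 e, ∃ K : Set (Rn n), IsCompact K ∧ K ⊆ Ω ∧
      ∀ᵐ x ∂volume.restrict (Ω : Set (Rn n)), x ∉ K → W α x = 0)
    (μ ν : ℕ) :
    ∃ lam₀ : ℝ, 1 ≤ lam₀ ∧
    ∃ R₁₁ R₁₂ R₂₁ R₂₂ : ℝ → (L2 Ω →L[ℂ] L2 Ω),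
    ∃ D₁₁ D₁₂ : (Fin n → ℕ) → ℝ → (L2 Ω →L[ℂ] L2 Ω),
    ∃ cR₂₁ cR₂₂ : 𝓓(Ω, ℂ) → ℝ → (L2 Ω →L[ℂ] L2 Ω),
      (∀ lam : ℝ, lam₀ ≤ lam →
        IsBornResolvent Ω k e a W V μ ν lam (R₁₁ lam) (R₁₂ lam) (R₂₁ lam) (R₂₂ lam)
          (D₁₁ · lam) (D₁₂ · lam) (cR₂₁ · lam) (cR₂₂ · lam)) ∧
      (∃ C : ℝ, ∀ lam : ℝ, lam₀ ≤ lam → ∀ α : Fin n → ℕ, mlen α ≤ k →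
        ‖D₁₁ α lam‖ ≤ C * lam ^ ((mlen α : ℝ) / k - 1)) ∧
      (∃ C : ℝ, ∀ lam : ℝ, lam₀ ≤ lam → ∀ α : Fin n → ℕ, mlen α ≤ k →
        ‖D₁₂ α lam‖ ≤ C * lam ^ (((1 - ν : ℕ) : ℝ) * e / k + (mlen α : ℝ) / k - 2)) ∧
      (∃ C : ℝ, ∀ lam : ℝ, lam₀ ≤ lam →
        ‖R₂₂ lam‖ ≤ C * lam ^ (((1 - ν : ℕ) : ℝ) * e / k - 1)) ∧
      (∃ C : ℝ, ∀ lam : ℝ, lam₀ ≤ lam → ‖R₂₁ lam‖ ≤ C) ∧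
      (∀ χ : 𝓓(Ω, ℂ), ∃ C : ℝ, ∀ lam : ℝ, lam₀ ≤ lam →
        ‖cR₂₁ χ lam‖ ≤ C * lam ^ (-1 : ℝ)) := by
  obtain ⟨c, s₀, h⟩ := exists_isCoerciveSymbol hk hell hsa hbb
  obtain ⟨s₁, hs₁, C₁₁, C₁₂, C₂₁, C₂₂, C, hR⟩ :=
    exists_isBornResolvent h hbd he hW hWK hV hVc μ ν
  choose! R₁₁ R₁₂ R₂₁ R₂₂ D₁₁ D₁₂ cR₂₁ cR₂₂ hR h₁₁ h₁₂ h₂₁ h₂₂ hχ using hR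
  have hpos {lam : ℝ} (hl : s₁ ^ k ≤ lam) : 0 < lam :=
    zero_lt_one.trans_le ((one_le_pow₀ hs₁).trans hl)
  have hpow {lam : ℝ} (hl : s₁ ^ k ≤ lam) := rpow_one_div_pow (hpos hl).le k
  have hself {lam : ℝ} (hl : s₁ ^ k ≤ lam) : (lam ^ (1 / (k : ℝ))) ^ k = lam := by
    rw [hpow hl, div_self (by positivity), Real.rpow_one]
  have hroot {lam : ℝ} (hl : s₁ ^ k ≤ lam) : s₁ ≤ lam ^ (1 / (k : ℝ)) :=
    le_of_pow_le_pow_left₀ (by omega) (Real.rpow_nonneg (hpos hl).le _)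
      (hl.trans_eq (hself hl).symm)
  refine ⟨s₁ ^ k, one_le_pow₀ hs₁, fun lam => R₁₁ (lam ^ (1 / (k : ℝ))),
    fun lam => R₁₂ (lam ^ (1 / (k : ℝ))), fun lam => R₂₁ (lam ^ (1 / (k : ℝ))),
    fun lam => R₂₂ (lam ^ (1 / (k : ℝ))), fun α lam => D₁₁ (lam ^ (1 / (k : ℝ))) α,
    fun α lam => D₁₂ (lam ^ (1 / (k : ℝ))) α, fun χ lam => cR₂₁ (lam ^ (1 / (k : ℝ))) χ,
    fun χ lam => cR₂₂ (lam ^ (1 / (k : ℝ))) χ, fun lam hl => ?_,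
    ⟨C₁₁, fun lam hl α hα => (h₁₁ _ (hroot hl) α hα).trans_eq ?_⟩,
    ⟨C₁₂, fun lam hl α hα => (h₁₂ _ (hroot hl) α hα).trans_eq ?_⟩,
    ⟨C₂₂, fun lam hl => (h₂₂ _ (hroot hl)).trans_eq ?_⟩,
    ⟨C₂₁, fun lam hl => h₂₁ _ (hroot hl)⟩,
    fun χ => ⟨C χ, fun lam hl => (hχ _ (hroot hl) χ).trans_eq ?_⟩⟩
  · simpa only [hself hl] using hR _ (hroot hl)
  · rw [hself hl, hpow hl, Real.rpow_sub_one (hpos hl).ne']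
  · rw [hself hl, hpow hl, hpow hl, ← Real.rpow_add (hpos hl), Nat.cast_mul, ← pow_two,
      Real.rpow_sub (hpos hl), Real.rpow_two]
  · rw [hself hl, hpow hl, Nat.cast_mul, Real.rpow_sub_one (hpos hl).ne']
  · rw [hself hl, Real.rpow_neg_one, div_eq_mul_inv]

theorem proposition1 {n : ℕ} (hn : 1 ≤ n) (k : ℕ) (hk : 1 ≤ k)
    (a : (Fin n → ℕ) → ℂ) (hell : IsEllipticOp k a) (hsa : IsFormallySelfAdjointOp k a)
    (hbb : IsBoundedBelowOp k a)
    (Ω : Opens (Rn n)) (hne : (Ω : Set (Rn n)).Nonempty)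
    (hbd : Bornology.IsBounded (Ω : Set (Rn n)))
    (V : Rn n → ℂ) (hV : MemLp V ∞ (volume.restrict (Ω : Set (Rn n))))
    (hVc : CoerciveNearBoundary Ω V)
    (e : ℕ) (he : e < k) (W : (Fin n → ℕ) → Rn n → ℂ)
    (hW : ∀ α ∈ multiIndices n 1 e, MemSobolevC Ω (mlen α) ∞ (W α))
    (μ ν : ℕ) (hμ : μ = 0 ∨ μ = 1) (hν : ν = 0 ∨ ν = 1) :
    ∃ lam₀ : ℝ, 0 < lam₀ ∧
    ∃ R₁₁ R₁₂ R₂₁ R₂₂ : ℝ → (L2 Ω →L[ℂ] L2 Ω),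
    ∃ D₁₁ D₁₂ : (Fin n → ℕ) → ℝ → (L2 Ω →L[ℂ] L2 Ω),
    ∃ cR₂₁ cR₂₂ : 𝓓(Ω, ℂ) → ℝ → (L2 Ω →L[ℂ] L2 Ω),
      (∀ lam : ℝ, lam₀ ≤ lam →
        -- `B` is a well-defined map on the whole of `H^k_0(Ω) × H^k_P(Ω)`
        (∀ u w : L2 Ω, MemH0 Ω k u → MemHP Ω k a w →
          ∃! q : L2 Ω × L2 Ω, BornGraph Ω k e a W V μ ν lam (u, w) q) ∧
        -- `B + lam` is bijective
        (∀ f g : L2 Ω, ∃! p : L2 Ω × L2 Ω,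
          BornGraph Ω k e a W V μ ν lam p (f - (lam : ℂ) • p.1, g - (lam : ℂ) • p.2)) ∧
        -- the matrix of the `R`'s is the inverse of `B + lam`
        (∀ f g : L2 Ω,
          BornGraph Ω k e a W V μ ν lam
            (R₁₁ lam f + R₁₂ lam g, R₂₁ lam f + R₂₂ lam g)
            (f - (lam : ℂ) • (R₁₁ lam f + R₁₂ lam g),
              g - (lam : ℂ) • (R₂₁ lam f + R₂₂ lam g))) ∧
        -- `D₁₁ α = ∂^α R₁₁`, `D₁₂ α = ∂^α R₁₂`, `cR₂₁ χ = χ R₂₁` and `cR₂₂ χ = χ R₂₂`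
        (∀ α : Fin n → ℕ, mlen α ≤ k →
          IsDerivOp Ω α (R₁₁ lam) (D₁₁ α lam) ∧ IsDerivOp Ω α (R₁₂ lam) (D₁₂ α lam)) ∧
        (∀ χ : 𝓓(Ω, ℂ),
          IsCutoffOp Ω χ (R₂₁ lam) (cR₂₁ χ lam) ∧ IsCutoffOp Ω χ (R₂₂ lam) (cR₂₂ χ lam)) ∧
        -- compactness
        IsCompactOperator (R₁₁ lam) ∧ IsCompactOperator (R₁₂ lam) ∧
        IsCompactOperator (R₂₂ lam) ∧
        (∀ χ : 𝓓(Ω, ℂ), IsCompactOperator (cR₂₁ χ lam)) ∧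
        (∀ α : Fin n → ℕ, 1 ≤ mlen α → mlen α < k →
          IsCompactOperator (D₁₁ α lam) ∧ IsCompactOperator (D₁₂ α lam) ∧
          ∀ χ : 𝓓(Ω, ℂ),
            (∃ T : L2 Ω →L[ℂ] L2 Ω,
              IsDerivOp Ω α (cR₂₁ χ lam) T ∧ IsCompactOperator T) ∧
            (∃ T : L2 Ω →L[ℂ] L2 Ω,
              IsDerivOp Ω α (cR₂₂ χ lam) T ∧ IsCompactOperator T))) ∧
      -- operator norm bounds
      (∃ C : ℝ, ∀ lam : ℝ, lam₀ ≤ lam → ∀ α : Fin n → ℕ, mlen α ≤ k →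
        ‖D₁₁ α lam‖ ≤ C * lam ^ ((mlen α : ℝ) / k - 1)) ∧
      (∀ ε : ℝ, 0 < ε → ∃ C : ℝ, ∀ lam : ℝ, lam₀ ≤ lam → ∀ α : Fin n → ℕ, mlen α ≤ k →
        ‖D₁₂ α lam‖ ≤ C * lam ^ (ε + (1 - (ν : ℝ)) * e / k + (mlen α : ℝ) / k - 2)) ∧
      (∀ ε : ℝ, 0 < ε → ∃ C : ℝ, ∀ lam : ℝ, lam₀ ≤ lam →
        ‖R₂₂ lam‖ ≤ C * lam ^ (ε + (e : ℝ) / k - 1)) ∧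
      (∃ C : ℝ, ∀ lam : ℝ, lam₀ ≤ lam → ‖R₂₁ lam‖ ≤ C) ∧
      (∀ χ : 𝓓(Ω, ℂ), ∃ C : ℝ, ∀ lam : ℝ, lam₀ ≤ lam →
        ‖cR₂₁ χ lam‖ ≤ C * lam ^ (-(1 : ℝ) / k)) := by
  obtain ⟨lam₀, hlam₀, R₁₁, R₁₂, R₂₁, R₂₂, D₁₁, D₁₂, cR₂₁, cR₂₂, hR, h₁₁, ⟨C₁₂, h₁₂⟩, ⟨C₂₂, h₂₂⟩,
    h₂₁, hχ⟩ := proposition1_general k hk a hell hsa hbb Ω hbd V hV hVc e he W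
      (fun α hα => (hW α hα).1) (fun α hα => (hW α hα).2.2) μ ν
  have hν1 : ν ≤ 1 := by omega
  refine ⟨lam₀, zero_lt_one.trans_le hlam₀, R₁₁, R₁₂, R₂₁, R₂₂, D₁₁, D₁₂, cR₂₁, cR₂₂, hR, h₁₁,
    fun ε hε => ⟨C₁₂, fun lam hl α hα => le_mul_rpow_of_exponent_le (norm_nonneg _)
      (hlam₀.trans hl) ?_ (h₁₂ lam hl α hα)⟩,
    fun ε hε => ⟨C₂₂, fun lam hl => le_mul_rpow_of_exponent_le (norm_nonneg _)
      (hlam₀.trans hl) ?_ (h₂₂ lam hl)⟩,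
    h₂₁, fun χ => (hχ χ).imp fun C hC lam hl => le_mul_rpow_of_exponent_le (norm_nonneg _)
      (hlam₀.trans hl) ?_ (hC lam hl)⟩
  · rw [Nat.cast_sub hν1, Nat.cast_one]
    linarith
  · have hle : ((1 - ν : ℕ) : ℝ) * e / k ≤ e / k := by
      gcongr
      exact mul_le_of_le_one_left (Nat.cast_nonneg e) (mod_cast Nat.sub_le 1 ν)
    linarith
  · rw [neg_div, neg_le_neg_iff]
    exact div_le_one_of_le₀ (mod_cast hk) (Nat.cast_nonneg k)
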